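/- **Setting.** Fix $p\ge 0$, $\tau\in(0,\infty)$, a baseline hazard $\lambda_0\ge 0$ with $\int_0^\tau\lambda_0(t)\,dt<\infty$, $\beta_0\in\mathbb R^p$ and a bounded set $F\subset\mathbb R^p$. For each sample size $n$ let $N_1,\dots,N_n$ be counting processes on $[0,\tau]$, adapted to a filtration, each with at most one jump and almost surely without common jumps, let $Y_i(t)\in\{0,1\}$ be predictable at-risk indicators and $X_i(t)\in F$ predictable covariates, such that $N_i$ has intensity $Y_i(t)\lambda_0(t)\exp(X_i(t)'\beta_0)$, i.e. $N_i(t)-\int_0^tY_i(s)\lambda_0(s)\exp(X_i(s)'\beta_0)\,ds$ is a martingale on $[0,\tau]$. Let $\mathcal D_n=\sigma\{N_i(s),Y_i(s),X_i(s):0\le s\le\tau,\ i\le n\}$ be the data, and assume that $Y_i$ and $X_i$ are jointly measurable in $(t,\omega)$ with respect to the Borel sets of $[0,\tau]$ and $\mathcal D_n$. With $x^{\otimes 0}=1$, $x^{\otimes1}=x$, $x^{\otimes2}=xx'$ put $$S_k(t,\beta)=\sum_{i=1}^n X_i(t)^{\otimes k}Y_i(t)e^{X_i(t)'\beta}\ (k=0,1,2),\qquad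 E(t,\beta)=S_1(t,\beta)/S_0(t,\beta)$$ ($E=0$ where $S_0=0$). Let $U_\tau(\beta)=\sum_i\int_0^\tau[X_i(t)-E(t,\beta)]\,dN_i(t)$ and let $\hat\beta$ be $\mathcal D_n$-measurable with $U_\tau(\hat\beta)=0$ almost surely whenever $U_\tau$ has a zero. **Condition 1.** There are an open neighbourhood $B$ of $\beta_0$ and functions $s_0,s_1,s_2$ on $[0,\tau]\times B$ with values in $\mathbb R,\mathbb R^p,\mathbb R^{p\times p}$ such that: (a) $\sup_{\beta\in B,\,t\in[0,\tau]}|n^{-1}S_k(t,\beta)-s_k(t,\beta)|\to0$ in probability as $n\to\infty$, $k=0,1,2$; (b) each $s_k$ is continuous in $\beta\in B$ uniformly in $t\in[0,\tau]$, and bounded; (c) $s_0(\cdot,\beta_0)$ is bounded away from zero on $[0,\tau]$; (d) $s_{k+1}=\partial s_k/\partial\beta$ for $k=0,1$; (e) $\Sigma=\int_0^\tau v(t,\beta_0)s_0(t,\beta_0)\lambda_0(t)\,dt$ is positive definite, where $v=s_2/s_0-(s_1/s_0)^{\otimes2}$. **Resampling.** For each $n$ let $G_1,\dots,G_n$ be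 i.i.d. with mean $0$ and variance $1$, independent of $\mathcal D_n$, with a distribution that does not depend on $n$. Put $$U^{c}_\tau(\beta)=\sum_iG_i\int_0^\tau[X_i-E(t,\beta)]\,dN_i(t),\qquad I^*_\tau(\beta)=\sum_iG_i^2\int_0^\tau[X_i-E(t,\beta)]^{\otimes2}\,dN_i(t),$$ $$U^*_\tau(\beta)=\sum_i(G_i+1)\int_0^\tau[X_i-E(t,\beta)]\,dN_i(t).$$ In the classical scheme the resampled score at $\hat\beta$ is $U^c_\tau(\hat\beta)$ and $\hat\beta^*$ is given by $\sqrt n(\hat\beta^*-\hat\beta)=(n^{-1}I^*_\tau(\hat\beta))^{-1}n^{-1/2}U^c_\tau(\hat\beta)$ (put $\hat\beta^*=\hat\beta$ if $I^*_\tau(\hat\beta)$ is singular). In the score-equation scheme the resampled score at $\hat\beta$ is $U^*_\tau(\hat\beta)$ and $\hat\beta^*$ is any measurable random vector with $U^*_\tau(\hat\beta^*)=0$ almost surely whenever $U^*_\tau$ has a zero. For $b=(b_1,\dots,b_p)$, let $\tilde DU^*_\tau(b)$ be the $p\times p$ matrix whose $a$-th row is the gradient of the $a$-th component of $U^*_\tau$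 at $b_a$. **Lemma.** Under Condition 1, as $n\to\infty$: 1. for either scheme, the conditional distribution given $\mathcal D_n$ of $n^{-1/2}$ times the resampled score at $\hat\beta$ converges weakly to $N(0,\Sigma)$, in probability: for every bounded continuous $f$, the conditional expectation of $f$ of this vector converges to $\int f\,dN(0,\Sigma)$ in probability; 2. if the random vectors $\tilde\beta_1,\dots,\tilde\beta_p$ (for instance intermediate points between $\hat\beta^*$ and $\hat\beta$, in either scheme) converge to $\beta_0$ in probability, then $-n^{-1}\tilde DU^*_\tau(\tilde\beta_1,\dots,\tilde\beta_p)\to\Sigma$ in conditional probability given $\mathcal D_n$, in probability; also $n^{-1}I^*_\tau(\hat\beta)\to\Sigma$ in the same sense; 3. for either scheme, $\|\hat\beta^*-\hat\beta\|\to0$ in conditional probability given $\mathcal D_n$, in probability, i.e. $P(\|\hat\beta^*-\hat\beta\|\ge\varepsilon\mid\mathcal D_n)\to0$ in probability for every $\varepsilon>0$. -/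

import Mathlib

open Filter Topology MeasureTheory ProbabilityTheory
open scoped NNReal ENNReal BoundedContinuousFunction

noncomputable section

namespace WildBootstrap

/-- Covariate and parameter space `ℝᵖ`. -/
abbrev Vec (p : ℕ) := EuclideanSpace ℝ (Fin p)

/-- The matrix `x ⊗ x = x xᵀ`. -/
def outer {p : ℕ} (x : Vec p) : Matrix (Fin p) (Fin p) ℝ := Matrix.of fun a b => x a * x b

/-- A matrix acting on `ℝᵖ`. -/
def matAct {p : ℕ} (A : Matrix (Fin p) (Fin p) ℝ) : Vec p →L[ℝ] Vec p :=
  Matrix.toEuclideanCLM (𝕜 := ℝ) A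

/-- `∫₀ᵗ f(s) ds` for a function of the time variable `s ≥ 0`. -/
def timeIntegral (t : ℝ≥0) (f : ℝ≥0 → ℝ) : ℝ := ∫ s in (0 : ℝ)..t, f s.toNNReal

/-- The observable processes of `n` individuals: counting processes `N i`, at-risk indicators `Y i`
and `p`-dimensional covariate processes `X i`. -/
structure SurvivalData (Ω : Type*) (n p : ℕ) where
  N : Fin n → ℝ≥0 → Ω → ℕ
  Y : Fin n → ℝ≥0 → Ω → ℝ
  X : Fin n → ℝ≥0 → Ω → Vec p

namespace SurvivalData

variable {Ω : Type*} {n p : ℕ} (D : SurvivalData Ω n p)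

/-- Jump times in `(0, τ]` of the path `t ↦ N i t ω` (nondecreasing, integer valued). -/
def jumpTimes (τ : ℝ≥0) (i : Fin n) (ω : Ω) : Set ℝ≥0 :=
  {t | 0 < t ∧ t ≤ τ ∧ ∀ s < t, D.N i s ω < D.N i t ω}

/-- `∫₀^τ H(t) dN_i(t)`, the sum of `H` over the (unit) jumps of `N i` in `(0, τ]`. -/
def intN {E : Type*} [AddCommMonoid E] (τ : ℝ≥0) (i : Fin n) (ω : Ω) (H : ℝ≥0 → E) : E :=
  ∑ᶠ t ∈ D.jumpTimes τ i ω, H t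

/-- The relative risk of individual `i`: `Y_i(t) exp(X_i(t)ᵀ β)`. -/
def risk (i : Fin n) (t : ℝ≥0) (β : Vec p) (ω : Ω) : ℝ :=
  D.Y i t ω * Real.exp (inner ℝ (D.X i t ω) β)

def S0 (t : ℝ≥0) (β : Vec p) (ω : Ω) : ℝ := ∑ i, D.risk i t β ω

def S1 (t : ℝ≥0) (β : Vec p) (ω : Ω) : Vec p := ∑ i, D.risk i t β ω • D.X i t ω

def S2 (t : ℝ≥0) (β : Vec p) (ω : Ω) : Matrix (Fin p) (Fin p) ℝ :=
  ∑ i, D.risk i t β ω • outer (D.X i t ω)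

/-- `E(t, β) = S₁ / S₀`; it is `0` when nobody is at risk (there `S₀ = 0`). -/
def Ebar (t : ℝ≥0) (β : Vec p) (ω : Ω) : Vec p := (D.S0 t β ω)⁻¹ • D.S1 t β ω

/-- The score `U_τ(β) = ∑ᵢ ∫₀^τ [X_i(t) - E(t, β)] dN_i(t)`. -/
def score (τ : ℝ≥0) (β : Vec p) (ω : Ω) : Vec p :=
  ∑ i, D.intN τ i ω fun t => D.X i t ω - D.Ebar t β ω

/-- `∑ᵢ G_i ∫₀^τ [X_i(t) - E(t, β)] dN_i(t)`, the resampled score of the classical scheme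
(used there at `β = β̂`). -/
def classicalScore (τ : ℝ≥0) (G : Fin n → Ω → ℝ) (β : Vec p) (ω : Ω) : Vec p :=
  ∑ i, G i ω • D.intN τ i ω fun t => D.X i t ω - D.Ebar t β ω

/-- `I*_τ(β) = ∑ᵢ G_i² ∫₀^τ [X_i(t) - E(t, β)]^{⊗2} dN_i(t)`. -/
def classicalInfo (τ : ℝ≥0) (G : Fin n → Ω → ℝ) (β : Vec p) (ω : Ω) :
    Matrix (Fin p) (Fin p) ℝ :=
  ∑ i, (G i ω) ^ 2 • D.intN τ i ω fun t => outer (D.X i t ω - D.Ebar t β ω)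

/-- The classical wild bootstrap estimator `β̂*`, given by
`√n (β̂* - β̂) = (I*_τ(β̂) / n)⁻¹ n^{-1/2} U*_τ(β̂)`. -/
def classicalEstimator (τ : ℝ≥0) (G : Fin n → Ω → ℝ) (βhat : Ω → Vec p) (ω : Ω) : Vec p :=
  βhat ω + (Real.sqrt n)⁻¹ • matAct (((n : ℝ)⁻¹ • D.classicalInfo τ G (βhat ω) ω)⁻¹)
    ((Real.sqrt n)⁻¹ • D.classicalScore τ G (βhat ω) ω)

/-- The wild bootstrap score function
`U*_τ(β) = ∑ᵢ (G_i + 1) ∫₀^τ [X_i(t) - E(t, β)] dN_i(t)`. -/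
def bootScore (τ : ℝ≥0) (G : Fin n → Ω → ℝ) (β : Vec p) (ω : Ω) : Vec p :=
  ∑ i, (G i ω + 1) • D.intN τ i ω fun t => D.X i t ω - D.Ebar t β ω

/-- The mean-value Jacobian of `U*_τ`: row `a` is the gradient of the `a`-th component of `U*_τ`,
evaluated at its own point `b a`. -/
def bootJacobian (τ : ℝ≥0) (G : Fin n → Ω → ℝ) (b : Fin p → Vec p) (ω : Ω) :
    Matrix (Fin p) (Fin p) ℝ :=
  Matrix.of fun a c => gradient (fun β => D.bootScore τ G β ω a) (b a) c

/-- The σ-algebra of all observations on `[0, τ]`. -/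
abbrev obs (τ : ℝ≥0) : MeasurableSpace Ω :=
  ⨆ i : Fin n, ⨆ t : Set.Icc (0 : ℝ≥0) τ,
    MeasurableSpace.comap (D.N i t) inferInstance ⊔ MeasurableSpace.comap (D.Y i t) inferInstance ⊔
      MeasurableSpace.comap (D.X i t) inferInstance

end SurvivalData

/-- `Z` restricted to `[0, τ] × Ω` is measurable for (Borel sets) ⊗ `m`. -/
def JointlyMeasurable {Ω E : Type*} [MeasurableSpace E] (m : MeasurableSpace Ω) (τ : ℝ≥0)
    (Z : ℝ≥0 → Ω → E) : Prop :=
  Measurable[(inferInstance : MeasurableSpace (Set.Icc (0 : ℝ≥0) τ)).prod m]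
    (fun q : Set.Icc (0 : ℝ≥0) τ × Ω => Z q.1 q.2)

/-- The Cox model on `[0, τ]` for `n` individuals, with respect to the filtration `ℱ`: `N` is a
multivariate counting process with at most one event per individual, and `N i` has the intensity
process `Y_i(t) λ₀(t) exp(X_i(t)ᵀ β₀)`. -/
structure IsCoxModel {Ω : Type*} [mΩ : MeasurableSpace Ω] (μ : Measure Ω) {n p : ℕ}
    (D : SurvivalData Ω n p) (ℱ : Filtration ℝ≥0 mΩ) (τ : ℝ≥0) (haz : ℝ≥0 → ℝ) (β₀ : Vec p)
    (F : Set (Vec p)) : Prop where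
  N_adapted : ∀ i, ∀ t ≤ τ, Measurable[ℱ t] (D.N i t)
  N_zero : ∀ i ω, D.N i 0 ω = 0
  N_mono : ∀ i ω, MonotoneOn (fun t => D.N i t ω) (Set.Icc 0 τ)
  N_rightCont : ∀ i ω, ∀ t < τ, ContinuousWithinAt (fun s => D.N i s ω) (Set.Ici t) t
  N_le_one : ∀ i ω, D.N i τ ω ≤ 1
  no_common_jumps : ∀ i j, i ≠ j →
    ∀ᵐ ω ∂μ, Disjoint (D.jumpTimes τ i ω) (D.jumpTimes τ j ω)
  Y_indicator : ∀ i, ∀ t ≤ τ, ∀ ω, D.Y i t ω = 0 ∨ D.Y i t ω = 1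
  X_mem : ∀ i, ∀ t ≤ τ, ∀ ω, D.X i t ω ∈ F
  Y_predictable : ∀ i, IsStronglyPredictable ℱ (D.Y i)
  X_predictable : ∀ i, IsStronglyPredictable ℱ (D.X i)
  Y_jointly : ∀ i, JointlyMeasurable (D.obs τ) τ (D.Y i)
  X_jointly : ∀ i, JointlyMeasurable (D.obs τ) τ (D.X i)
  martingale : ∀ i, Martingale
    (fun t ω => (D.N i (min t τ) ω : ℝ) -
      timeIntegral (min t τ) fun s => D.Y i s ω * haz s * Real.exp (inner ℝ (D.X i s ω) β₀)) ℱ μ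

/-- The entries of `v(t, β) = s₂ s₀⁻¹ - (s₁ s₀⁻¹)^{⊗2}`. -/
def limitV {p : ℕ} (s0 : ℝ≥0 → Vec p → ℝ) (s1 : ℝ≥0 → Vec p → Vec p)
    (s2 : ℝ≥0 → Vec p → Matrix (Fin p) (Fin p) ℝ) (t : ℝ≥0) (β : Vec p) :
    Matrix (Fin p) (Fin p) ℝ :=
  (s0 t β)⁻¹ • s2 t β - outer ((s0 t β)⁻¹ • s1 t β)

/-- `Σ_τ = ∫₀^τ v(t, β₀) s₀(t, β₀) λ₀(t) dt`, entry by entry. -/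
def limitSigma {p : ℕ} (τ : ℝ≥0) (haz : ℝ≥0 → ℝ) (β₀ : Vec p) (s0 : ℝ≥0 → Vec p → ℝ)
    (s1 : ℝ≥0 → Vec p → Vec p) (s2 : ℝ≥0 → Vec p → Matrix (Fin p) (Fin p) ℝ) :
    Matrix (Fin p) (Fin p) ℝ :=
  Matrix.of fun a b =>
    timeIntegral τ fun t => limitV s0 s1 s2 t β₀ a b * s0 t β₀ * haz t

/-- `sup_{β ∈ B, t ∈ [0, τ]} Z n t β → 0` in (outer) probability. Note that the supremum exceeds
`ε` exactly when one of the values does. -/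
def SupTendstoZero {Ω : Type*} [MeasurableSpace Ω] (μ : Measure Ω) {p : ℕ} (τ : ℝ≥0)
    (B : Set (Vec p)) (Z : ℕ → ℝ≥0 → Vec p → Ω → ℝ) : Prop :=
  ∀ ε : ℝ, 0 < ε →
    Tendsto (fun n => μ {ω | ∃ t ≤ τ, ∃ β ∈ B, ε < Z n t β ω}) atTop (𝓝 0)

/-- `f(t, ·)` is continuous on `B` uniformly in `t ∈ [0, τ]`, and `f` is bounded on
`[0, τ] × B`. -/
def UnifContBounded {p : ℕ} {E : Type*} [NormedAddCommGroup E] (τ : ℝ≥0) (B : Set (Vec p))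
    (f : ℝ≥0 → Vec p → E) : Prop :=
  (∀ β ∈ B, ∀ ε : ℝ, 0 < ε → ∃ δ : ℝ, 0 < δ ∧
    ∀ β' ∈ B, ‖β' - β‖ < δ → ∀ t ≤ τ, ‖f t β' - f t β‖ < ε) ∧
  ∃ C : ℝ, ∀ t ≤ τ, ∀ β ∈ B, ‖f t β‖ ≤ C

/-- The regularity conditions on the sums `S_k` and their limits `s_k` on a neighbourhood `B` of
`β₀`. Matrices are compared entry by entry. -/
structure RegularityConditions {Ω : Type*} [MeasurableSpace Ω] (μ : Measure Ω) {p : ℕ}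
    (D : (n : ℕ) → SurvivalData Ω n p) (τ : ℝ≥0) (haz : ℝ≥0 → ℝ) (β₀ : Vec p)
    (B : Set (Vec p)) (s0 : ℝ≥0 → Vec p → ℝ) (s1 : ℝ≥0 → Vec p → Vec p)
    (s2 : ℝ≥0 → Vec p → Matrix (Fin p) (Fin p) ℝ) : Prop where
  isOpen : IsOpen B
  mem : β₀ ∈ B
  conv0 : SupTendstoZero μ τ B fun n t β ω => |(n : ℝ)⁻¹ * (D n).S0 t β ω - s0 t β|
  conv1 : SupTendstoZero μ τ B fun n t β ω => ‖(n : ℝ)⁻¹ • (D n).S1 t β ω - s1 t β‖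
  conv2 : ∀ a b, SupTendstoZero μ τ B fun n t β ω =>
    |(n : ℝ)⁻¹ * (D n).S2 t β ω a b - s2 t β a b|
  reg0 : UnifContBounded τ B s0
  reg1 : UnifContBounded τ B s1
  reg2 : ∀ a b, UnifContBounded τ B fun t β => s2 t β a b
  away : ∃ c : ℝ, 0 < c ∧ ∀ t ≤ τ, c ≤ s0 t β₀
  deriv0 : ∀ t ≤ τ, ∀ β ∈ B, HasGradientAt (s0 t) (s1 t β) β
  deriv1 : ∀ t ≤ τ, ∀ β ∈ B, HasFDerivAt (s1 t) (matAct (s2 t β)) β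
  posDef : (limitSigma τ haz β₀ s0 s1 s2).PosDef

/-- The multipliers `G i`: i.i.d. with law `ν`, jointly independent of the σ-algebra `m`. -/
structure IsMultiplier {Ω : Type*} (m : MeasurableSpace Ω) [MeasurableSpace Ω] (μ : Measure Ω)
    (ν : Measure ℝ) {n : ℕ} (G : Fin n → Ω → ℝ) : Prop where
  measurable : ∀ i, Measurable (G i)
  law : ∀ i, μ.map (G i) = ν
  indep : iIndepFun G μ
  indep_data : Indep (⨆ i, MeasurableSpace.comap (G i) inferInstance) m μ

/-- Convergence `Z n → 0` in conditional probability given `m n`, in probability: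
`P(|Z n| ≥ ε | m n) → 0` in probability for every `ε > 0`. -/
def CondTendstoZero {Ω : Type*} [MeasurableSpace Ω] (μ : Measure Ω) (m : ℕ → MeasurableSpace Ω)
    (Z : ℕ → Ω → ℝ) : Prop :=
  ∀ ε : ℝ, 0 < ε →
    TendstoInMeasure μ (fun n => μ⟦{ω | ε ≤ |Z n ω|} | m n⟧) atTop (fun _ => (0 : ℝ))

/-- The conditional law of `Z n` given `m n` converges weakly to `ρ`, in probability:
`E(f(Z n) | m n) → ∫ f dρ` in probability for every bounded continuous `f`. -/
def CondTendstoInLaw {Ω E : Type*} [MeasurableSpace Ω] [TopologicalSpace E] [MeasurableSpace E]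
    (μ : Measure Ω) (m : ℕ → MeasurableSpace Ω) (Z : ℕ → Ω → E) (ρ : Measure E) : Prop :=
  ∀ f : E →ᵇ ℝ,
    TendstoInMeasure μ (fun n => μ[fun ω => f (Z n ω) | m n]) atTop (fun _ => ∫ x, f x ∂ρ)

end WildBootstrap
end

/-! Reduction. A conditional probability has the unconditional one as its mean, so convergence in
probability already implies convergence in conditional probability (`condTendstoZero_of_tendsto`).
Except for the central limit theorem, everything is therefore shown unconditionally, as convergence
along the filter `probFilter`, where limits can be combined by the usual rules.

Event-time sums. Every counting process has at most one jump, so its integral of `H` is the value of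
`H` at a random time. For bounded predictable `H` the difference between the integral against the
counting process and the integral against its compensator has mean zero and is bounded uniformly in
the sample size. For two individuals these differences are orthogonal, because there are almost
surely no common jumps (`IsCoxModel.integral_mul_eq_zero`). Their averages thus vanish in mean
square, and an average over event times may be replaced by a time integral of risk-set sums, whose
limit follows from the regularity conditions. Consequently the score at the true parameter, divided
by `n`, tends to zero, while both the averaged risk-set covariance and the averaged product of
residuals tend to `Σ`: the last two have the same compensator.

Consistency. The score is the gradient of a concave function, the log partial likelihood. Along a
ray from the true parameter its radial component decreases, at a definite rate near the origin of
the ray because `Σ` is positive definite. So it points inwards outside any small ball, all its zeros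
lie in the ball, and a maximiser of the potential on the ball is a zero
(`eventually_inner_avgScore_le`, `exists_zero_and_norm_lt`). The resampled score is still a
gradient, but the weights `G i + 1` may be negative and concavity is lost. It is treated as a
perturbation of the score, which has to be small on the whole of the parameter space
(`eventually_abs_inner_avgScore_le`). Within a distance of order `log n` this follows from
Chebyshev's inequality on a grid of `O((log n) ^ p) = o(n)` points and a Lipschitz bound. Farther
out, exponentially weighted averages have nearly reached their limit along the ray.

Resampled information. The matrix `I*` and the Jacobian of the resampled score are averages weighted
by `G i ^ 2` and `G i + 1`. Their centred multiplier parts vanish by a weak law with data-dependent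
bounded weights; as `G i ^ 2 - 1` is only integrable, that law rests on truncation
(`tendsto_multiplier_average`). The remainders tend to `Σ`, also at random points tending to the
true parameter, by Lipschitz continuity.

Normality. Given the data, the classical resampled score is a linear combination of i.i.d.
multipliers with fixed, uniformly small coefficients whose covariance is close to `Σ`. A central
limit theorem that is uniform in such coefficients, together with integrating out the multipliers
for fixed data, gives the conditional limit (`condTendstoInLaw_multiplier`). At the estimator the
two resampled scores differ by the score itself, which is zero with probability tending to one. -/

noncomputable section

namespace WildBootstrap

/-! ### Convergence in probability as convergence along a filter -/

/-- The filter of the sets `S ⊆ ℕ × Ω` whose sections have probability tending to one. Convergence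
along it is convergence in (outer) probability. -/
def probFilter {Ω : Type*} [MeasurableSpace Ω] (μ : Measure Ω) : Filter (ℕ × Ω) where
  sets := {S | Tendsto (fun n => μ {ω | (n, ω) ∉ S}) atTop (𝓝 0)}
  univ_sets := by simp
  sets_of_superset {S T} hS hST := by
    refine tendsto_of_tendsto_of_tendsto_of_le_of_le tendsto_const_nhds hS (fun _ => zero_le)
      fun n => measure_mono fun ω hω h => hω (hST h)
  inter_sets {S T} hS hT := by
    have h := (show Tendsto _ _ _ from hS).add (show Tendsto _ _ _ from hT)
    rw [add_zero] at h
    refine tendsto_of_tendsto_of_tendsto_of_le_of_le tendsto_const_nhds h (fun _ => zero_le)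
      fun n => (measure_mono ?_).trans (measure_union_le _ _)
    intro ω hω
    by_contra hc
    simp only [Set.mem_union, Set.mem_ofPred_eq, not_or, not_not] at hc
    exact hω ⟨hc.1, hc.2⟩

section ProbFilter

variable {Ω : Type*} [mΩ : MeasurableSpace Ω] {μ : Measure Ω}

lemma eventually_probFilter {P : ℕ × Ω → Prop} :
    (∀ᶠ q in probFilter μ, P q) ↔ Tendsto (fun n => μ {ω | ¬ P (n, ω)}) atTop (𝓝 0) := Iff.rfl

lemma tendsto_fst_probFilter : Tendsto Prod.fst (probFilter μ) atTop := by
  intro S hS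
  change Tendsto _ _ _
  refine tendsto_const_nhds.congr' ?_
  filter_upwards [hS] with n hn
  have : {ω : Ω | (n, ω) ∉ Prod.fst ⁻¹' S} = ∅ := by
    ext ω; simpa using hn
  rw [this, measure_empty]

lemma eventually_probFilter_of_ae {P : ℕ → Ω → Prop} (h : ∀ n, ∀ᵐ ω ∂μ, P n ω) :
    ∀ᶠ q in probFilter μ, P q.1 q.2 := by
  rw [eventually_probFilter]
  refine tendsto_const_nhds.congr fun n => ?_
  exact (h n).symm

lemma tendstoInMeasure_iff_probFilter {E : Type*} [PseudoMetricSpace E] {Z : ℕ → Ω → E} {z : E} :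
    TendstoInMeasure μ Z atTop (fun _ => z) ↔
      Tendsto (fun q : ℕ × Ω => Z q.1 q.2) (probFilter μ) (𝓝 z) := by
  rw [tendstoInMeasure_iff_dist, Metric.tendsto_nhds]
  simp only [eventually_probFilter, not_lt]

/-- Nontriviality allows a single sample to be picked from an eventual statement, as is done in
`tendsto_timeIntegral`. -/
lemma probFilter_neBot [IsProbabilityMeasure μ] : (probFilter μ).NeBot := by
  refine ⟨fun h => ?_⟩
  have h0 : ∀ᶠ q in probFilter μ, False := by
    rw [h]; exact Filter.eventually_bot
  rw [eventually_probFilter] at h0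
  simp only [not_false_eq_true, Set.ofPred_true, measure_univ] at h0
  exact one_ne_zero (tendsto_nhds_unique tendsto_const_nhds h0)

/-- Convergence in mean implies convergence in probability. -/
lemma tendsto_probFilter_of_integral_le [IsFiniteMeasure μ] {Z : ℕ → Ω → ℝ} {c : ℕ → ℝ}
    (hZ : ∀ n, Integrable (Z n) μ) (h : ∀ n, ∫ ω, |Z n ω| ∂μ ≤ c n) (hc : Tendsto c atTop (𝓝 0)) :
    Tendsto (fun q : ℕ × Ω => Z q.1 q.2) (probFilter μ) (𝓝 0) := by
  rw [Metric.tendsto_nhds]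
  intro ε hε
  rw [eventually_probFilter]
  have h1 : Tendsto (fun n => ENNReal.ofReal (c n / ε)) atTop (𝓝 0) := by
    have := ENNReal.tendsto_ofReal (hc.div_const ε)
    simpa using this
  refine tendsto_of_tendsto_of_tendsto_of_le_of_le tendsto_const_nhds h1 (fun _ => zero_le)
    fun n => ?_
  simp only [Real.dist_eq, sub_zero, not_lt]
  have h2 := mul_meas_ge_le_integral_of_nonneg (μ := μ) (f := fun ω => |Z n ω|)
    (Eventually.of_forall fun ω => abs_nonneg _) (hZ n).abs ε
  rw [← ofReal_measureReal]
  refine ENNReal.ofReal_le_ofReal ?_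
  rw [le_div_iff₀ hε]
  linarith [h n, h2]

/-- Chebyshev's inequality in terms of a bound on the second moment. -/
lemma measure_le_of_integral_sq_le [IsFiniteMeasure μ] {Z : Ω → ℝ} {c ε : ℝ} (hε : 0 < ε)
    (hZ : Integrable (fun ω => Z ω ^ 2) μ) (h : ∫ ω, Z ω ^ 2 ∂μ ≤ c) :
    μ {ω | ε ≤ |Z ω|} ≤ ENNReal.ofReal (c / ε ^ 2) := by
  have h2 := mul_meas_ge_le_integral_of_nonneg (μ := μ) (f := fun ω => Z ω ^ 2)
    (Eventually.of_forall fun ω => sq_nonneg _) hZ (ε ^ 2)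
  have : {ω | ε ≤ |Z ω|} = {ω | ε ^ 2 ≤ Z ω ^ 2} := by
    ext ω
    simp only [Set.mem_ofPred_eq]
    rw [← sq_abs (Z ω), sq_le_sq₀ hε.le (abs_nonneg _)]
  rw [this, ← ofReal_measureReal]
  refine ENNReal.ofReal_le_ofReal ?_
  rw [le_div_iff₀ (by positivity)]
  linarith [h2]

lemma tendsto_probFilter_of_integral_sq_le [IsFiniteMeasure μ] {Z : ℕ → Ω → ℝ} {c : ℕ → ℝ}
    (hZ : ∀ n, Integrable (fun ω => Z n ω ^ 2) μ) (h : ∀ n, ∫ ω, Z n ω ^ 2 ∂μ ≤ c n)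
    (hc : Tendsto c atTop (𝓝 0)) :
    Tendsto (fun q : ℕ × Ω => Z q.1 q.2) (probFilter μ) (𝓝 0) := by
  rw [Metric.tendsto_nhds]
  intro ε hε
  rw [eventually_probFilter]
  have h1 : Tendsto (fun n => ENNReal.ofReal (c n / ε ^ 2)) atTop (𝓝 0) := by
    have := ENNReal.tendsto_ofReal (hc.div_const (ε ^ 2))
    simpa using this
  refine tendsto_of_tendsto_of_tendsto_of_le_of_le tendsto_const_nhds h1 (fun _ => zero_le)
    fun n => ?_
  simp only [Real.dist_eq, sub_zero, not_lt]
  exact measure_le_of_integral_sq_le hε (hZ n) (h n)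

/-- Measurability of `s` is not needed: if its indicator is not integrable, the conditional
expectation is zero by convention and the inequality is trivial. -/
lemma integral_condExp_indicator_le {Ω : Type*} {m mΩ : MeasurableSpace Ω} {μ : Measure Ω}
    [IsProbabilityMeasure μ] (hm : m ≤ mΩ) (s : Set Ω) :
    ENNReal.ofReal (∫ ω, (μ⟦s | m⟧) ω ∂μ) ≤ μ s := by
  by_cases hi : Integrable (s.indicator fun _ => (1 : ℝ)) μ
  · rw [integral_condExp hm]
    have h0 : NullMeasurableSet s μ :=
      (aemeasurable_indicator_const_iff (1 : ℝ)).1 hi.aestronglyMeasurable.aemeasurable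
    rw [integral_indicator₀ h0]
    simp
  · rw [condExp_of_not_integrable hi]
    simp

/-- Conditional probabilities are nonnegative with mean at most the unconditional probability, so
they tend to zero in mean. This removes the conditioning from all claims except the convergence in
law. -/
lemma condTendstoZero_of_tendsto [IsProbabilityMeasure μ] {m : ℕ → MeasurableSpace Ω}
    (hm : ∀ n, m n ≤ mΩ) {Z : ℕ → Ω → ℝ}
    (hZ : Tendsto (fun q : ℕ × Ω => Z q.1 q.2) (probFilter μ) (𝓝 0)) :
    CondTendstoZero μ m Z := by
  intro ε hε
  rw [tendstoInMeasure_iff_probFilter]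
  have h0 : Tendsto (fun n => μ {ω | ε ≤ |Z n ω|}) atTop (𝓝 0) := by
    have := Metric.tendsto_nhds.1 hZ ε hε
    rw [eventually_probFilter] at this
    simpa [Real.dist_eq] using this
  have h1 : Tendsto (fun n => (μ {ω | ε ≤ |Z n ω|}).toReal) atTop (𝓝 0) := by
    have := (ENNReal.tendsto_toReal ENNReal.zero_ne_top).comp h0
    rwa [ENNReal.toReal_zero] at this
  refine tendsto_probFilter_of_integral_le (Z := fun n => μ⟦{ω | ε ≤ |Z n ω|} | m n⟧)
    (fun n => integrable_condExp) (fun n => ?_) h1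
  have hnn : 0 ≤ᵐ[μ] μ⟦{ω | ε ≤ |Z n ω|} | m n⟧ :=
    condExp_nonneg (Eventually.of_forall fun ω => Set.indicator_nonneg (fun _ _ => zero_le_one) _)
  rw [integral_congr_ae (g := μ⟦{ω | ε ≤ |Z n ω|} | m n⟧)]
  · rw [← ENNReal.ofReal_le_iff_le_toReal (measure_ne_top _ _)]
    exact integral_condExp_indicator_le (hm n) _
  · filter_upwards [hnn] with ω hω using abs_of_nonneg hω

end ProbFilter

/-! ### Exponentially weighted averages and their derivatives -/

section WeightedAverage

variable {ι : Type*} [Fintype ι] {p : ℕ}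

/-- `∑ⱼ fⱼ wⱼ exp(xⱼᵀ β)`. -/
def wsum (w : ι → ℝ) (x : ι → Vec p) (f : ι → ℝ) (β : Vec p) : ℝ :=
  ∑ j, f j * (w j * Real.exp (inner ℝ (x j) β))

/-- The average of `f` with weights `wⱼ exp(xⱼᵀ β)`. -/
def wavg (w : ι → ℝ) (x : ι → Vec p) (f : ι → ℝ) (β : Vec p) : ℝ :=
  (wsum w x (fun _ => 1) β)⁻¹ * wsum w x f β

/-- The covariance of `f` and `g` with weights `wⱼ exp(xⱼᵀ β)`. -/
def wcov (w : ι → ℝ) (x : ι → Vec p) (f g : ι → ℝ) (β : Vec p) : ℝ :=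
  wavg w x (fun j => f j * g j) β - wavg w x f β * wavg w x g β

variable {w : ι → ℝ} {x : ι → Vec p} {f g : ι → ℝ} {β : Vec p}

lemma wsum_one_nonneg (hw : ∀ j, 0 ≤ w j) : 0 ≤ wsum w x (fun _ => 1) β := by
  unfold wsum
  exact Finset.sum_nonneg fun j _ => by have := hw j; positivity

/-- The total weight vanishes only for an empty risk set. Then every sum is zero, so the identities
below survive the convention that the inverse of zero is zero. -/
lemma eq_zero_of_wsum_one_eq_zero (hw : ∀ j, 0 ≤ w j) (h : wsum w x (fun _ => 1) β = 0) :
    w = 0 := by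
  unfold wsum at h
  rw [Finset.sum_eq_zero_iff_of_nonneg (fun j _ => by have := hw j; positivity)] at h
  ext j
  have := h j (Finset.mem_univ j)
  simpa [Real.exp_ne_zero] using this

lemma wavg_mul_wsum_one (hw : ∀ j, 0 ≤ w j) :
    wavg w x f β * wsum w x (fun _ => 1) β = wsum w x f β := by
  by_cases h : wsum w x (fun _ => 1) β = 0
  · have := eq_zero_of_wsum_one_eq_zero hw h
    subst this
    simp [wsum]
  · unfold wavg
    field_simp

lemma wsum_add : wsum w x (fun j => f j + g j) β = wsum w x f β + wsum w x g β := by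
  simp [wsum, add_mul, Finset.sum_add_distrib]

lemma wsum_const_mul (c : ℝ) : wsum w x (fun j => c * f j) β = c * wsum w x f β := by
  simp [wsum, Finset.mul_sum, mul_assoc]

lemma wavg_add : wavg w x (fun j => f j + g j) β = wavg w x f β + wavg w x g β := by
  simp [wavg, wsum_add, mul_add]

lemma wavg_const_mul (c : ℝ) : wavg w x (fun j => c * f j) β = c * wavg w x f β := by
  simp only [wavg, wsum_const_mul]; ring

lemma wavg_sum {κ : Type*} (s : Finset κ) (F : κ → ι → ℝ) :
    wavg w x (fun j => ∑ k ∈ s, F k j) β = ∑ k ∈ s, wavg w x (F k) β := by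
  simp only [wavg, wsum, Finset.sum_mul, Finset.mul_sum]
  rw [Finset.sum_comm]

lemma abs_wsum_le (hw : ∀ j, 0 ≤ w j) {K : ℝ} (hf : ∀ j, |f j| ≤ K) :
    |wsum w x f β| ≤ K * wsum w x (fun _ => 1) β := by
  unfold wsum
  rw [Finset.mul_sum]
  refine (Finset.abs_sum_le_sum_abs _ _).trans (Finset.sum_le_sum fun j _ => ?_)
  have h0 : 0 ≤ w j * Real.exp (inner ℝ (x j) β) := by have := hw j; positivity
  rw [abs_mul, abs_of_nonneg h0, one_mul]
  exact mul_le_mul_of_nonneg_right (hf j) h0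

lemma abs_wavg_le (hw : ∀ j, 0 ≤ w j) {K : ℝ} (hK : 0 ≤ K) (hf : ∀ j, |f j| ≤ K) :
    |wavg w x f β| ≤ K := by
  have h0 := wsum_one_nonneg (x := x) (β := β) hw
  rcases h0.eq_or_lt with h | h
  · simpa [wavg, ← h] using hK
  · rw [wavg, abs_mul, abs_inv, abs_of_nonneg h0, inv_mul_le_iff₀ h, mul_comm]
    exact abs_wsum_le hw hf

lemma abs_wcov_le (hw : ∀ j, 0 ≤ w j) {K C : ℝ} (hK : 0 ≤ K) (hC : 0 ≤ C)
    (hf : ∀ j, |f j| ≤ K) (hg : ∀ j, |g j| ≤ C) : |wcov w x f g β| ≤ 2 * (K * C) := by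
  unfold wcov
  have h1 := abs_wavg_le (x := x) (β := β) (f := fun j => f j * g j) hw (mul_nonneg hK hC)
    fun j => by rw [abs_mul]; exact mul_le_mul (hf j) (hg j) (abs_nonneg _) hK
  have h2 : |wavg w x f β * wavg w x g β| ≤ K * C := by
    rw [abs_mul]
    exact mul_le_mul (abs_wavg_le hw hK hf) (abs_wavg_le hw hC hg) (abs_nonneg _) hK
  exact (abs_sub _ _).trans (by linarith)

/-- It is a variance: expand the weighted average of `(f j - m) ^ 2` around the mean `m`. -/
lemma wcov_self_nonneg (hw : ∀ j, 0 ≤ w j) : 0 ≤ wcov w x f f β := by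
  have h0 := wsum_one_nonneg (x := x) (β := β) hw
  rcases h0.eq_or_lt with h | h
  · simp [wcov, wavg, ← h]
  · set m := wavg w x f β with hm
    have h1 : 0 ≤ wavg w x (fun j => (f j - m) ^ 2) β := by
      unfold wavg
      refine mul_nonneg (inv_nonneg.2 h0) ?_
      unfold wsum
      exact Finset.sum_nonneg fun j _ => by have := hw j; positivity
    have h2 : wavg w x (fun _ => 1) β = 1 := by
      unfold wavg; exact inv_mul_cancel₀ h.ne'
    have h3 : (fun j => (f j - m) ^ 2) = fun j => f j * f j + ((-2 * m) * f j + m ^ 2 * 1) := by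
      ext j; ring
    rw [h3, wavg_add, wavg_add, wavg_const_mul, wavg_const_mul (f := fun _ => 1), h2, ← hm] at h1
    unfold wcov
    rw [← hm]
    linarith

lemma wsum_hasFDerivAt (w : ι → ℝ) (x : ι → Vec p) (f : ι → ℝ) (β : Vec p) :
    ∃ L : Vec p →L[ℝ] ℝ, HasFDerivAt (wsum w x f) L β ∧
      ∀ u, L u = wsum w x (fun j => f j * inner ℝ (x j) u) β := by
  refine ⟨∑ j, f j • (w j • (Real.exp (inner ℝ (x j) β) • innerSL ℝ (x j))), ?_, ?_⟩
  · unfold wsum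
    refine HasFDerivAt.fun_sum fun j _ => ?_
    refine HasFDerivAt.const_mul ?_ _
    refine HasFDerivAt.const_mul ?_ _
    exact HasFDerivAt.exp ((innerSL ℝ (x j)).hasFDerivAt)
  · intro u
    simp only [wsum, sum_apply, smul_apply,
      innerSL_apply_apply, smul_eq_mul]
    exact Finset.sum_congr rfl fun j _ => by ring

/-- The weights form an exponential family in `β`, so differentiating an average in direction `u`
produces its covariance with the sufficient statistic in that direction. Only the values of the
derivative are recorded. -/
lemma wavg_hasFDerivAt (hw : ∀ j, 0 ≤ w j) (x : ι → Vec p) (f : ι → ℝ) (β : Vec p) :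
    ∃ L : Vec p →L[ℝ] ℝ, HasFDerivAt (wavg w x f) L β ∧
      ∀ u, L u = wcov w x f (fun j => inner ℝ (x j) u) β := by
  by_cases h : wsum w x (fun _ => 1) β = 0
  · have := eq_zero_of_wsum_one_eq_zero hw h
    subst this
    refine ⟨0, ?_, fun u => by simp [wcov, wavg, wsum]⟩
    have : wavg (0 : ι → ℝ) x f = fun _ => 0 := by ext b; simp [wavg, wsum]
    rw [this]
    exact hasFDerivAt_const _ _
  · obtain ⟨L0, h0, e0⟩ := wsum_hasFDerivAt w x (fun _ => 1) β
    obtain ⟨L1, h1, e1⟩ := wsum_hasFDerivAt w x f β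
    have h2 := ((hasDerivAt_inv h).comp_hasFDerivAt β h0).mul h1
    refine ⟨_, h2, fun u => ?_⟩
    simp only [add_apply, smul_apply, smul_eq_mul, e0, e1,
      Function.comp_apply, wcov, wavg, one_mul]
    field_simp
    ring

/-- The log-normaliser has the mean as its gradient, which makes the score a gradient field. For an
empty risk set the function is constant, as `Real.log 0 = 0`. -/
lemma log_wsum_hasFDerivAt (hw : ∀ j, 0 ≤ w j) (x : ι → Vec p) (β : Vec p) :
    ∃ L : Vec p →L[ℝ] ℝ, HasFDerivAt (fun b => Real.log (wsum w x (fun _ => 1) b)) L β ∧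
      ∀ u, L u = wavg w x (fun j => inner ℝ (x j) u) β := by
  by_cases h : wsum w x (fun _ => 1) β = 0
  · have := eq_zero_of_wsum_one_eq_zero hw h
    subst this
    refine ⟨0, ?_, fun u => by simp [wavg, wsum]⟩
    simp only [wsum, Pi.zero_apply, zero_mul, mul_zero, Finset.sum_const_zero, Real.log_zero]
    exact hasFDerivAt_const _ _
  · obtain ⟨L0, h0, e0⟩ := wsum_hasFDerivAt w x (fun _ => 1) β
    refine ⟨_, h0.log h, fun u => ?_⟩
    simp only [smul_apply, smul_eq_mul, e0, wavg, one_mul]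

lemma hasDerivAt_wavg_line (hw : ∀ j, 0 ≤ w j) (x : ι → Vec p) (f : ι → ℝ) (β u : Vec p) (s : ℝ) :
    HasDerivAt (fun s : ℝ => wavg w x f (β + s • u))
      (wcov w x f (fun j => inner ℝ (x j) u) (β + s • u)) s := by
  obtain ⟨L, hL, e⟩ := wavg_hasFDerivAt hw x f (β + s • u)
  rw [← e]
  have h1 : HasDerivAt (fun s : ℝ => β + s • u) u s := by
    simpa using ((hasDerivAt_id s).smul_const u).const_add β
  exact hL.comp_hasDerivAt s h1

lemma abs_wavg_sub_le (hw : ∀ j, 0 ≤ w j) {K C : ℝ} (hK : 0 ≤ K) (hC : 0 ≤ C)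
    (hf : ∀ j, |f j| ≤ K) (hx : ∀ j, ‖x j‖ ≤ C) (β β' : Vec p) :
    |wavg w x f β' - wavg w x f β| ≤ 2 * (K * C) * ‖β' - β‖ := by
  have key : ‖wavg w x f β' - wavg w x f β‖ ≤ 2 * (K * C) * ‖β' - β‖ := by
    refine Convex.norm_image_sub_le_of_norm_hasFDerivWithin_le (s := Set.univ)
      (f' := fun b => (wavg_hasFDerivAt hw x f b).choose)
      (fun b _ => (wavg_hasFDerivAt hw x f b).choose_spec.1.hasFDerivWithinAt)
      (fun b _ => ?_) convex_univ (Set.mem_univ _) (Set.mem_univ _)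
    refine ContinuousLinearMap.opNorm_le_bound _ (by positivity) fun u => ?_
    rw [(wavg_hasFDerivAt hw x f b).choose_spec.2 u, Real.norm_eq_abs]
    have := abs_wcov_le (x := x) (β := b) hw hK (mul_nonneg hC (norm_nonneg u)) hf
      (g := fun j => inner ℝ (x j) u)
      fun j => (abs_real_inner_le_norm _ _).trans (mul_le_mul_of_nonneg_right (hx j) (norm_nonneg _))
    linarith
  exact key

/-- The constant `6` collects `2` from the average of `f * g`, which is bounded by `K ^ 2`, and `2`
from each factor of the product of the two averages. -/
lemma abs_wcov_sub_le (hw : ∀ j, 0 ≤ w j) {K C : ℝ} (hK : 0 ≤ K) (hC : 0 ≤ C)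
    (hf : ∀ j, |f j| ≤ K) (hg : ∀ j, |g j| ≤ K) (hx : ∀ j, ‖x j‖ ≤ C) (β β' : Vec p) :
    |wcov w x f g β' - wcov w x f g β| ≤ 6 * (K ^ 2 * C) * ‖β' - β‖ := by
  have h1 := abs_wavg_sub_le (f := fun j => f j * g j) hw (mul_nonneg hK hK) hC
    (fun j => by rw [abs_mul]; exact mul_le_mul (hf j) (hg j) (abs_nonneg _) hK) hx β β'
  have h2 := abs_wavg_sub_le hw hK hC hf hx β β'
  have h3 := abs_wavg_sub_le hw hK hC hg hx β β'
  have h4 := abs_wavg_le (x := x) (β := β') hw hK hf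
  have h5 := abs_wavg_le (x := x) (β := β) hw hK hg
  have e : wcov w x f g β' - wcov w x f g β =
      (wavg w x (fun j => f j * g j) β' - wavg w x (fun j => f j * g j) β) -
      (wavg w x f β' * (wavg w x g β' - wavg w x g β) +
        (wavg w x f β' - wavg w x f β) * wavg w x g β) := by
    unfold wcov; ring
  rw [e]
  have h6 : |wavg w x f β' * (wavg w x g β' - wavg w x g β)| ≤ K * (2 * (K * C) * ‖β' - β‖) := by
    rw [abs_mul]; exact mul_le_mul h4 h3 (abs_nonneg _) hK
  have h7 : |(wavg w x f β' - wavg w x f β) * wavg w x g β| ≤ (2 * (K * C) * ‖β' - β‖) * K := by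
    rw [abs_mul]; exact mul_le_mul h2 h5 (abs_nonneg _) (by positivity)
  refine (abs_sub _ _).trans ?_
  have := abs_add_le (wavg w x f β' * (wavg w x g β' - wavg w x g β))
    ((wavg w x f β' - wavg w x f β) * wavg w x g β)
  nlinarith

/-- Far away from `β`, the average of `xⱼᵀ u` in direction `u` is close to its maximum over the
indices of positive weight. -/
lemma exists_wavg_radial (hw : ∀ j, w j = 0 ∨ w j = 1) {C : ℝ} (hC : 0 ≤ C) (hx : ∀ j, ‖x j‖ ≤ C)
    (β u : Vec p) (hu : ‖u‖ = 1) {ε R : ℝ} (hε : 0 ≤ ε) (hR : 0 ≤ R) :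
    ∃ M : ℝ, ∀ s, R ≤ s → wavg w x (fun j => inner ℝ (x j) u) (β + s • u) ≤ M ∧
      M - (ε + 2 * C * Fintype.card ι * Real.exp (2 * C * ‖β‖) * Real.exp (-(R * ε))) ≤
        wavg w x (fun j => inner ℝ (x j) u) (β + s • u) := by
  have hw0 : ∀ j, 0 ≤ w j := fun j => by rcases hw j with h | h <;> simp [h]
  by_cases hne : ∃ j, w j = 1
  swap
  · have : w = 0 := by
      ext j
      rcases hw j with h | h
      · exact h
      · exact absurd ⟨j, h⟩ hne
    refine ⟨0, fun s _ => ?_⟩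
    subst this
    simp only [wavg, wsum, Pi.zero_apply, zero_mul, mul_zero, Finset.sum_const_zero, le_refl,
      true_and, zero_sub, Left.neg_nonpos_iff]
    positivity
  -- `M` is the largest value of the inner product over the indices of positive weight; far out on
  -- the ray the weights concentrate on its maximisers.
  obtain ⟨k, hk, hmax⟩ : ∃ k, w k = 1 ∧ ∀ j, w j = 1 → inner ℝ (x j) u ≤ inner ℝ (x k) u := by
    obtain ⟨k, hk, h⟩ := Finset.exists_max_image (Finset.univ.filter fun j => w j = 1)
      (fun j => inner ℝ (x j) u) (by obtain ⟨j, hj⟩ := hne; exact ⟨j, by simpa using hj⟩)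
    exact ⟨k, by simpa using hk, fun j hj => h j (by simpa using hj)⟩
  set M := inner ℝ (x k) u with hM
  set κ := Real.exp (2 * C * ‖β‖) with hκ
  have hd : ∀ j, |inner ℝ (x j) u| ≤ C := fun j =>
    (abs_real_inner_le_norm _ _).trans (by rw [hu, mul_one]; exact hx j)
  have hb : ∀ j, |inner ℝ (x j) β| ≤ C * ‖β‖ := fun j =>
    (abs_real_inner_le_norm _ _).trans (mul_le_mul_of_nonneg_right (hx j) (norm_nonneg _))
  refine ⟨M, fun s hs => ?_⟩
  set e : ι → ℝ := fun j => Real.exp (inner ℝ (x j) (β + s • u)) with he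
  have he' : ∀ j, e j = Real.exp (inner ℝ (x j) β + s * inner ℝ (x j) u) := fun j => by
    simp only [he, inner_add_right, inner_smul_right]
  have hpos : e k ≤ wsum w x (fun _ => 1) (β + s • u) := by
    unfold wsum
    refine le_trans ?_ (Finset.single_le_sum (f := fun j => 1 * (w j * e j))
      (fun j _ => by have := hw0 j; positivity) (Finset.mem_univ k))
    simp [hk]
  have hek : 0 < e k := Real.exp_pos _
  have hS : 0 < wsum w x (fun _ => 1) (β + s • u) := hek.trans_le hpos
  set δ := 2 * C * Fintype.card ι * κ * Real.exp (-(R * ε)) with hδ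
  have hδ0 : 0 ≤ δ := by positivity
  have hsum : wsum w x (fun _ => 1) (β + s • u) = ∑ j, w j * e j := by simp [wsum, he]
  unfold wavg
  rw [inv_mul_le_iff₀ hS, ← div_eq_inv_mul, le_div_iff₀ hS]
  constructor
  · rw [hsum, Finset.sum_mul]
    unfold wsum
    refine Finset.sum_le_sum fun j _ => ?_
    rcases hw j with h | h
    · simp [h]
    · rw [h, one_mul, mul_comm]
      exact mul_le_mul_of_nonneg_left (hmax j h) (Real.exp_pos _).le
  -- An index whose inner product falls short of `M` by more than `ε` has weight at most `κ * exp
  -- (-(R * ε))` times that of `k`, and its shortfall is at most `2 * C`. All other indices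
  -- contribute a nonpositive term.
  · have h1 : ∀ j, (M - ε - inner ℝ (x j) u) * (w j * e j) ≤ 2 * C * κ * Real.exp (-(R * ε)) * e k := by
      intro j
      have hr : 0 ≤ 2 * C * κ * Real.exp (-(R * ε)) * e k := by positivity
      rcases hw j with h | h
      · simpa [h] using hr
      · rw [h, one_mul]
        by_cases hc : M - ε - inner ℝ (x j) u ≤ 0
        · exact (mul_nonpos_of_nonpos_of_nonneg hc (Real.exp_pos _).le).trans hr
        push Not at hc
        have h2 : M - ε - inner ℝ (x j) u ≤ 2 * C := by
          have := (abs_le.1 (hd j)).1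
          have := (abs_le.1 (hd k)).2
          linarith
        have h3 : e j ≤ κ * Real.exp (-(R * ε)) * e k := by
          rw [he', he', hκ, ← Real.exp_add, ← Real.exp_add, Real.exp_le_exp]
          have := (abs_le.1 (hb j)).2
          have := (abs_le.1 (hb k)).1
          have : s * ε ≤ s * (M - inner ℝ (x j) u) :=
            mul_le_mul_of_nonneg_left (by linarith) (hR.trans hs)
          have : R * ε ≤ s * ε := mul_le_mul_of_nonneg_right hs hε
          have e1 : s * (M - inner ℝ (x j) u) = s * M - s * inner ℝ (x j) u := by ring
          rw [← hM]
          linarith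
        calc _ ≤ 2 * C * (κ * Real.exp (-(R * ε)) * e k) :=
              mul_le_mul h2 h3 (Real.exp_pos _).le (by positivity)
          _ = _ := by ring
    have h4 : (M - ε) * wsum w x (fun _ => 1) (β + s • u) -
        wsum w x (fun j => inner ℝ (x j) u) (β + s • u) ≤ δ * e k := by
      rw [hsum, Finset.mul_sum]
      unfold wsum
      rw [← Finset.sum_sub_distrib]
      calc _ ≤ ∑ _j : ι, 2 * C * κ * Real.exp (-(R * ε)) * e k :=
            Finset.sum_le_sum fun j _ => by rw [← sub_mul]; exact h1 j
        _ = _ := by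
            rw [Finset.sum_const, Finset.card_univ, nsmul_eq_mul]; ring
    have h5 : δ * e k ≤ δ * wsum w x (fun _ => 1) (β + s • u) :=
      mul_le_mul_of_nonneg_left hpos hδ0
    have h6 : (M - (ε + δ)) * wsum w x (fun _ => 1) (β + s • u) =
      (M - ε) * wsum w x (fun _ => 1) (β + s • u) - δ * wsum w x (fun _ => 1) (β + s • u) := by ring
    linarith

/-- Both values lie in the same short interval below the limit `M`. This controls the unbounded part
of a ray beyond `R`. -/
lemma abs_wavg_radial_sub_le (hw : ∀ j, w j = 0 ∨ w j = 1) {C : ℝ} (hC : 0 ≤ C)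
    (hx : ∀ j, ‖x j‖ ≤ C) (β u : Vec p) (hu : ‖u‖ = 1) {ε R s : ℝ} (hε : 0 ≤ ε) (hR : 0 ≤ R)
    (hs : R ≤ s) :
    |wavg w x (fun j => inner ℝ (x j) u) (β + s • u) -
      wavg w x (fun j => inner ℝ (x j) u) (β + R • u)| ≤
      ε + 2 * C * Fintype.card ι * Real.exp (2 * C * ‖β‖) * Real.exp (-(R * ε)) := by
  obtain ⟨M, hM⟩ := exists_wavg_radial hw hC hx β u hu hε hR
  have h1 := hM s hs
  have h2 := hM R le_rfl
  rw [abs_le]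
  constructor <;> linarith [h1.1, h1.2, h2.1, h2.2]

lemma measurable_wsum {α : Type*} [MeasurableSpace α] {w f : ι → α → ℝ} {x : ι → α → Vec p}
    {β : α → Vec p} (hw : ∀ j, Measurable (w j)) (hx : ∀ j, Measurable (x j))
    (hf : ∀ j, Measurable (f j)) (hβ : Measurable β) :
    Measurable fun a => wsum (fun j => w j a) (fun j => x j a) (fun j => f j a) (β a) := by
  unfold wsum
  refine Finset.measurable_sum _ fun j _ => (hf j).mul ((hw j).mul ?_)
  exact Real.measurable_exp.comp ((hx j).inner hβ)

lemma measurable_wavg {α : Type*} [MeasurableSpace α] {w f : ι → α → ℝ} {x : ι → α → Vec p}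
    {β : α → Vec p} (hw : ∀ j, Measurable (w j)) (hx : ∀ j, Measurable (x j))
    (hf : ∀ j, Measurable (f j)) (hβ : Measurable β) :
    Measurable fun a => wavg (fun j => w j a) (fun j => x j a) (fun j => f j a) (β a) :=
  (measurable_wsum hw hx (fun _ => measurable_const) hβ).inv.mul (measurable_wsum hw hx hf hβ)

lemma measurable_wcov {α : Type*} [MeasurableSpace α] {w f g : ι → α → ℝ} {x : ι → α → Vec p}
    {β : α → Vec p} (hw : ∀ j, Measurable (w j)) (hx : ∀ j, Measurable (x j))
    (hf : ∀ j, Measurable (f j)) (hg : ∀ j, Measurable (g j)) (hβ : Measurable β) :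
    Measurable fun a =>
      wcov (fun j => w j a) (fun j => x j a) (fun j => f j a) (fun j => g j a) (β a) :=
  (measurable_wavg hw hx (fun j => (hf j).mul (hg j)) hβ).sub
    ((measurable_wavg hw hx hf hβ).mul (measurable_wavg hw hx hg hβ))

end WeightedAverage

/-! ### Moments of multiplier averages -/

section Multiplier

variable {Ω : Type*} {m mΩ : MeasurableSpace Ω} {μ : Measure Ω} {ν : Measure ℝ} {n : ℕ}
  {G : Fin n → Ω → ℝ}

lemma IsMultiplier.integral_comp (hG : IsMultiplier m μ ν G) (i : Fin n) {φ : ℝ → ℝ}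
    (hφ : Measurable φ) : ∫ ω, φ (G i ω) ∂μ = ∫ x, φ x ∂ν := by
  rw [← hG.law i, integral_map (hG.measurable i).aemeasurable hφ.aestronglyMeasurable]

lemma IsMultiplier.integrable_comp (hG : IsMultiplier m μ ν G) (i : Fin n) {φ : ℝ → ℝ}
    (hφ : Integrable φ ν) : Integrable (fun ω => φ (G i ω)) μ := by
  rw [← hG.law i] at hφ
  exact hφ.comp_measurable (hG.measurable i)

lemma IsMultiplier.memLp_comp (hG : IsMultiplier m μ ν G) (i : Fin n) {φ : ℝ → ℝ} {q : ℝ≥0∞}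
    (hφ : MemLp φ q ν) : MemLp (fun ω => φ (G i ω)) q μ := by
  rw [← hG.law i] at hφ
  exact hφ.comp_of_map (hG.measurable i).aemeasurable

/-- Pairwise independence of the multipliers from the data would not suffice: the product lies in
the σ-algebra of all multipliers, which is jointly independent of `m`. For `i = j` it covers the
diagonal terms of a second moment. -/
lemma IsMultiplier.indepFun_mul (hG : IsMultiplier m μ ν G) (i j : Fin n)
    {φ : ℝ → ℝ} (hφ : Measurable φ) {W : Ω → ℝ} (hW : Measurable[m] W) :
    IndepFun (fun ω => φ (G i ω) * φ (G j ω)) W μ := by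
  rw [IndepFun_iff_Indep]
  refine indep_of_indep_of_le_left (indep_of_indep_of_le_right hG.indep_data hW.comap_le) ?_
  have h : ∀ k, Measurable[⨆ i, MeasurableSpace.comap (G i) inferInstance] (fun ω => φ (G k ω)) :=
    fun k => hφ.comp (Measurable.mono (comap_measurable (G k))
      (le_iSup (fun i => MeasurableSpace.comap (G i) inferInstance) k) le_rfl)
  have h' := (h i).mul (h j)
  exact Measurable.comap_le h'

/-- The second moment of a multiplier average with bounded weights measurable with respect to the
data. -/
lemma IsMultiplier.integral_sq_le [IsProbabilityMeasure μ] [IsProbabilityMeasure ν] (hm : m ≤ mΩ)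
    (hG : IsMultiplier m μ ν G) {φ : ℝ → ℝ} (hφ : Measurable φ) (h0 : ∫ x, φ x ∂ν = 0)
    (h2 : MemLp φ 2 ν) {w : Fin n → Ω → ℝ} (hw : ∀ i, Measurable[m] (w i)) {C : ℝ}
    (hC : ∀ i ω, |w i ω| ≤ C) :
    Integrable (fun ω => ((n : ℝ)⁻¹ * ∑ i, φ (G i ω) * w i ω) ^ 2) μ ∧
      ∫ ω, ((n : ℝ)⁻¹ * ∑ i, φ (G i ω) * w i ω) ^ 2 ∂μ ≤ C ^ 2 * (∫ x, φ x ^ 2 ∂ν) / n := by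
  have hexp : ∀ ω, ((n : ℝ)⁻¹ * ∑ i, φ (G i ω) * w i ω) ^ 2 =
      (n : ℝ)⁻¹ ^ 2 * ∑ i, ∑ j, (φ (G i ω) * φ (G j ω)) * (w i ω * w j ω) := by
    intro ω
    rw [mul_pow, sq (∑ i, _), Finset.sum_mul_sum]
    congr 1
    exact Finset.sum_congr rfl fun i _ => Finset.sum_congr rfl fun j _ => by ring
  have hww : ∀ i j, Measurable[m] (fun ω => w i ω * w j ω) := fun i j => by
    have h := (hw i).mul (hw j)
    exact h
  have hGG : ∀ i j, Integrable (fun ω => φ (G i ω) * φ (G j ω)) μ := fun i j =>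
    (hG.memLp_comp i h2).integrable_mul (hG.memLp_comp j h2)
  have hint : ∀ i j, Integrable (fun ω => (φ (G i ω) * φ (G j ω)) * (w i ω * w j ω)) μ := by
    intro i j
    refine (hGG i j).mul_bdd (c := C * C) ((hww i j).mono hm le_rfl).aestronglyMeasurable
      (Eventually.of_forall fun ω => ?_)
    rw [Real.norm_eq_abs, abs_mul]
    exact mul_le_mul (hC i ω) (hC j ω) (abs_nonneg _) ((abs_nonneg _).trans (hC i ω))
  have hval : ∀ i j, ∫ ω, (φ (G i ω) * φ (G j ω)) * (w i ω * w j ω) ∂μ =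
      (∫ ω, φ (G i ω) * φ (G j ω) ∂μ) * ∫ ω, w i ω * w j ω ∂μ := fun i j =>
    (hG.indepFun_mul i j hφ (hww i j)).integral_fun_mul_eq_mul_integral
      (hGG i j).aestronglyMeasurable ((hww i j).mono hm le_rfl).aestronglyMeasurable
  -- The weights may be dependent on each other, but they factor out as data; what remains is the
  -- product of two zero means.
  have hoff : ∀ i j, i ≠ j → ∫ ω, (φ (G i ω) * φ (G j ω)) * (w i ω * w j ω) ∂μ = 0 := by
    intro i j hij
    have h3 := ((hG.indep.indepFun hij).comp hφ hφ).integral_fun_mul_eq_mul_integral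
      (hφ.comp (hG.measurable i)).aestronglyMeasurable
      (hφ.comp (hG.measurable j)).aestronglyMeasurable
    simp only [Function.comp_apply, hG.integral_comp i hφ, h0, zero_mul] at h3
    rw [hval, h3, zero_mul]
  have hdiag : ∀ i, ∫ ω, (φ (G i ω) * φ (G i ω)) * (w i ω * w i ω) ∂μ ≤
      C ^ 2 * ∫ x, φ x ^ 2 ∂ν := by
    intro i
    rw [hval, ← hG.integral_comp i (hφ.pow_const 2), mul_comm]
    have h1 : ∫ ω, w i ω * w i ω ∂μ ≤ C ^ 2 := by
      refine (integral_mono_of_nonneg (g := fun _ => C ^ 2)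
        (Eventually.of_forall fun ω => mul_self_nonneg _)
        (integrable_const _) (Eventually.of_forall fun ω => ?_)).trans (by simp)
      change w i ω * w i ω ≤ C ^ 2
      rw [← sq, ← sq_abs]
      exact pow_le_pow_left₀ (abs_nonneg _) (hC i ω) 2
    simp only [sq]
    refine mul_le_mul (by simpa [sq] using h1) le_rfl
      (integral_nonneg fun ω => mul_self_nonneg _) (mul_self_nonneg _)
  simp only [hexp]
  refine ⟨(integrable_finsetSum _ fun i _ => integrable_finsetSum _ fun j _ => hint i j).const_mul _,
    ?_⟩
  rw [integral_const_mul, integral_finsetSum _ fun i _ => integrable_finsetSum _ fun j _ => hint i j]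
  have : ∀ i, ∫ ω, ∑ j, (φ (G i ω) * φ (G j ω)) * (w i ω * w j ω) ∂μ ≤ C ^ 2 * ∫ x, φ x ^ 2 ∂ν := by
    intro i
    rw [integral_finsetSum _ fun j _ => hint i j,
      Finset.sum_eq_single i (fun j _ hj => hoff i j hj.symm) (by simp)]
    exact hdiag i
  calc _ ≤ (n : ℝ)⁻¹ ^ 2 * ∑ _i : Fin n, C ^ 2 * ∫ x, φ x ^ 2 ∂ν :=
        mul_le_mul_of_nonneg_left (Finset.sum_le_sum fun i _ => this i) (by positivity)
    _ = _ := by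
      rw [Finset.sum_const, Finset.card_univ, Fintype.card_fin, nsmul_eq_mul]
      rcases Nat.eq_zero_or_pos n with h | h
      · subst h; simp
      · field_simp

lemma IsMultiplier.integral_abs_le [IsProbabilityMeasure μ] (hm : m ≤ mΩ)
    (hG : IsMultiplier m μ ν G) {ψ : ℝ → ℝ} (hψm : Measurable ψ) (hψ : Integrable ψ ν)
    {w : Fin n → Ω → ℝ} (hw : ∀ i, Measurable[m] (w i)) {C : ℝ} (hC0 : 0 ≤ C)
    (hC : ∀ i ω, |w i ω| ≤ C) :
    Integrable (fun ω => (n : ℝ)⁻¹ * ∑ i, ψ (G i ω) * w i ω) μ ∧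
      ∫ ω, |(n : ℝ)⁻¹ * ∑ i, ψ (G i ω) * w i ω| ∂μ ≤ C * ∫ x, |ψ x| ∂ν := by
  have hterm : ∀ i, Integrable (fun ω => ψ (G i ω) * w i ω) μ :=
    fun i => (hG.integrable_comp i hψ).mul_bdd (c := C)
      ((hw i).mono hm le_rfl).aestronglyMeasurable (Eventually.of_forall fun ω => hC i ω)
  have hZint : Integrable (fun ω => (n : ℝ)⁻¹ * ∑ i, ψ (G i ω) * w i ω) μ :=
    (integrable_finsetSum _ fun i _ => hterm i).const_mul _
  refine ⟨hZint, ?_⟩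
  have h1 : ∀ ω, |(n : ℝ)⁻¹ * ∑ i, ψ (G i ω) * w i ω| ≤ (n : ℝ)⁻¹ * ∑ i, C * |ψ (G i ω)| := by
    intro ω
    rw [abs_mul, abs_of_nonneg (by positivity : (0 : ℝ) ≤ (n : ℝ)⁻¹)]
    refine mul_le_mul_of_nonneg_left ((Finset.abs_sum_le_sum_abs _ _).trans
      (Finset.sum_le_sum fun i _ => ?_)) (by positivity)
    rw [abs_mul, mul_comm]
    exact mul_le_mul_of_nonneg_right (hC i ω) (abs_nonneg _)
  have hi' : ∀ i, Integrable (fun ω => C * |ψ (G i ω)|) μ := fun i =>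
    (hG.integrable_comp i hψ).abs.const_mul _
  refine (integral_mono hZint.abs
    ((integrable_finsetSum _ fun i _ => hi' i).const_mul _) h1).trans ?_
  rw [integral_const_mul, integral_finsetSum _ fun i _ => hi' i]
  simp only [integral_const_mul, hG.integral_comp _ hψm.abs, Finset.sum_const,
    Finset.card_univ, Fintype.card_fin, nsmul_eq_mul]
  rcases Nat.eq_zero_or_pos n with h | h
  · subst h
    simp only [CharP.cast_eq_zero, zero_mul, mul_zero]
    exact mul_nonneg hC0 (integral_nonneg fun x => abs_nonneg _)
  · have : (n : ℝ) ≠ 0 := by positivity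
    rw [← mul_assoc, inv_mul_cancel₀ this, one_mul]

/-- A centered integrable function is an `L¹` limit of centered bounded functions. -/
lemma exists_memLp_two_integral_abs_sub_le [IsProbabilityMeasure ν] {φ : ℝ → ℝ}
    (hφ : Measurable φ) (hi : Integrable φ ν) (h0 : ∫ x, φ x ∂ν = 0) {δ : ℝ} (hδ : 0 < δ) :
    ∃ ψ : ℝ → ℝ, Measurable ψ ∧ MemLp ψ 2 ν ∧ ∫ x, ψ x ∂ν = 0 ∧ ∫ x, |φ x - ψ x| ∂ν ≤ δ := by
  set T : ℕ → ℝ → ℝ := fun K x => {x | |φ x| ≤ K}.indicator φ x with hT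
  have hTset : ∀ K : ℕ, MeasurableSet {x | |φ x| ≤ K} := fun K =>
    measurableSet_le hφ.abs measurable_const
  have hTm : ∀ K, Measurable (T K) := fun K => hφ.indicator (hTset K)
  have hTi : ∀ K, Integrable (T K) ν := fun K => hi.indicator (hTset K)
  have hTb : ∀ K x, |T K x| ≤ K := by
    intro K x
    simp only [hT, Set.indicator_apply]
    split_ifs with h
    · exact h
    · simp
  have hr0 : Tendsto (fun K => ∫ x, |φ x - T K x| ∂ν) atTop (𝓝 0) := by
    have : Tendsto (fun K => ∫ x, |φ x - T K x| ∂ν) atTop (𝓝 (∫ x, (0 : ℝ) ∂ν)) := by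
      refine tendsto_integral_of_dominated_convergence (fun x => |φ x|)
        (fun K => (hφ.sub (hTm K)).abs.aestronglyMeasurable) hi.abs
        (fun K => Eventually.of_forall fun x => ?_) (Eventually.of_forall fun x => ?_)
      · simp only [hT, Set.indicator_apply]
        split_ifs with h <;> simp
      · obtain ⟨N, hN⟩ := exists_nat_ge |φ x|
        refine tendsto_const_nhds.congr' ?_
        filter_upwards [eventually_ge_atTop N] with K hK
        have : x ∈ {x | |φ x| ≤ K} := hN.trans (by exact_mod_cast hK)
        simp only [hT, Set.indicator_of_mem this, sub_self, abs_zero]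
    simpa using this
  obtain ⟨K, hK⟩ := ((tendsto_order.1 hr0).2 (δ / 2) (by positivity)).exists
  set M : ℝ := ∫ x, T K x ∂ν with hM
  have hMr : |M| ≤ ∫ x, |φ x - T K x| ∂ν := by
    have : M = -∫ x, (φ x - T K x) ∂ν := by
      rw [integral_sub hi (hTi K), h0]; simp [hM]
    rw [this, abs_neg]
    exact abs_integral_le_integral_abs
  have hm : Measurable fun x => T K x - M := (hTm K).sub_const _
  refine ⟨fun x => T K x - M, hm, MemLp.of_bound hm.aestronglyMeasurable (K + |M|)
    (Eventually.of_forall fun x => (abs_sub _ _).trans (add_le_add_left (hTb K x) _)), ?_, ?_⟩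
  · rw [integral_sub (hTi K) (integrable_const _)]; simp [hM]
  · have h1 : Integrable (fun x => |φ x - T K x|) ν := (hi.sub (hTi K)).abs
    have h2 : ∀ x, |φ x - (T K x - M)| ≤ |φ x - T K x| + |M| := fun x => by
      rw [show φ x - (T K x - M) = (φ x - T K x) + M by ring]
      exact abs_add_le _ _
    refine (integral_mono (hi.sub ((hTi K).sub (integrable_const _))).abs
      (h1.add (integrable_const _)) h2).trans ?_
    rw [integral_add' h1 (integrable_const _)]
    simp only [integral_const, probReal_univ, smul_eq_mul, one_mul]
    linarith

end Multiplier

/-! ### The weak law for multiplier averages -/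

section MultiplierLLN

variable {Ω : Type*} {m : ℕ → MeasurableSpace Ω} {mΩ : MeasurableSpace Ω} {μ : Measure Ω}
  {ν : Measure ℝ} {G : (n : ℕ) → Fin n → Ω → ℝ}

/-- The weak law of large numbers for multiplier averages with bounded weights. -/
lemma tendsto_multiplier_average [IsProbabilityMeasure μ] [IsProbabilityMeasure ν]
    (hm : ∀ n, m n ≤ mΩ) (hG : ∀ n, IsMultiplier (m n) μ ν (G n)) {φ : ℝ → ℝ}
    (hφ : Measurable φ) (hi : Integrable φ ν) (h0 : ∫ x, φ x ∂ν = 0)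
    {w : (n : ℕ) → Fin n → Ω → ℝ} (hw : ∀ n i, Measurable[m n] (w n i)) {C : ℝ} (hC0 : 0 ≤ C)
    (hC : ∀ n i ω, |w n i ω| ≤ C) :
    Tendsto (fun q : ℕ × Ω => (q.1 : ℝ)⁻¹ * ∑ i, φ (G q.1 i q.2) * w q.1 i q.2)
      (probFilter μ) (𝓝 0) := by
  have hlim : Tendsto (fun n : ℕ => ∫ ω, |(n : ℝ)⁻¹ * ∑ i, φ (G n i ω) * w n i ω| ∂μ) atTop (𝓝 0) := by
    rw [Metric.tendsto_atTop]
    intro ε hε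
    -- The part `ψ` is handled by its variance. The rest is small in mean uniformly in `n`, by the
    -- bound on the weights; `C + 1` avoids division by zero.
    obtain ⟨ψ, hψm, hψ2, hψ0, hψ⟩ := exists_memLp_two_integral_abs_sub_le hφ hi h0
      (δ := ε / 4 / (C + 1)) (by positivity)
    have hψi : Integrable ψ ν := hψ2.integrable one_le_two
    have hN : Tendsto (fun n : ℕ => C ^ 2 * (∫ x, ψ x ^ 2 ∂ν) / n / (ε / 3)) atTop (𝓝 0) := by
      simpa using (tendsto_const_div_atTop_nhds_zero_nat (C ^ 2 * ∫ x, ψ x ^ 2 ∂ν)).div_const (ε / 3)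
    obtain ⟨N, hN⟩ := eventually_atTop.1 ((tendsto_order.1 hN).2 (ε / 3) (by positivity))
    refine ⟨N, fun n hn => ?_⟩
    rw [Real.dist_eq, sub_zero, abs_of_nonneg (integral_nonneg fun ω => abs_nonneg _)]
    obtain ⟨i2, b2⟩ := (hG n).integral_sq_le (hm n) hψm hψ0 hψ2 (hw n) (hC n)
    obtain ⟨i1, b1⟩ := (hG n).integral_abs_le (hm n) (hφ.sub hψm) (hi.sub hψi) (hw n) hC0 (hC n)
    obtain ⟨i0, -⟩ := (hG n).integral_abs_le (hm n) hφ hi (hw n) hC0 (hC n)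
    have hpt : ∀ ω, |(n : ℝ)⁻¹ * ∑ i, φ (G n i ω) * w n i ω| ≤
        (ε / 3 + ((n : ℝ)⁻¹ * ∑ i, ψ (G n i ω) * w n i ω) ^ 2 / (ε / 3)) +
        |(n : ℝ)⁻¹ * ∑ i, (φ - ψ) (G n i ω) * w n i ω| := by
      -- For a real `z` the inequality `|z| ≤ ε / 3 + z ^ 2 / (ε / 3)` turns the second-moment bound
      -- for the `ψ` part into a first-moment bound. The total is below `ε / 3 + ε / 3 + ε / 4`.
      intro ω
      have hdec : (n : ℝ)⁻¹ * ∑ i, φ (G n i ω) * w n i ω =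
          (n : ℝ)⁻¹ * ∑ i, ψ (G n i ω) * w n i ω +
          (n : ℝ)⁻¹ * ∑ i, (φ - ψ) (G n i ω) * w n i ω := by
        rw [← mul_add, ← Finset.sum_add_distrib]
        congr 1
        exact Finset.sum_congr rfl fun i _ => by rw [Pi.sub_apply]; ring
      rw [hdec]
      refine (abs_add_le _ _).trans (add_le_add_left ?_ _)
      generalize (n : ℝ)⁻¹ * ∑ i, ψ (G n i ω) * w n i ω = z
      have h3 : 0 < ε / 3 := by positivity
      by_cases hz : |z| ≤ ε / 3
      · have : 0 ≤ z ^ 2 / (ε / 3) := by positivity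
        linarith
      · push Not at hz
        have : |z| ≤ z ^ 2 / (ε / 3) := by
          rw [le_div_iff₀ h3, ← sq_abs, sq]
          exact mul_le_mul_of_nonneg_left hz.le (abs_nonneg _)
        linarith
    have i3 := (integrable_const (μ := μ) (ε / 3)).add (i2.div_const (ε / 3))
    have h5 := integral_mono i0.abs (i3.add i1.abs) hpt
    rw [integral_add' i3 i1.abs, integral_add' (integrable_const _) (i2.div_const _),
      integral_div (ε / 3)] at h5
    simp only [integral_const, probReal_univ, smul_eq_mul, one_mul] at h5
    have h6 := hN n hn
    have h7 := div_le_div_of_nonneg_right b2 (by positivity : 0 ≤ ε / 3)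
    have h8 : C * ∫ x, |(φ - ψ) x| ∂ν ≤ ε / 4 := by
      refine (mul_le_mul (by linarith : C ≤ C + 1) hψ
        (integral_nonneg fun x => abs_nonneg _) (by positivity)).trans ?_
      rw [mul_div_cancel₀ _ (by positivity)]
    linarith
  exact tendsto_probFilter_of_integral_le
    (Z := fun n ω => (n : ℝ)⁻¹ * ∑ i, φ (G n i ω) * w n i ω)
    (fun n => ((hG n).integral_abs_le (hm n) hφ hi (hw n) hC0 (hC n)).1) (fun n => le_rfl) hlim

end MultiplierLLN

/-! ### A central limit theorem uniform in the coefficients -/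

section CentralLimit

/-- Factors are exchanged one at a time, the others being bounded by one. -/
lemma norm_prod_sub_prod_le {ι : Type*} (s : Finset ι) {f g : ι → ℂ} (hf : ∀ i ∈ s, ‖f i‖ ≤ 1)
    (hg : ∀ i ∈ s, ‖g i‖ ≤ 1) : ‖∏ i ∈ s, f i - ∏ i ∈ s, g i‖ ≤ ∑ i ∈ s, ‖f i - g i‖ := by
  classical
  induction s using Finset.induction_on with
  | empty => simp
  | insert a s ha ih =>
    rw [Finset.prod_insert ha, Finset.prod_insert ha, Finset.sum_insert ha]
    have h1 := ih (fun i hi => hf i (Finset.mem_insert_of_mem hi))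
      (fun i hi => hg i (Finset.mem_insert_of_mem hi))
    have h2 : ‖∏ i ∈ s, f i‖ ≤ 1 := by
      rw [norm_prod]
      exact Finset.prod_le_one (fun i _ => norm_nonneg _)
        fun i hi => hf i (Finset.mem_insert_of_mem hi)
    rw [show f a * ∏ i ∈ s, f i - g a * ∏ i ∈ s, g i =
      (f a - g a) * ∏ i ∈ s, f i + g a * (∏ i ∈ s, f i - ∏ i ∈ s, g i) by ring]
    refine (norm_add_le _ _).trans (add_le_add ?_ ?_)
    · rw [norm_mul]
      exact mul_le_of_le_one_right (norm_nonneg _) h2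
    · rw [norm_mul]
      exact (mul_le_of_le_one_left (norm_nonneg _) (hg a (Finset.mem_insert_self _ _))).trans h1

/-- A standardised law and the Gaussian have the same characteristic function to second order. -/
lemma charFun_sub_exp_isLittleO {ν : Measure ℝ} [IsProbabilityMeasure ν]
    (h0 : ∫ x, x ∂ν = 0) (h1 : ∫ x, x ^ 2 ∂ν = 1) :
    (fun t : ℝ => charFun ν t - Complex.exp (-(t ^ 2 / 2 : ℝ))) =o[𝓝 0] fun t : ℝ => t ^ 2 := by
  have h2 := taylor_charFun_two (P := ν) (X := id) aemeasurable_id (by simpa using h0)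
    (by simpa using h1)
  rw [Measure.map_id] at h2
  have h3 : (fun t : ℝ => ((1 - t ^ 2 / 2 : ℂ) - Complex.exp (-(t ^ 2 / 2 : ℝ)))) =o[𝓝 0]
      fun t : ℝ => t ^ 2 := by
    have h4 : Tendsto (fun t : ℝ => ((-(t ^ 2 / 2) : ℝ) : ℂ)) (𝓝 0) (𝓝 0) := by
      have : Continuous fun t : ℝ => ((-(t ^ 2 / 2) : ℝ) : ℂ) := by fun_prop
      simpa using this.tendsto 0
    have h5 := (Complex.hasDerivAt_exp 0).isLittleO
    simp only [Complex.exp_zero, sub_zero, smul_eq_mul, mul_one] at h5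
    have h6 := (h5.comp_tendsto h4).neg_left
    have h7 : (fun t : ℝ => ((-(t ^ 2 / 2) : ℝ) : ℂ)) =O[𝓝 0] fun t : ℝ => t ^ 2 := by
      refine Asymptotics.IsBigO.of_bound 1 (Eventually.of_forall fun t => ?_)
      rw [Complex.norm_real, norm_neg, Real.norm_eq_abs, Real.norm_eq_abs,
        abs_of_nonneg (by positivity), abs_of_nonneg (by positivity)]
      nlinarith [sq_nonneg t]
    refine (h6.trans_isBigO h7).congr_left fun t => ?_
    simp only [Function.comp_apply]
    push_cast
    ring
  refine (h2.add h3).congr_left fun t => ?_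
  ring

lemma charFun_map_sum_smul {p n : ℕ} (ν : Measure ℝ) [IsProbabilityMeasure ν]
    (a : Fin n → Vec p) (t : Vec p) :
    charFun ((Measure.pi fun _ : Fin n => ν).map fun x => ∑ i, x i • a i) t =
      ∏ i, charFun ν (inner ℝ (a i) t) := by
  have hm : Measurable fun x : Fin n → ℝ => ∑ i, x i • a i := by fun_prop
  rw [charFun_apply, integral_map hm.aemeasurable (by fun_prop)]
  simp only [charFun_apply_real]
  rw [← integral_fintype_prod_eq_prod (𝕜 := ℂ)
    (f := fun i (x : ℝ) => Complex.exp ((inner ℝ (a i) t : ℝ) * x * Complex.I))]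
  congr 1
  ext x
  rw [← Complex.exp_sum, sum_inner, ← Finset.sum_mul]
  congr 2
  push_cast
  exact Finset.sum_congr rfl fun i _ => by rw [inner_smul_left]; simp [mul_comm]

lemma sum_inner_sq {p : ℕ} {ι : Type*} [Fintype ι] (a : ι → Vec p) (t : Vec p) :
    ∑ i, (inner ℝ (a i) t : ℝ) ^ 2 = ∑ c, ∑ d, t c * t d * ∑ i, a i c * a i d := by
  simp only [PiLp.inner_apply, RCLike.inner_apply, conj_trivial, sq, Finset.sum_mul_sum]
  simp only [Finset.mul_sum]
  rw [Finset.sum_comm]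
  refine Finset.sum_congr rfl fun c _ => ?_
  rw [Finset.sum_comm]
  exact Finset.sum_congr rfl fun d _ => Finset.sum_congr rfl fun i _ => by ring

/-- Replacing each factor by its Gaussian counterpart costs a small multiple of the squared
argument, because all arguments tend to zero uniformly. The squares sum to a bounded quantity, and
the Gaussian factors multiply exactly to the exponential of minus half that sum. -/
lemma tendsto_prod_charFun {p : ℕ} {ν : Measure ℝ} [IsProbabilityMeasure ν]
    (h0 : ∫ x, x ∂ν = 0) (h1 : ∫ x, x ^ 2 ∂ν = 1) {S : Matrix (Fin p) (Fin p) ℝ}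
    (hS : S.PosSemidef) {N : ℕ → ℕ} {a : (k : ℕ) → Fin (N k) → Vec p} {b : ℕ → ℝ}
    (hb : Tendsto b atTop (𝓝 0)) (hab : ∀ k i, ‖a k i‖ ≤ b k)
    (hcov : ∀ c d, Tendsto (fun k => ∑ i, a k i c * a k i d) atTop (𝓝 (S c d))) (t : Vec p) :
    Tendsto (fun k => ∏ i, charFun ν (inner ℝ (a k i) t)) atTop
      (𝓝 (charFun (multivariateGaussian 0 S) t)) := by
  rw [charFun_multivariateGaussian hS]
  set V : ℝ := ∑ c, ∑ d, t c * t d * S c d with hV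
  have hVt : (t.ofLp ⬝ᵥ S.mulVec t.ofLp) = V := by
    simp only [dotProduct, Matrix.mulVec, hV, Finset.mul_sum]
    exact Finset.sum_congr rfl fun c _ => Finset.sum_congr rfl fun d _ => by ring
  have hsq : Tendsto (fun k => ∑ i, (inner ℝ (a k i) t : ℝ) ^ 2) atTop (𝓝 V) := by
    simp only [sum_inner_sq]
    exact tendsto_finsetSum _ fun c _ => tendsto_finsetSum _ fun d _ => (hcov c d).const_mul _
  have hexp : Tendsto (fun k => ∏ i, Complex.exp (-((inner ℝ (a k i) t : ℝ) ^ 2 / 2 : ℝ))) atTop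
      (𝓝 (Complex.exp (-(V / 2 : ℝ)))) := by
    simp only [← Complex.exp_sum]
    refine (Complex.continuous_exp.tendsto _).comp ?_
    have := ((Complex.continuous_ofReal.tendsto _).comp (hsq.div_const 2)).neg
    refine this.congr fun k => ?_
    simp only [Function.comp_apply, Finset.sum_neg_distrib, Finset.sum_div]
    push_cast
    rfl
  have hdiff : Tendsto (fun k => ∏ i, charFun ν (inner ℝ (a k i) t) -
      ∏ i, Complex.exp (-((inner ℝ (a k i) t : ℝ) ^ 2 / 2 : ℝ))) atTop (𝓝 0) := by
    rw [Metric.tendsto_nhds]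
    intro ε hε
    have hV0 : 0 < |V| + 1 := by positivity
    -- The sum of the squared arguments tends to `V`, so it is eventually below `|V| + 1` and the
    -- accumulated error is at most `ε / 2`.
    have hη : 0 < ε / (2 * (|V| + 1)) := by positivity
    obtain ⟨ρ, hρ, hρ'⟩ := Metric.eventually_nhds_iff.1
      ((charFun_sub_exp_isLittleO h0 h1).bound hη)
    have hbt : Tendsto (fun k => b k * ‖t‖) atTop (𝓝 0) := by simpa using hb.mul_const ‖t‖
    filter_upwards [(tendsto_order.1 hbt).2 ρ hρ,
      (tendsto_order.1 hsq).2 (|V| + 1) (by linarith [le_abs_self V])] with k hk1 hk2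
    rw [dist_zero_right]
    refine (norm_prod_sub_prod_le _ (fun i _ => norm_charFun_le_one _) fun i _ => ?_).trans_lt ?_
    · rw [Complex.norm_exp]
      refine Real.exp_le_one_iff.2 ?_
      rw [← Complex.ofReal_neg, Complex.ofReal_re]
      have := sq_nonneg (inner ℝ (a k i) t : ℝ)
      linarith
    · calc _ ≤ ∑ i, ε / (2 * (|V| + 1)) * (inner ℝ (a k i) t : ℝ) ^ 2 := by
            refine Finset.sum_le_sum fun i _ => ?_
            have h3 : dist (inner ℝ (a k i) t : ℝ) 0 < ρ := by
              rw [dist_zero_right]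
              refine (norm_inner_le_norm _ _).trans_lt (lt_of_le_of_lt ?_ hk1)
              exact mul_le_mul_of_nonneg_right (hab k i) (norm_nonneg _)
            have h4 := hρ' h3
            rwa [Real.norm_of_nonneg (sq_nonneg _)] at h4
        _ = ε / (2 * (|V| + 1)) * ∑ i, (inner ℝ (a k i) t : ℝ) ^ 2 := by rw [Finset.mul_sum]
        _ ≤ ε / (2 * (|V| + 1)) * (|V| + 1) := mul_le_mul_of_nonneg_left hk2.le hη.le
        _ = ε / 2 := by field_simp
        _ < ε := by linarith
  have hfin := hdiff.add hexp
  simp only [sub_add_cancel, zero_add] at hfin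
  convert hfin using 2
  rw [inner_zero_right, hVt]
  push_cast
  simp

/-- The central limit theorem for linear combinations of i.i.d. variables whose vector coefficients
are uniformly small and have a convergent covariance matrix. -/
lemma tendsto_integral_map_sum_smul {p : ℕ} {ν : Measure ℝ} [IsProbabilityMeasure ν]
    (h0 : ∫ x, x ∂ν = 0) (h1 : ∫ x, x ^ 2 ∂ν = 1) {S : Matrix (Fin p) (Fin p) ℝ}
    (hS : S.PosSemidef) {N : ℕ → ℕ} {a : (k : ℕ) → Fin (N k) → Vec p} {b : ℕ → ℝ}
    (hb : Tendsto b atTop (𝓝 0)) (hab : ∀ k i, ‖a k i‖ ≤ b k)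
    (hcov : ∀ c d, Tendsto (fun k => ∑ i, a k i c * a k i d) atTop (𝓝 (S c d)))
    (f : Vec p →ᵇ ℝ) :
    Tendsto (fun k => ∫ x, f (∑ i, x i • a k i) ∂(Measure.pi fun _ : Fin (N k) => ν)) atTop
      (𝓝 (∫ x, f x ∂(multivariateGaussian 0 S))) := by
  have hm : ∀ k, Measurable fun x : Fin (N k) → ℝ => ∑ i, x i • a k i := fun k => by fun_prop
  have hP : ∀ k, IsProbabilityMeasure ((Measure.pi fun _ : Fin (N k) => ν).map
      fun x => ∑ i, x i • a k i) := fun k =>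
    Measure.isProbabilityMeasure_map (hm k).aemeasurable
  obtain ⟨Q, hQ⟩ : ∃ Q : ℕ → ProbabilityMeasure (Vec p), ∀ k, (Q k : Measure (Vec p)) =
      (Measure.pi fun _ : Fin (N k) => ν).map fun x => ∑ i, x i • a k i :=
    ⟨fun k => ⟨_, hP k⟩, fun k => rfl⟩
  obtain ⟨Q0, hQ0⟩ : ∃ Q : ProbabilityMeasure (Vec p),
      (Q : Measure (Vec p)) = multivariateGaussian 0 S :=
    ⟨⟨multivariateGaussian 0 S, inferInstance⟩, rfl⟩
  have key : Tendsto Q atTop (𝓝 Q0) := by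
    refine ProbabilityMeasure.tendsto_of_tendsto_charFun fun t => ?_
    simp only [hQ, hQ0, charFun_map_sum_smul]
    exact tendsto_prod_charFun h0 h1 hS hb hab hcov t
  have := (ProbabilityMeasure.tendsto_iff_forall_integral_tendsto.1 key) f
  simp only [hQ, hQ0] at this
  refine this.congr fun k => ?_
  exact integral_map (hm k).aemeasurable f.continuous.aestronglyMeasurable

/-- A uniform version of the central limit theorem for linear combinations. -/
lemma exists_forall_abs_integral_sub_lt {p : ℕ} {ν : Measure ℝ} [IsProbabilityMeasure ν]
    (h0 : ∫ x, x ∂ν = 0) (h1 : ∫ x, x ^ 2 ∂ν = 1) {S : Matrix (Fin p) (Fin p) ℝ}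
    (hS : S.PosSemidef) (C : ℝ) (f : Vec p →ᵇ ℝ) {ε : ℝ} (hε : 0 < ε) :
    ∃ δ : ℝ, 0 < δ ∧ ∃ N : ℕ, ∀ n ≥ N, ∀ a : Fin n → Vec p, (∀ i, ‖a i‖ ≤ C / Real.sqrt n) →
      (∀ c d, |∑ i, a i c * a i d - S c d| < δ) →
      |∫ x, f (∑ i, x i • a i) ∂(Measure.pi fun _ : Fin n => ν) -
        ∫ x, f x ∂(multivariateGaussian 0 S)| < ε := by
  -- Failure for all `δ = 1 / (k + 1)` and `N = k` would yield a sequence of coefficient vectors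
  -- violating the sequential theorem. Uniformity is what allows random coefficients later.
  by_contra! hcon
  have hk : ∀ k : ℕ, ∃ n ≥ k, ∃ a : Fin n → Vec p, (∀ i, ‖a i‖ ≤ C / Real.sqrt n) ∧
      (∀ c d, |∑ i, a i c * a i d - S c d| < 1 / ((k : ℝ) + 1)) ∧
      ε ≤ |∫ x, f (∑ i, x i • a i) ∂(Measure.pi fun _ : Fin n => ν) -
        ∫ x, f x ∂(multivariateGaussian 0 S)| := fun k => hcon _ (by positivity) k
  choose N hN a ha hcov hbad using hk
  have hNt : Tendsto N atTop atTop := tendsto_atTop_mono hN tendsto_id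
  have hb : Tendsto (fun k => C / Real.sqrt (N k)) atTop (𝓝 0) :=
    ((Real.tendsto_sqrt_atTop.comp tendsto_natCast_atTop_atTop).comp hNt).const_div_atTop C
  have hlim := tendsto_integral_map_sum_smul h0 h1 hS hb ha (fun c d => by
    rw [tendsto_iff_norm_sub_tendsto_zero]
    refine squeeze_zero (fun k => norm_nonneg _) (fun k => (hcov k c d).le) ?_
    exact tendsto_one_div_add_atTop_nhds_zero_nat) f
  obtain ⟨k, hk⟩ := (Metric.tendsto_nhds.1 hlim ε hε).exists
  exact absurd hk (not_lt.2 (hbad k))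

end CentralLimit

/-! ### Integrating out the multipliers for fixed data -/

section Freezing

lemma measurable_pi_of {Ω ι E : Type*} {m : MeasurableSpace Ω} [MeasurableSpace E]
    {w : ι → Ω → E} (hw : ∀ i, Measurable[m] (w i)) : Measurable[m] fun ω i => w i ω :=
  measurable_pi_lambda _ hw

variable {Ω : Type*} {m mΩ : MeasurableSpace Ω} {μ : Measure Ω} {ν : Measure ℝ} {n p : ℕ}
  {G : Fin n → Ω → ℝ}

/-- The conditional expectation given the data of a function of a multiplier sum. -/
lemma IsMultiplier.condExp_sum_smul [IsProbabilityMeasure μ] [IsProbabilityMeasure ν]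
    (hm : m ≤ mΩ) (hG : IsMultiplier m μ ν G) {w : Fin n → Ω → Vec p}
    (hw : ∀ i, Measurable[m] (w i)) (f : Vec p →ᵇ ℝ) :
    μ[fun ω => f (∑ i, G i ω • w i ω) | m] =ᵐ[μ]
      fun ω => ∫ x, f (∑ i, x i • w i ω) ∂(Measure.pi fun _ : Fin n => ν) := by
  set P := Measure.pi fun _ : Fin n => ν
  have hGm : Measurable fun ω i => G i ω := measurable_pi_lambda _ hG.measurable
  have hlaw : μ.map (fun ω i => G i ω) = P := by
    rw [(iIndepFun_iff_map_fun_eq_pi_map fun i => (hG.measurable i).aemeasurable).1 hG.indep]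
    simp only [hG.law]
    rfl
  have hwm : ∀ i, Measurable (w i) := fun i => (hw i).mono hm le_rfl
  have hWm : Measurable[m] fun ω i => w i ω := measurable_pi_of hw
  have hF : Measurable fun q : (Fin n → Vec p) × (Fin n → ℝ) => f (∑ i, q.2 i • q.1 i) :=
    f.continuous.measurable.comp (by fun_prop)
  have hΦ : StronglyMeasurable fun W : Fin n → Vec p => ∫ x, f (∑ i, x i • W i) ∂P :=
    hF.stronglyMeasurable.integral_prod_right'
  have hbound : ∀ W : Fin n → Vec p, ‖∫ x, f (∑ i, x i • W i) ∂P‖ ≤ ‖f‖ := fun W => by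
    refine (norm_integral_le_of_norm_le_const (Eventually.of_forall fun x =>
      f.norm_coe_le_norm _)).trans ?_
    simp
  have hΦw : Measurable[m] fun ω => ∫ x, f (∑ i, x i • w i ω) ∂P := hΦ.measurable.comp hWm
  have hint : Integrable (fun ω => ∫ x, f (∑ i, x i • w i ω) ∂P) μ :=
    Integrable.of_bound (hΦw.mono hm le_rfl).aestronglyMeasurable ‖f‖
      (Eventually.of_forall fun ω => hbound _)
  have hfm : Measurable fun ω => f (∑ i, G i ω • w i ω) :=
    hF.comp ((hWm.mono hm le_rfl).prodMk hGm)
  have hfint : Integrable (fun ω => f (∑ i, G i ω • w i ω)) μ :=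
    Integrable.of_bound hfm.aestronglyMeasurable ‖f‖
      (Eventually.of_forall fun ω => f.norm_coe_le_norm _)
  symm
  refine ae_eq_condExp_of_forall_setIntegral_eq hm hfint (fun s _ _ => hint.integrableOn)
    (fun s hs _ => ?_) hΦw.aestronglyMeasurable
  -- The indicator of the test set is carried along with the coefficients. The pair is a function of
  -- the data, hence independent of the multipliers, and Fubini's theorem for the product law gives
  -- the defining identity of the conditional expectation.
  set b : Ω → ℝ := s.indicator fun _ => 1
  have hb : Measurable[m] b := measurable_const.indicator hs
  have hbY : Measurable[m] fun ω => ((fun i => w i ω), b ω) := hWm.prodMk hb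
  have hY := hbY.mono hm le_rfl
  have hind : IndepFun (fun ω => ((fun i => w i ω), b ω)) (fun ω i => G i ω) μ := by
    rw [IndepFun_iff_Indep]
    refine indep_of_indep_of_le_left (indep_of_indep_of_le_right hG.indep_data.symm ?_)
      hbY.comap_le
    refine Measurable.comap_le (measurable_pi_of fun i => ?_)
    exact (comap_measurable (G i)).mono
      (le_iSup (fun i => MeasurableSpace.comap (G i) inferInstance) i) le_rfl
  have hprod := (indepFun_iff_map_prod_eq_prod_map_map hY.aemeasurable hGm.aemeasurable).1 hind
  rw [hlaw] at hprod
  have hY1 : IsProbabilityMeasure (μ.map fun ω => ((fun i => w i ω), b ω)) :=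
    Measure.isProbabilityMeasure_map hY.aemeasurable
  set F : ((Fin n → Vec p) × ℝ) × (Fin n → ℝ) → ℝ := fun q => q.1.2 * f (∑ i, q.2 i • q.1.1 i)
  have hFm : Measurable F := measurable_fst.snd.mul
    (hF.comp ((measurable_fst.comp measurable_fst).prodMk measurable_snd))
  have hYG : Measurable fun ω => (((fun i => w i ω), b ω), fun i => G i ω) := hY.prodMk hGm
  have hbb : ∀ ω, ‖b ω‖ ≤ 1 := fun ω => by
    by_cases h : ω ∈ s <;> simp [b, h]
  have hFi : Integrable F ((μ.map fun ω => ((fun i => w i ω), b ω)).prod P) := by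
    rw [← hprod, integrable_map_measure hFm.aestronglyMeasurable hYG.aemeasurable]
    exact hfint.bdd_mul (c := 1) (hb.mono hm le_rfl).aestronglyMeasurable
      (Eventually.of_forall hbb)
  have e1 : ∫ q, F q ∂((μ.map fun ω => ((fun i => w i ω), b ω)).prod P) =
      ∫ ω, b ω * f (∑ i, G i ω • w i ω) ∂μ := by
    rw [← hprod, integral_map hYG.aemeasurable hFm.aestronglyMeasurable]
  have e2 : ∫ q, F q ∂((μ.map fun ω => ((fun i => w i ω), b ω)).prod P) =
      ∫ ω, b ω * ∫ x, f (∑ i, x i • w i ω) ∂P ∂μ := by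
    rw [integral_prod _ hFi, integral_map hY.aemeasurable
      hFm.stronglyMeasurable.integral_prod_right'.aestronglyMeasurable]
    refine integral_congr_ae (Eventually.of_forall fun ω => ?_)
    exact integral_const_mul _ _
  have e3 : ∀ g : Ω → ℝ, ∫ ω in s, g ω ∂μ = ∫ ω, b ω * g ω ∂μ := fun g => by
    rw [← integral_indicator (hm s hs)]
    congr 1
    ext ω
    by_cases h : ω ∈ s <;> simp [b, h]
  rw [e3, e3, ← e1, e2]

end Freezing

/-! ### The conditional multiplier central limit theorem -/

section ConditionalCLT

variable {Ω : Type*} {m : ℕ → MeasurableSpace Ω} {mΩ : MeasurableSpace Ω} {μ : Measure Ω}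
  {ν : Measure ℝ} {p : ℕ} {G : (n : ℕ) → Fin n → Ω → ℝ}

/-- The conditional multiplier central limit theorem. -/
lemma condTendstoInLaw_multiplier [IsProbabilityMeasure μ] [IsProbabilityMeasure ν]
    (hm : ∀ n, m n ≤ mΩ) (hG : ∀ n, IsMultiplier (m n) μ ν (G n))
    (h0 : ∫ x, x ∂ν = 0) (h1 : ∫ x, x ^ 2 ∂ν = 1) {S : Matrix (Fin p) (Fin p) ℝ}
    (hS : S.PosSemidef) {w : (n : ℕ) → Fin n → Ω → Vec p} (hw : ∀ n i, Measurable[m n] (w n i))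
    {C : ℝ} (hC : ∀ n i ω, ‖w n i ω‖ ≤ C)
    (hcov : ∀ c d, Tendsto (fun q : ℕ × Ω => (q.1 : ℝ)⁻¹ * ∑ i, w q.1 i q.2 c * w q.1 i q.2 d)
      (probFilter μ) (𝓝 (S c d))) :
    CondTendstoInLaw μ m (fun n ω => (Real.sqrt n)⁻¹ • ∑ i, G n i ω • w n i ω)
      (multivariateGaussian 0 S) := by
  intro f
  rw [tendstoInMeasure_iff_probFilter]
  have hw' : ∀ n i, Measurable[m n] (fun ω => (Real.sqrt n)⁻¹ • w n i ω) :=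
    fun n i => by
    have h := (hw n i).const_smul (Real.sqrt n)⁻¹
    exact h
  have hce : ∀ n, ∀ᵐ ω ∂μ, (μ[fun ω => f ((Real.sqrt n)⁻¹ • ∑ i, G n i ω • w n i ω) | m n]) ω =
      ∫ x, f (∑ i, x i • (Real.sqrt n)⁻¹ • w n i ω) ∂(Measure.pi fun _ : Fin n => ν) := by
    intro n
    have := (hG n).condExp_sum_smul (hm n) (hw' n) f
    simp only [Finset.smul_sum, smul_comm (Real.sqrt n)⁻¹ (G n _ _)]
    exact this
  rw [Metric.tendsto_nhds]
  intro ε hε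
  -- `δ` and `N` do not depend on the coefficients, so they serve every sample whose empirical
  -- covariance is within `δ` of `S`; such samples have probability tending to one.
  obtain ⟨δ, hδ, N, hN⟩ := exists_forall_abs_integral_sub_lt h0 h1 hS C f hε
  have hcov' : ∀ᶠ q in probFilter μ, ∀ c d,
      |(q.1 : ℝ)⁻¹ * ∑ i, w q.1 i q.2 c * w q.1 i q.2 d - S c d| < δ :=
    eventually_all.2 fun c => eventually_all.2 fun d => Metric.tendsto_nhds.1 (hcov c d) δ hδ
  filter_upwards [hcov', eventually_probFilter_of_ae hce,
    tendsto_fst_probFilter.eventually (eventually_ge_atTop N)] with q h2 h3 h4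
  rw [h3, Real.dist_eq]
  refine hN q.1 h4 _ (fun i => ?_) fun c d => ?_
  · rw [norm_smul, norm_inv, Real.norm_of_nonneg (Real.sqrt_nonneg _), div_eq_inv_mul]
    exact mul_le_mul_of_nonneg_left (hC _ _ _) (by positivity)
  · convert h2 c d using 3
    rw [Finset.mul_sum]
    refine Finset.sum_congr rfl fun i _ => ?_
    simp only [PiLp.smul_apply, smul_eq_mul]
    rw [mul_mul_mul_comm, ← mul_inv, Real.mul_self_sqrt (Nat.cast_nonneg _)]

end ConditionalCLT

/-! ### The jump time of a counting process -/

/-- The jump time of `N i`, truncated at `τ`. -/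
def SurvivalData.jumpTime {Ω : Type*} {n p : ℕ} (D : SurvivalData Ω n p) (τ : ℝ≥0) (i : Fin n)
    (ω : Ω) : ℝ≥0 :=
  -- Inserting `τ` gives paths without an event the jump time `τ`; such values are harmless because
  -- they are multiplied by `N i τ = 0` whenever an integral is formed.
  sInf (insert τ {t | t ≤ τ ∧ 1 ≤ D.N i t ω})

section JumpTime

variable {Ω : Type*} {n p : ℕ} {D : SurvivalData Ω n p} {τ : ℝ≥0}

lemma measurable_of_preimage_Iic {m : MeasurableSpace Ω} {T : Ω → ℝ≥0}
    (h : ∀ t, MeasurableSet[m] (T ⁻¹' Set.Iic t)) : Measurable[m] T :=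
  measurable_of_Iic h

lemma SurvivalData.jumpTime_le (D : SurvivalData Ω n p) (τ : ℝ≥0) (i : Fin n) (ω : Ω) :
    D.jumpTime τ i ω ≤ τ :=
  csInf_le (OrderBot.bddBelow _) (Set.mem_insert _ _)

lemma SurvivalData.N_eq_zero_of_lt_jumpTime {i : Fin n} {ω : Ω} {t : ℝ≥0}
    (h : t < D.jumpTime τ i ω) : D.N i t ω = 0 := by
  by_contra hne
  refine absurd h (not_lt.2 (csInf_le (OrderBot.bddBelow _) (Set.mem_insert_of_mem _ ⟨?_, ?_⟩)))
  · exact h.le.trans (D.jumpTime_le τ i ω)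
  · exact Nat.one_le_iff_ne_zero.2 hne

lemma SurvivalData.measurable_N (i : Fin n) {t : ℝ≥0} (ht : t ≤ τ) : Measurable[D.obs τ] (D.N i t) := by
  refine Measurable.of_comap_le ?_
  exact le_trans (le_trans le_sup_left le_sup_left)
    (le_iSup_of_le i (le_iSup_of_le (⟨t, zero_le, ht⟩ : Set.Icc 0 τ) le_rfl))

namespace IsCoxModel

variable [mΩ : MeasurableSpace Ω] {μ : Measure Ω} {ℱ : Filtration ℝ≥0 mΩ} {haz : ℝ≥0 → ℝ}
    {β₀ : Vec p} {F : Set (Vec p)}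

lemma N_le (hC : IsCoxModel μ D ℱ τ haz β₀ F) {i : Fin n} {ω : Ω} {t : ℝ≥0} (ht : t ≤ τ) :
    D.N i t ω ≤ D.N i τ ω :=
  hC.N_mono i ω ⟨zero_le, ht⟩ ⟨zero_le, le_rfl⟩ ht

/-- By right continuity an integer-valued path is constant on a short interval after the jump time,
and this interval contains points where the path is at least one because the jump time is an
infimum. -/
lemma N_jumpTime (hC : IsCoxModel μ D ℱ τ haz β₀ F) (i : Fin n) (ω : Ω) :
    D.N i (D.jumpTime τ i ω) ω = D.N i τ ω := by
  set T := D.jumpTime τ i ω with hT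
  rcases (D.jumpTime_le τ i ω).eq_or_lt with h | h
  · rw [hT, h]
  refine le_antisymm (hC.N_le h.le) ?_
  refine (hC.N_le_one i ω).trans ?_
  have hd : {T' | T' ≤ τ ∧ 1 ≤ D.N i T' ω}.Nonempty := by
    by_contra hne
    rw [Set.not_nonempty_iff_eq_empty] at hne
    have : T = τ := by rw [hT, SurvivalData.jumpTime, hne]; simp
    exact h.ne this
  have hcont := hC.N_rightCont i ω T h
  have hev : ∀ᶠ s in 𝓝[≥] T, D.N i s ω = D.N i T ω := by
    have := hcont (IsOpen.mem_nhds (isOpen_discrete {D.N i T ω}) rfl)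
    exact this
  rw [eventually_nhdsWithin_iff, Metric.eventually_nhds_iff] at hev
  obtain ⟨ε, hε, hball⟩ := hev
  -- Staying below `τ` excludes the inserted point, so the point found is a genuine time with `N ≥
  -- 1`.
  have hlt : T < min τ (T + ⟨ε, hε.le⟩) := lt_min h (lt_add_of_pos_right _ (by exact_mod_cast hε))
  obtain ⟨s, hs, hs'⟩ := exists_lt_of_csInf_lt (Set.insert_nonempty _ _) (hT ▸ hlt)
  rcases hs with rfl | hs
  · exact absurd (hs'.trans_le (min_le_left _ _)) (lt_irrefl _)
  have hTs : T ≤ s := csInf_le (OrderBot.bddBelow _) (Set.mem_insert_of_mem _ hs)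
  rw [← hball ?_ hTs]
  · exact hs.2
  · rw [NNReal.dist_eq, abs_of_nonneg (sub_nonneg.2 (by exact_mod_cast hTs))]
    have : (s : ℝ) < T + ε := by exact_mod_cast hs'.trans_le (min_le_right _ _)
    linarith

lemma N_eq_of_jumpTime_le (hC : IsCoxModel μ D ℱ τ haz β₀ F) {i : Fin n} {ω : Ω} {t : ℝ≥0}
    (ht : t ≤ τ) (h : D.jumpTime τ i ω ≤ t) : D.N i t ω = D.N i τ ω := by
  refine le_antisymm (hC.N_le ht) ?_
  rw [← hC.N_jumpTime i ω]
  exact hC.N_mono i ω ⟨zero_le, D.jumpTime_le τ i ω⟩ ⟨zero_le, ht⟩ h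

lemma N_eq_ite (hC : IsCoxModel μ D ℱ τ haz β₀ F) {i : Fin n} {ω : Ω} {t : ℝ≥0} (ht : t ≤ τ) :
    D.N i t ω = if D.jumpTime τ i ω ≤ t then D.N i τ ω else 0 := by
  split_ifs with h
  · exact hC.N_eq_of_jumpTime_le ht h
  · exact SurvivalData.N_eq_zero_of_lt_jumpTime (not_le.1 h)

lemma N_eq_zero_or_one (hC : IsCoxModel μ D ℱ τ haz β₀ F) (i : Fin n) (ω : Ω) :
    D.N i τ ω = 0 ∨ D.N i τ ω = 1 := by
  have := hC.N_le_one i ω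
  omega

lemma jumpTime_pos (hC : IsCoxModel μ D ℱ τ haz β₀ F) {i : Fin n} {ω : Ω}
    (h : D.N i τ ω = 1) : 0 < D.jumpTime τ i ω := by
  rw [pos_iff_ne_zero]
  intro h0
  have h1 := hC.N_jumpTime i ω
  rw [h0, hC.N_zero, h] at h1
  exact zero_ne_one h1

lemma jumpTimes_eq (hC : IsCoxModel μ D ℱ τ haz β₀ F) (i : Fin n) (ω : Ω) :
    D.jumpTimes τ i ω = if D.N i τ ω = 1 then {D.jumpTime τ i ω} else ∅ := by
  ext t
  constructor
  · rintro ⟨h0, h1, h2⟩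
    have h3 : 1 ≤ D.N i t ω := Nat.one_le_iff_ne_zero.2 fun h => by
      have := h2 0 h0
      omega
    have h4 : D.N i τ ω = 1 := le_antisymm (hC.N_le_one i ω) (h3.trans (hC.N_le h1))
    rw [if_pos h4]
    refine le_antisymm ?_ ?_
    · by_contra hlt
      have := h2 _ (not_le.1 hlt)
      rw [hC.N_jumpTime, h4] at this
      have := hC.N_le (i := i) (ω := ω) h1
      omega
    · by_contra hlt
      have := SurvivalData.N_eq_zero_of_lt_jumpTime (not_le.1 hlt)
      omega
  · intro h
    split_ifs at h with h4
    · rw [Set.mem_singleton_iff] at h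
      subst h
      refine ⟨hC.jumpTime_pos h4, D.jumpTime_le τ i ω, fun s hs => ?_⟩
      rw [SurvivalData.N_eq_zero_of_lt_jumpTime hs, hC.N_jumpTime, h4]
      exact Nat.one_pos
    · exact absurd h (Set.notMem_empty _)

/-- There is at most one jump, so every integral against `N i` is an evaluation at a random time. No
theory of stochastic integration is needed. -/
lemma intN_eq (hC : IsCoxModel μ D ℱ τ haz β₀ F) {E : Type*} [AddCommGroup E] [Module ℝ E]
    (i : Fin n) (ω : Ω) (H : ℝ≥0 → E) :
    D.intN τ i ω H = (D.N i τ ω : ℝ) • H (D.jumpTime τ i ω) := by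
  unfold SurvivalData.intN
  rw [hC.jumpTimes_eq]
  rcases hC.N_eq_zero_or_one i ω with h | h
  · simp [h]
  · rw [if_pos h, finsum_mem_singleton, h]
    simp

lemma ae_jumpTime_ne (hC : IsCoxModel μ D ℱ τ haz β₀ F) {i j : Fin n} (hij : i ≠ j) :
    ∀ᵐ ω ∂μ, D.N i τ ω = 1 → D.N j τ ω = 1 → D.jumpTime τ i ω ≠ D.jumpTime τ j ω := by
  filter_upwards [hC.no_common_jumps i j hij] with ω hω hi hj h
  rw [hC.jumpTimes_eq, hC.jumpTimes_eq, if_pos hi, if_pos hj, h] at hω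
  simp at hω

/-- The strict inequality matters: at `t = τ` the left side always holds, whether or not there is an
event. -/
lemma jumpTime_le_iff (hC : IsCoxModel μ D ℱ τ haz β₀ F) {i : Fin n} {ω : Ω} {t : ℝ≥0}
    (ht : t < τ) : D.jumpTime τ i ω ≤ t ↔ D.N i t ω = 1 := by
  constructor
  · intro h
    have hT : D.jumpTime τ i ω < τ := h.trans_lt ht
    rw [hC.N_eq_of_jumpTime_le ht.le h]
    by_contra hne
    have h0 : D.N i τ ω = 0 := (hC.N_eq_zero_or_one i ω).resolve_right hne
    have : {t | t ≤ τ ∧ 1 ≤ D.N i t ω} = ∅ := by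
      ext s
      simp only [Set.mem_ofPred_eq, Set.mem_empty_iff_false, iff_false, not_and]
      intro hs h1
      have := hC.N_le (i := i) (ω := ω) hs
      omega
    have : D.jumpTime τ i ω = τ := by rw [SurvivalData.jumpTime, this]; simp
    exact hT.ne this
  · intro h
    by_contra hlt
    have := SurvivalData.N_eq_zero_of_lt_jumpTime (not_le.1 hlt)
    omega

/-- The truncated jump time is a stopping time. -/
lemma measurableSet_jumpTime_le (hC : IsCoxModel μ D ℱ τ haz β₀ F) (i : Fin n) (t : ℝ≥0) :
    MeasurableSet[ℱ t] {ω | D.jumpTime τ i ω ≤ t} := by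
  by_cases ht : t < τ
  · have : {ω | D.jumpTime τ i ω ≤ t} = D.N i t ⁻¹' {1} := by
      ext ω; exact hC.jumpTime_le_iff ht
    rw [this]
    exact hC.N_adapted i t ht.le (measurableSet_singleton 1)
  · have : {ω | D.jumpTime τ i ω ≤ t} = Set.univ := by
      ext ω
      simpa using (D.jumpTime_le τ i ω).trans (not_lt.1 ht)
    rw [this]
    exact MeasurableSet.univ

lemma measurable_min_jumpTime (hC : IsCoxModel μ D ℱ τ haz β₀ F) (i : Fin n) (u : ℝ≥0) :
    Measurable[ℱ u] fun ω => min (D.jumpTime τ i ω) u := by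
  refine measurable_of_preimage_Iic fun t => ?_
  by_cases ht : u ≤ t
  · have : (fun ω => min (D.jumpTime τ i ω) u) ⁻¹' Set.Iic t = Set.univ := by
      ext ω; simp [ht]
    rw [this]
    exact MeasurableSet.univ
  · have : (fun ω => min (D.jumpTime τ i ω) u) ⁻¹' Set.Iic t = {ω | D.jumpTime τ i ω ≤ t} := by
      ext ω; simp [ht]
    rw [this]
    exact ℱ.mono (not_le.1 ht).le _ (hC.measurableSet_jumpTime_le i t)

lemma measurable_jumpTime (hC : IsCoxModel μ D ℱ τ haz β₀ F) (i : Fin n) :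
    Measurable (D.jumpTime τ i) :=
  measurable_of_Iic fun t => ℱ.le t _ (hC.measurableSet_jumpTime_le i t)

/-- Predictable processes are progressive, so their value at a stopping time truncated at `u` is
known at time `u`. -/
lemma measurable_comp_min_jumpTime (hC : IsCoxModel μ D ℱ τ haz β₀ F) (i : Fin n) {u : ℝ≥0}
    {H : ℝ≥0 → Ω → ℝ} (hH : IsStronglyPredictable ℱ H) :
    Measurable[ℱ u] fun ω => H (min (D.jumpTime τ i ω) u) ω := by
  have h1 : Measurable[Subtype.instMeasurableSpace.prod (ℱ u)]
      fun q : Set.Iic u × Ω => H q.1 q.2 :=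
    StronglyMeasurable.measurable (hH.isStronglyProgressive u)
  have h2 : @Measurable Ω (Set.Iic u × Ω) (ℱ u) (Subtype.instMeasurableSpace.prod (ℱ u))
      fun ω => (⟨min (D.jumpTime τ i ω) u, Set.mem_Iic.2 (min_le_right _ _)⟩, ω) := by
    refine Measurable.prodMk ?_ measurable_id
    exact Measurable.subtype_mk (hC.measurable_min_jumpTime i u)
  exact h1.comp h2

lemma obs_le (hC : IsCoxModel μ D ℱ τ haz β₀ F) : D.obs τ ≤ mΩ := by
  refine iSup_le fun i => iSup_le fun t => sup_le (sup_le ?_ ?_) ?_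
  · exact ((hC.N_adapted i t t.2.2).mono (ℱ.le _) le_rfl).comap_le
  · exact (((hC.Y_predictable i).stronglyAdapted t).measurable.mono (ℱ.le _) le_rfl).comap_le
  · exact (((hC.X_predictable i).stronglyAdapted t).measurable.mono (ℱ.le _) le_rfl).comap_le

lemma measurable_jumpTime_obs (hC : IsCoxModel μ D ℱ τ haz β₀ F) (i : Fin n) :
    Measurable[D.obs τ] (D.jumpTime τ i) := by
  refine measurable_of_preimage_Iic fun t => ?_
  by_cases ht : t < τ
  · have : (D.jumpTime τ i) ⁻¹' Set.Iic t = D.N i t ⁻¹' {1} := by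
      ext ω; exact hC.jumpTime_le_iff ht
    rw [this]
    exact SurvivalData.measurable_N i ht.le (measurableSet_singleton 1)
  · have : (D.jumpTime τ i) ⁻¹' Set.Iic t = Set.univ := by
      ext ω
      simpa using (D.jumpTime_le τ i ω).trans (not_lt.1 ht)
    rw [this]
    exact MeasurableSet.univ

/-- Joint measurability with respect to the data makes values at the random jump time functions of
the data; measurability at each fixed time would not do. -/
lemma measurable_comp_jumpTime_obs (hC : IsCoxModel μ D ℱ τ haz β₀ F) (i : Fin n)
    {E : Type*} [MeasurableSpace E] {Z : ℝ≥0 → Ω → E} (hZ : JointlyMeasurable (D.obs τ) τ Z) :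
    Measurable[D.obs τ] fun ω => Z (D.jumpTime τ i ω) ω := by
  have h2 : @Measurable Ω (Set.Icc 0 τ × Ω) (D.obs τ) (Subtype.instMeasurableSpace.prod (D.obs τ))
      fun ω => (⟨D.jumpTime τ i ω, zero_le, D.jumpTime_le τ i ω⟩, ω) := by
    refine Measurable.prodMk ?_ measurable_id
    exact Measurable.subtype_mk (hC.measurable_jumpTime_obs i)
  exact Measurable.comp hZ h2

end IsCoxModel

end JumpTime

/-! ### The predictable σ-algebra -/

section Predictable

variable {Ω : Type*} {mΩ : MeasurableSpace Ω} {ℱ : Filtration ℝ≥0 mΩ}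

lemma predictable_le (ℱ : Filtration ℝ≥0 mΩ) :
    ℱ.predictable ≤ (inferInstance : MeasurableSpace (ℝ≥0 × Ω)) := by
  refine measurableSpace_le_predictable_of_measurableSet (fun A hA => ?_) fun t A hA => ?_
  · exact (measurableSet_singleton _).prod (ℱ.le _ _ hA)
  · exact measurableSet_Ioi.prod (ℱ.le _ _ hA)

/-- Rectangles over `{0}` and over open half-lines never meet; two of the same kind intersect in a
third of that kind. -/
lemma isPiSystem_predictable (ℱ : Filtration ℝ≥0 mΩ) : IsPiSystem
    ({s | ∃ A, MeasurableSet[ℱ ⊥] A ∧ s = {⊥} ×ˢ A} ∪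
    {s | ∃ i A, MeasurableSet[ℱ i] A ∧ s = Set.Ioi i ×ˢ A} : Set (Set (ℝ≥0 × Ω))) := by
  rintro s hs t ht hne
  rcases hs with ⟨A, hA, rfl⟩ | ⟨i, A, hA, rfl⟩ <;> rcases ht with ⟨B, hB, rfl⟩ | ⟨j, B, hB, rfl⟩
  · refine Or.inl ⟨A ∩ B, hA.inter hB, ?_⟩
    rw [Set.prod_inter_prod, Set.inter_self]
  · obtain ⟨⟨x, ω⟩, ⟨h1, -⟩, ⟨h2, -⟩⟩ := hne
    have h1' : x = ⊥ := h1
    have h2' : j < x := h2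
    exact absurd (h1' ▸ h2') not_lt_bot
  · obtain ⟨⟨x, ω⟩, ⟨h2, -⟩, ⟨h1, -⟩⟩ := hne
    have h1' : x = ⊥ := h1
    have h2' : i < x := h2
    exact absurd (h1' ▸ h2') not_lt_bot
  · refine Or.inr ⟨max i j, A ∩ B, ?_, ?_⟩
    · exact (ℱ.mono (le_max_left i j) _ hA).inter (ℱ.mono (le_max_right i j) _ hB)
    · rw [Set.prod_inter_prod, Set.Ioi_inter_Ioi]

/-- Finite measures that agree on the generators of the predictable `σ`-algebra integrate
predictable processes in the same way. -/
lemma integral_eq_of_predictable {ρ₁ ρ₂ : Measure (ℝ≥0 × Ω)} [IsFiniteMeasure ρ₁]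
    [IsFiniteMeasure ρ₂] (h₁ : ρ₁ ({0} ×ˢ Set.univ) = 0) (h₂ : ρ₂ ({0} ×ˢ Set.univ) = 0)
    (h : ∀ s A, MeasurableSet[ℱ s] A → ρ₁ (Set.Ioi s ×ˢ A) = ρ₂ (Set.Ioi s ×ˢ A))
    {H : ℝ≥0 → Ω → ℝ} (hH : IsStronglyPredictable ℱ H) :
    ∫ q, H q.1 q.2 ∂ρ₁ = ∫ q, H q.1 q.2 ∂ρ₂ := by
  have key : ρ₁.trim (predictable_le ℱ) = ρ₂.trim (predictable_le ℱ) := by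
    refine @ext_of_generate_finite _ ℱ.predictable _ _ _ rfl (isPiSystem_predictable ℱ) _ ?_ ?_
    · intro s hs
      have hsm : MeasurableSet[ℱ.predictable] s := MeasurableSpace.measurableSet_generateFrom hs
      rw [trim_measurableSet_eq _ hsm, trim_measurableSet_eq _ hsm]
      rcases hs with ⟨A, hA, rfl⟩ | ⟨i, A, hA, rfl⟩
      · have hsub : ({⊥} ×ˢ A : Set (ℝ≥0 × Ω)) ⊆ {0} ×ˢ Set.univ :=
          Set.prod_mono le_rfl (Set.subset_univ _)
        rw [measure_mono_null hsub h₁, measure_mono_null hsub h₂]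
      · exact h i A hA
    · rw [trim_measurableSet_eq _ MeasurableSet.univ, trim_measurableSet_eq _ MeasurableSet.univ]
      -- The total masses agree because time zero is null for both measures and the rest is the
      -- generator starting at zero.
      have hu : (Set.univ : Set (ℝ≥0 × Ω)) = {0} ×ˢ Set.univ ∪ Set.Ioi 0 ×ˢ Set.univ := by
        ext ⟨x, ω⟩
        simp only [Set.mem_univ, Set.mem_union, Set.mem_prod, Set.mem_singleton_iff, and_true,
          Set.mem_Ioi, true_iff]
        rcases eq_or_ne x 0 with h | h
        · exact Or.inl h
        · exact Or.inr (pos_iff_ne_zero.2 h)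
      have hd : Disjoint ({0} ×ˢ Set.univ : Set (ℝ≥0 × Ω)) (Set.Ioi 0 ×ˢ Set.univ) := by
        rw [Set.disjoint_left]
        rintro ⟨x, ω⟩ ⟨h1, -⟩ ⟨h2, -⟩
        have h1' : x = 0 := h1
        have h2' : 0 < x := h2
        exact h2'.ne' h1'
      have hm : MeasurableSet (Set.Ioi (0 : ℝ≥0) ×ˢ (Set.univ : Set Ω)) :=
        measurableSet_Ioi.prod MeasurableSet.univ
      rw [hu, measure_union hd hm, measure_union hd hm, h₁, h₂, h 0 _ MeasurableSet.univ]
  change ∫ q, Function.uncurry H q ∂ρ₁ = ∫ q, Function.uncurry H q ∂ρ₂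
  rw [integral_trim (predictable_le ℱ) hH, key, ← integral_trim (predictable_le ℱ) hH]

lemma IsStronglyPredictable_measurable {H : ℝ≥0 → Ω → ℝ} (hH : IsStronglyPredictable ℱ H) :
    Measurable (Function.uncurry H) :=
  hH.measurable.mono (predictable_le ℱ) le_rfl

lemma isStronglyPredictable_of_measurable {H : ℝ≥0 → Ω → ℝ}
    (hH : Measurable[ℱ.predictable] (Function.uncurry H)) : IsStronglyPredictable ℱ H :=
  Measurable.stronglyMeasurable hH

/-- `1_{(u, v]}(t) ξ(ω)` is predictable if `ξ` is known at time `u`. -/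
lemma isStronglyPredictable_indicator_Ioc (u v : ℝ≥0) {ξ : Ω → ℝ} (hξ : Measurable[ℱ u] ξ) :
    IsStronglyPredictable ℱ fun t ω => (Set.Ioc u v).indicator (fun _ => ξ ω) t := by
  refine isStronglyPredictable_of_measurable fun B hB => ?_
  have hpre : ∀ B : Set ℝ, MeasurableSet B → (0 : ℝ) ∉ B → MeasurableSet[ℱ.predictable]
      ((Function.uncurry fun t ω => (Set.Ioc u v).indicator (fun _ => ξ ω) t) ⁻¹' B) := by
    intro B hB h0
    have : (Function.uncurry fun t ω => (Set.Ioc u v).indicator (fun _ => ξ ω) t) ⁻¹' B =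
        Set.Ioc u v ×ˢ (ξ ⁻¹' B) := by
      ext ⟨t, ω⟩
      by_cases ht : t ∈ Set.Ioc u v <;> simp [Function.uncurry, ht, h0]
    rw [this]
    exact measurableSet_predictable_Ioc_prod u v (hξ hB)
  -- A preimage is a rectangle only if the target set avoids zero, the value off the interval;
  -- otherwise pass to complements.
  by_cases h0 : (0 : ℝ) ∈ B
  · have := (hpre Bᶜ hB.compl (by simpa using h0)).compl
    rwa [← Set.preimage_compl, compl_compl] at this
  · exact hpre B hB h0

lemma isStronglyPredictable_mul {H K : ℝ≥0 → Ω → ℝ} (hH : IsStronglyPredictable ℱ H)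
    (hK : IsStronglyPredictable ℱ K) : IsStronglyPredictable ℱ fun t ω => H t ω * K t ω := by
  have h := hH.measurable.mul hK.measurable
  exact isStronglyPredictable_of_measurable h

end Predictable

/-! ### Expectations of integrals of predictable processes -/

section Compensator

variable {Ω : Type*} [mΩ : MeasurableSpace Ω] {μ : Measure Ω} {n p : ℕ}
    {D : SurvivalData Ω n p} {ℱ : Filtration ℝ≥0 mΩ} {τ : ℝ≥0} {haz : ℝ≥0 → ℝ} {β₀ : Vec p}
    {F : Set (Vec p)}

/-- `∫₀ᵗ H dΛ_i`, with the cumulative intensity `Λ_i` of `N i`. -/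
def SurvivalData.compensator (D : SurvivalData Ω n p) (haz : ℝ≥0 → ℝ) (β₀ : Vec p) (i : Fin n)
    (H : ℝ≥0 → Ω → ℝ) (t : ℝ≥0) (ω : Ω) : ℝ :=
  timeIntegral t fun s => H s ω * (D.risk i s β₀ ω * haz s)

namespace IsCoxModel

lemma risk_predictable (hC : IsCoxModel μ D ℱ τ haz β₀ F) (i : Fin n) :
    IsStronglyPredictable ℱ fun t ω => D.risk i t β₀ ω := by
  refine isStronglyPredictable_of_measurable ?_
  have hX : Measurable[ℱ.predictable] (Function.uncurry (D.X i)) := (hC.X_predictable i).measurable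
  have h1 : Measurable[ℱ.predictable] fun q : ℝ≥0 × Ω => inner ℝ (D.X i q.1 q.2) β₀ :=
    hX.inner measurable_const
  have h := (hC.Y_predictable i).measurable.mul (Real.measurable_exp.comp h1)
  exact h

lemma risk_nonneg (hC : IsCoxModel μ D ℱ τ haz β₀ F) (i : Fin n) {t : ℝ≥0} (ht : t ≤ τ)
    (β : Vec p) (ω : Ω) : 0 ≤ D.risk i t β ω := by
  unfold SurvivalData.risk
  rcases hC.Y_indicator i t ht ω with h | h <;> rw [h] <;> positivity

lemma risk_le (hC : IsCoxModel μ D ℱ τ haz β₀ F) {C : ℝ} (hF : ∀ x ∈ F, ‖x‖ ≤ C) (i : Fin n)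
    {t : ℝ≥0} (ht : t ≤ τ) (β : Vec p) (ω : Ω) : D.risk i t β ω ≤ Real.exp (C * ‖β‖) := by
  have h1 : Real.exp (inner ℝ (D.X i t ω) β) ≤ Real.exp (C * ‖β‖) := by
    refine Real.exp_le_exp.2 ((real_inner_le_norm _ _).trans ?_)
    exact mul_le_mul_of_nonneg_right (hF _ (hC.X_mem i t ht ω)) (norm_nonneg _)
  unfold SurvivalData.risk
  rcases hC.Y_indicator i t ht ω with h | h <;> rw [h]
  · rw [zero_mul]; positivity
  · rwa [one_mul]

end IsCoxModel

lemma toNNReal_le_of_mem_Ioc {u : ℝ} {t : ℝ≥0} (h : u ∈ Set.Ioc (0 : ℝ) t) : u.toNNReal ≤ t :=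
  Real.toNNReal_le_iff_le_coe.2 h.2

lemma timeIntegral_eq (t : ℝ≥0) (f : ℝ≥0 → ℝ) :
    timeIntegral t f = ∫ u in Set.Ioc (0 : ℝ) t, f u.toNNReal :=
  intervalIntegral.integral_of_le t.2

namespace IsCoxModel

lemma integrable_intensity [IsProbabilityMeasure μ] (hC : IsCoxModel μ D ℱ τ haz β₀ F) {C : ℝ} (hF : ∀ x ∈ F, ‖x‖ ≤ C)
    (hz : Measurable haz)
    (hzi : IntervalIntegrable (fun s : ℝ => haz s.toNNReal) volume 0 τ) (i : Fin n)
    {H : ℝ≥0 → Ω → ℝ} (hH : Measurable (Function.uncurry H)) {K : ℝ}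
    (hK : ∀ t ≤ τ, ∀ ω, |H t ω| ≤ K) :
    Integrable (fun q : Ω × ℝ => H q.2.toNNReal q.1 *
      (D.risk i q.2.toNNReal β₀ q.1 * haz q.2.toNNReal))
      (μ.prod (volume.restrict (Set.Ioc (0 : ℝ) τ))) := by
  have hmap : Measurable fun q : Ω × ℝ => (q.2.toNNReal, q.1) :=
    (measurable_real_toNNReal.comp measurable_snd).prodMk measurable_fst
  have h1 : Measurable fun q : Ω × ℝ => H q.2.toNNReal q.1 := hH.comp hmap
  have h2 : Measurable fun q : Ω × ℝ => D.risk i q.2.toNNReal β₀ q.1 :=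
    (IsStronglyPredictable_measurable (hC.risk_predictable i)).comp hmap
  have h3 : Measurable fun q : Ω × ℝ => haz q.2.toNNReal :=
    hz.comp (measurable_real_toNNReal.comp measurable_snd)
  have hi : Integrable (fun q : Ω × ℝ => haz q.2.toNNReal)
      (μ.prod (volume.restrict (Set.Ioc (0 : ℝ) τ))) := by
    have := (intervalIntegrable_iff_integrableOn_Ioc_of_le τ.2).1 hzi
    exact this.comp_snd μ
  have hmem : ∀ᵐ q ∂(μ.prod (volume.restrict (Set.Ioc (0 : ℝ) τ))), q.2 ∈ Set.Ioc (0 : ℝ) τ := by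
    have h := ae_restrict_mem (μ := volume) (measurableSet_Ioc (a := (0 : ℝ)) (b := τ))
    exact Measure.quasiMeasurePreserving_snd.ae h
  have := hi.bdd_mul (c := K * Real.exp (C * ‖β₀‖)) (f := fun q : Ω × ℝ =>
    H q.2.toNNReal q.1 * D.risk i q.2.toNNReal β₀ q.1) (h1.mul h2).aestronglyMeasurable ?_
  · refine this.congr (Eventually.of_forall fun q => ?_)
    exact mul_assoc _ _ _
  · filter_upwards [hmem] with q hq
    have ht := toNNReal_le_of_mem_Ioc hq
    rw [Real.norm_eq_abs, abs_mul, abs_of_nonneg (hC.risk_nonneg i ht _ _)]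
    exact mul_le_mul (hK _ ht _) (hC.risk_le hF i ht _ _) (hC.risk_nonneg i ht _ _)
      ((abs_nonneg _).trans (hK _ ht q.1))

/-- The process is stopped at `τ`, so comparing times `s` and `max s τ` covers every `s`, also
beyond `τ`, as the generators of the predictable σ-algebra require. -/
lemma martingale_increment [IsProbabilityMeasure μ] (hC : IsCoxModel μ D ℱ τ haz β₀ F) (i : Fin n) (s : ℝ≥0) {A : Set Ω}
    (hA : MeasurableSet[ℱ s] A) :
    ∫ ω in A, (((D.N i τ ω : ℝ) - D.compensator haz β₀ i (fun _ _ => 1) τ ω) -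
      ((D.N i (min s τ) ω : ℝ) - D.compensator haz β₀ i (fun _ _ => 1) (min s τ) ω)) ∂μ = 0 := by
  have hM := hC.martingale i
  have e : ∀ t ω, timeIntegral (min t τ)
      (fun s => D.Y i s ω * haz s * Real.exp (inner ℝ (D.X i s ω) β₀)) =
      D.compensator haz β₀ i (fun _ _ => 1) (min t τ) ω := fun t ω => by
    unfold SurvivalData.compensator SurvivalData.risk
    congr 1
    ext u
    ring
  simp only [e] at hM
  have h := hM.setIntegral_eq (le_max_left s τ) hA
  have h1 := hM.integrable (max s τ)
  have h2 := hM.integrable s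
  simp only [min_eq_right (le_max_right s τ)] at h h1
  rw [integral_sub h1.integrableOn h2.integrableOn, sub_eq_zero]
  exact h.symm

/-- `∫₀^τ H dN_i` and `∫₀^τ H dΛ_i` have the same expectation for predictable `H`. -/
lemma integral_N_mul_eq [IsProbabilityMeasure μ] (hC : IsCoxModel μ D ℱ τ haz β₀ F) {C : ℝ} (hF : ∀ x ∈ F, ‖x‖ ≤ C)
    (hz : Measurable haz) (hz0 : ∀ t, 0 ≤ haz t)
    (hzi : IntervalIntegrable (fun s : ℝ => haz s.toNNReal) volume 0 τ) (i : Fin n)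
    {H : ℝ≥0 → Ω → ℝ} (hH : IsStronglyPredictable ℱ H) {K : ℝ}
    (hK : ∀ t ≤ τ, ∀ ω, |H t ω| ≤ K) :
    ∫ ω, (D.N i τ ω : ℝ) * H (D.jumpTime τ i ω) ω ∂μ =
      ∫ ω, D.compensator haz β₀ i H τ ω ∂μ := by
  set T := D.jumpTime τ i with hT
  have hTm : Measurable T := hC.measurable_jumpTime i
  have hNm : Measurable (D.N i τ) := (hC.N_adapted i τ le_rfl).mono (ℱ.le _) le_rfl
  set S1 : Set Ω := {ω | D.N i τ ω = 1} with hS1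
  have hS1m : MeasurableSet S1 := hNm (measurableSet_singleton 1)
  have hΦ : Measurable fun ω => (T ω, ω) := hTm.prodMk measurable_id
  set P := μ.prod (volume.restrict (Set.Ioc (0 : ℝ) τ)) with hP
  set a : Ω × ℝ → ℝ := fun q => D.risk i q.2.toNNReal β₀ q.1 * haz q.2.toNNReal with ha
  have hΨ : Measurable fun q : Ω × ℝ => (q.2.toNNReal, q.1) :=
    (measurable_real_toNNReal.comp measurable_snd).prodMk measurable_fst
  have ham : Measurable a :=
    ((IsStronglyPredictable_measurable (hC.risk_predictable i)).comp hΨ).mul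
      (hz.comp (measurable_real_toNNReal.comp measurable_snd))
  have hai : Integrable a P := by
    have := hC.integrable_intensity hF hz hzi i (H := fun _ _ => 1) measurable_const (K := 1)
      (fun _ _ _ => by simp)
    simpa using this
  have hmem : ∀ᵐ q ∂P, q.2 ∈ Set.Ioc (0 : ℝ) τ := by
    have h := ae_restrict_mem (μ := volume) (measurableSet_Ioc (a := (0 : ℝ)) (b := τ))
    exact Measure.quasiMeasurePreserving_snd.ae h
  have ha0 : 0 ≤ᵐ[P] a := by
    filter_upwards [hmem] with q hq
    exact mul_nonneg (hC.risk_nonneg i (toNNReal_le_of_mem_Ioc hq) _ _) (hz0 _)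
  set Q := P.withDensity fun q => ENNReal.ofReal (a q) with hQ
  have hQf : IsFiniteMeasure Q := isFiniteMeasure_withDensity_ofReal hai.2
  -- `ρ₁` is the distribution of the pair of jump time and outcome on the event of a jump, and `ρ₂`
  -- is the intensity measure. The two sides of the claim are the integrals of `H` against them, so
  -- it suffices to compare the measures on generators.
  set ρ₁ := (μ.restrict S1).map fun ω => (T ω, ω) with hρ₁
  set ρ₂ := Q.map fun q : Ω × ℝ => (q.2.toNNReal, q.1) with hρ₂
  have hQ0 : ∀ s, MeasurableSet s → Q s = ENNReal.ofReal (∫ q in s, a q ∂P) := by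
    intro s hs
    rw [hQ, withDensity_apply _ hs, ofReal_integral_eq_lintegral_ofReal hai.integrableOn
      (ae_restrict_of_ae ha0)]
  have key := integral_eq_of_predictable (ℱ := ℱ) (ρ₁ := ρ₁) (ρ₂ := ρ₂) ?_ ?_ ?_ hH
  · have e1 : ∫ q, H q.1 q.2 ∂ρ₁ = ∫ ω, (D.N i τ ω : ℝ) * H (T ω) ω ∂μ := by
      change ∫ q, Function.uncurry H q ∂ρ₁ = _
      rw [hρ₁, integral_map hΦ.aemeasurable
        (IsStronglyPredictable_measurable hH).aestronglyMeasurable, ← integral_indicator hS1m]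
      congr 1
      ext ω
      rcases hC.N_eq_zero_or_one i ω with h | h <;> simp [hS1, h]
    have e2 : ∫ q, H q.1 q.2 ∂ρ₂ = ∫ ω, D.compensator haz β₀ i H τ ω ∂μ := by
      change ∫ q, Function.uncurry H q ∂ρ₂ = _
      rw [hρ₂, integral_map hΨ.aemeasurable
        (IsStronglyPredictable_measurable hH).aestronglyMeasurable, hQ,
        integral_withDensity_eq_integral_toReal_smul ham.ennreal_ofReal
          (Eventually.of_forall fun _ => ENNReal.ofReal_lt_top)]
      have h3 := hC.integrable_intensity hF hz hzi i (IsStronglyPredictable_measurable hH) hK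
      rw [integral_congr_ae (g := fun q : Ω × ℝ => H q.2.toNNReal q.1 *
        (D.risk i q.2.toNNReal β₀ q.1 * haz q.2.toNNReal)), integral_prod _ h3]
      · simp only [SurvivalData.compensator, timeIntegral_eq]
      · filter_upwards [ha0] with q hq
        rw [ENNReal.toReal_ofReal hq, smul_eq_mul, mul_comm]
        rfl
    rw [← e1, key, e2]
  · rw [hρ₁, Measure.map_apply hΦ ((measurableSet_singleton _).prod MeasurableSet.univ),
      Measure.restrict_apply (hΦ ((measurableSet_singleton _).prod MeasurableSet.univ))]
    convert measure_empty (μ := μ)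
    ext ω
    simp only [Set.mem_inter_iff, Set.mem_preimage, Set.mem_prod, Set.mem_singleton_iff,
      Set.mem_univ, and_true, Set.mem_empty_iff_false, iff_false, not_and]
    intro h0 h1
    exact (hC.jumpTime_pos h1).ne' h0
  · rw [hρ₂, Measure.map_apply hΨ ((measurableSet_singleton _).prod MeasurableSet.univ)]
    refine withDensity_absolutelyContinuous P _ ?_
    rw [← compl_compl ((fun q : Ω × ℝ => (q.2.toNNReal, q.1)) ⁻¹' _), ← mem_ae_iff]
    filter_upwards [hmem] with q hq h0
    simp only [Set.mem_preimage, Set.mem_prod, Set.mem_singleton_iff, Set.mem_univ, and_true,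
      Real.toNNReal_eq_zero] at h0
    exact absurd hq.1 (not_lt.2 h0)
  -- The masses of this rectangle are the expected increments after `s`, restricted to `A`, of the
  -- counting process and of its compensator. They agree by the martingale property.
  · intro s A hA
    have hAm : MeasurableSet A := ℱ.le _ _ hA
    have hset : MeasurableSet (Set.Ioi s ×ˢ A) := measurableSet_Ioi.prod hAm
    rw [hρ₁, hρ₂, Measure.map_apply hΦ hset, Measure.map_apply hΨ hset, hQ0 _ (hΨ hset),
      Measure.restrict_apply (hΦ hset), ← ofReal_measureReal]
    congr 1
    have hinc := hC.martingale_increment i s hA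
    set cmp := D.compensator haz β₀ i (fun _ _ => 1) with hcmp
    have hB : MeasurableSet ((fun ω => (T ω, ω)) ⁻¹' Set.Ioi s ×ˢ A ∩ S1) := (hΦ hset).inter hS1m
    have hNs : Measurable (D.N i (min s τ)) :=
      (hC.N_adapted i _ (min_le_right _ _)).mono (ℱ.le _) le_rfl
    have hNb : ∀ t ≤ τ, ∀ ω, ‖(D.N i t ω : ℝ)‖ ≤ 1 := fun t ht ω => by
      rw [Real.norm_of_nonneg (Nat.cast_nonneg _)]
      exact_mod_cast (hC.N_le ht).trans (hC.N_le_one i ω)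
    have hNi : ∀ t ≤ τ, Integrable (fun ω => (D.N i t ω : ℝ)) μ := fun t ht =>
      Integrable.of_bound ((measurable_of_countable (fun k : ℕ => (k : ℝ))).comp
        ((hC.N_adapted i t ht).mono (ℱ.le _) le_rfl)).aestronglyMeasurable 1
        (Eventually.of_forall (hNb t ht))
    have hs : min s τ ≤ τ := min_le_right _ _
    have e1 : μ.real ((fun ω => (T ω, ω)) ⁻¹' Set.Ioi s ×ˢ A ∩ S1) =
        ∫ ω in A, ((D.N i τ ω : ℝ) - D.N i (min s τ) ω) ∂μ := by
      rw [← integral_indicator_one hB, ← integral_indicator hAm]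
      congr 1
      ext ω
      by_cases hω : ω ∈ A
      swap
      · simp [hω]
      rw [Set.indicator_of_mem hω, hC.N_eq_ite hs]
      rcases hC.N_eq_zero_or_one i ω with h | h
      · simp [hS1, h]
      · by_cases hts : T ω ≤ min s τ
        · have : ¬ s < T ω := not_lt.2 (hts.trans (min_le_left _ _))
          rw [if_pos hts]
          simp [this]
        · have : s < T ω := by
            by_contra hc
            exact hts (le_min (not_lt.1 hc) (D.jumpTime_le τ i ω))
          rw [if_neg hts]
          simp [this, hω, hS1, h]
    have e2 : ∫ q in (fun q : Ω × ℝ => (q.2.toNNReal, q.1)) ⁻¹' Set.Ioi s ×ˢ A, a q ∂P =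
        ∫ ω in A, (cmp τ ω - cmp (min s τ) ω) ∂μ := by
      rw [← integral_indicator (hΨ hset), integral_prod _ (hai.indicator (hΨ hset)),
        ← integral_indicator hAm]
      refine integral_congr_ae ?_
      filter_upwards [hai.prod_right_ae] with ω hω
      by_cases hωA : ω ∈ A
      swap
      · rw [Set.indicator_of_notMem hωA]
        refine integral_eq_zero_of_ae (Eventually.of_forall fun u => ?_)
        exact Set.indicator_of_notMem (fun h => hωA h.2) _
      · rw [Set.indicator_of_mem hωA, hcmp]
        simp only [SurvivalData.compensator, timeIntegral_eq, one_mul]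
        have hsub : Set.Ioc (0 : ℝ) (min s τ : ℝ≥0) ⊆ Set.Ioc (0 : ℝ) τ :=
          Set.Ioc_subset_Ioc_right (by exact_mod_cast hs)
        have hω' : IntegrableOn (fun u : ℝ => D.risk i u.toNNReal β₀ ω * haz u.toNNReal)
          (Set.Ioc (0 : ℝ) τ) := hω
        rw [← setIntegral_sdiff measurableSet_Ioc hω' hsub]
        have hd : Set.Ioc (0 : ℝ) τ \ Set.Ioc (0 : ℝ) (min s τ : ℝ≥0) ⊆ Set.Ioc (0 : ℝ) τ :=
          Set.sdiff_subset
        rw [← Set.inter_eq_self_of_subset_left hd, ← Measure.restrict_restrict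
          (measurableSet_Ioc.diff measurableSet_Ioc), ← integral_indicator
          (measurableSet_Ioc.diff measurableSet_Ioc)]
        refine integral_congr_ae ?_
        filter_upwards [ae_restrict_mem measurableSet_Ioc] with u hu
        have hiff : (s < u.toNNReal) ↔ u ∈ Set.Ioc (0 : ℝ) τ \ Set.Ioc (0 : ℝ) (min s τ : ℝ≥0) := by
          rw [Real.lt_toNNReal_iff_coe_lt]
          constructor
          · intro h
            refine ⟨hu, fun h' => ?_⟩
            exact absurd (h'.2.trans (by exact_mod_cast min_le_left s τ)) (not_le.2 h)
          · rintro ⟨-, h⟩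
            by_contra hc
            refine h ⟨hu.1, ?_⟩
            rw [NNReal.coe_min]
            exact le_min (not_lt.1 hc) hu.2
        by_cases hsu : s < u.toNNReal
        · rw [Set.indicator_of_mem (hiff.1 hsu), Set.indicator_of_mem]
          exact ⟨hsu, hωA⟩
        · rw [Set.indicator_of_notMem (fun h => hsu (hiff.2 h)), Set.indicator_of_notMem]
          exact fun h => hsu h.1
    -- The compensator is the bounded count minus the martingale, which supplies its integrability.
    have hci : ∀ t ≤ τ, Integrable (fun ω => cmp t ω) μ := by
      intro t ht
      have hM := (hC.martingale i).integrable t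
      simp only [min_eq_left ht] at hM
      have := (hNi t ht).sub hM
      refine this.congr (Eventually.of_forall fun ω => ?_)
      simp only [Pi.sub_apply, sub_sub_cancel, hcmp, SurvivalData.compensator, SurvivalData.risk,
        one_mul]
      congr 1
      ext u
      ring
    rw [e1, e2]
    have i1 : Integrable (fun ω => (D.N i τ ω : ℝ) - D.N i (min s τ) ω) μ :=
      (hNi _ le_rfl).sub (hNi _ hs)
    have i2 : Integrable (fun ω => cmp τ ω - cmp (min s τ) ω) μ := (hci _ le_rfl).sub (hci _ hs)
    rw [← sub_eq_zero, ← integral_sub i1.integrableOn i2.integrableOn, ← hinc]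
    congr 1
    ext ω
    ring

end IsCoxModel
end Compensator

/-! ### Covariation of one-jump paths with continuous compensators -/

section Paths

/-- The `k`-th point of the partition of `[0, τ]` into `m + 1` intervals of equal length. -/
def gridPoint (τ : ℝ≥0) (m k : ℕ) : ℝ≥0 := τ * k / (m + 1 : ℕ)

lemma gridPoint_zero (τ : ℝ≥0) (m : ℕ) : gridPoint τ m 0 = 0 := by simp [gridPoint]

lemma gridPoint_last (τ : ℝ≥0) (m : ℕ) : gridPoint τ m (m + 1) = τ := by
  unfold gridPoint
  have : ((m + 1 : ℕ) : ℝ≥0) ≠ 0 := Nat.cast_ne_zero.2 (Nat.succ_ne_zero m)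
  field_simp

lemma gridPoint_mono (τ : ℝ≥0) (m : ℕ) : Monotone (gridPoint τ m) := fun a b h => by
  unfold gridPoint
  gcongr

lemma gridPoint_le (τ : ℝ≥0) {m k : ℕ} (h : k ≤ m + 1) : gridPoint τ m k ≤ τ :=
  (gridPoint_mono τ m h).trans (gridPoint_last τ m).le

lemma gridPoint_succ_sub (τ : ℝ≥0) (m k : ℕ) :
    (gridPoint τ m (k + 1) : ℝ) - gridPoint τ m k = τ / (m + 1 : ℕ) := by
  unfold gridPoint
  push_cast
  field_simp
  ring

/-- It bounds discrete covariations by a product of total variations, uniformly in the partition,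
which serves as dominating function. -/
lemma abs_sum_mul_le {ι : Type*} (s : Finset ι) (a b : ι → ℝ) :
    |∑ k ∈ s, a k * b k| ≤ (∑ k ∈ s, |a k|) * ∑ k ∈ s, |b k| := by
  refine (Finset.abs_sum_le_sum_abs _ _).trans ?_
  simp only [abs_mul]
  rw [Finset.sum_mul]
  refine Finset.sum_le_sum fun k hk => mul_le_mul_of_nonneg_left ?_ (abs_nonneg _)
  exact Finset.single_le_sum (f := fun k => |b k|) (fun i _ => abs_nonneg _) hk

/-- A path with one jump of size `x` at `T`. -/
def jumpPath (T : ℝ≥0) (x : ℝ) (t : ℝ≥0) : ℝ := if T ≤ t then x else 0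

/-- The absolute increments are increments of a monotone path, so their sum over a partition
telescopes. -/
lemma abs_jumpPath_sub {T : ℝ≥0} {x : ℝ} {u v : ℝ≥0} (h : u ≤ v) :
    |jumpPath T x v - jumpPath T x u| = jumpPath T |x| v - jumpPath T |x| u := by
  unfold jumpPath
  split_ifs with h1 h2 h2
  · simp
  · simp
  · exact absurd (h2.trans h) h1
  · simp

variable {τ : ℝ≥0} {c : ℝ} {L A A₁ A₂ : ℝ≥0 → ℝ} {T T₁ T₂ : ℝ≥0} {x x₁ x₂ : ℝ}

lemma sum_abs_jumpPath_le (τ : ℝ≥0) (m : ℕ) (T : ℝ≥0) (x : ℝ) :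
    ∑ k ∈ Finset.range (m + 1), |jumpPath T x (gridPoint τ m (k + 1)) -
      jumpPath T x (gridPoint τ m k)| ≤ |x| := by
  simp only [abs_jumpPath_sub (gridPoint_mono τ m (Nat.le_succ _))]
  rw [Finset.sum_range_sub (fun k => jumpPath T |x| (gridPoint τ m k))]
  unfold jumpPath
  split_ifs <;> simp

lemma sum_abs_compensator_le (hA : ∀ u v, u ≤ v → v ≤ τ → |A v - A u| ≤ c * (L v - L u)) (m : ℕ) :
    ∑ k ∈ Finset.range (m + 1), |A (gridPoint τ m (k + 1)) - A (gridPoint τ m k)| ≤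
      c * (L τ - L 0) := by
  calc _ ≤ ∑ k ∈ Finset.range (m + 1), c * (L (gridPoint τ m (k + 1)) - L (gridPoint τ m k)) :=
        Finset.sum_le_sum fun k hk => hA _ _ (gridPoint_mono τ m (Nat.le_succ _))
          (gridPoint_le τ (Finset.mem_range.1 hk))
    _ = _ := by
      rw [← Finset.mul_sum, Finset.sum_range_sub (fun k => L (gridPoint τ m k)), gridPoint_zero,
        gridPoint_last]

lemma sum_abs_path_le (hA : ∀ u v, u ≤ v → v ≤ τ → |A v - A u| ≤ c * (L v - L u)) (m : ℕ) :
    ∑ k ∈ Finset.range (m + 1), |(jumpPath T x (gridPoint τ m (k + 1)) - A (gridPoint τ m (k + 1))) -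
      (jumpPath T x (gridPoint τ m k) - A (gridPoint τ m k))| ≤ |x| + c * (L τ - L 0) := by
  refine le_trans ?_ (add_le_add (sum_abs_jumpPath_le τ m T x) (sum_abs_compensator_le hA m))
  rw [← Finset.sum_add_distrib]
  refine Finset.sum_le_sum fun k _ => ?_
  rw [sub_sub_sub_comm]
  exact abs_sub _ _

/-- The quadratic covariation of two paths of bounded variation without common jumps vanishes. -/
lemma tendsto_sum_increments_mul (hne : x₁ ≠ 0 → x₂ ≠ 0 → T₁ ≠ T₂) (hc : 0 ≤ c)
    (hL : ContinuousOn L (Set.Icc 0 τ))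
    (hA₁ : ∀ u v, u ≤ v → v ≤ τ → |A₁ v - A₁ u| ≤ c * (L v - L u))
    (hA₂ : ∀ u v, u ≤ v → v ≤ τ → |A₂ v - A₂ u| ≤ c * (L v - L u)) :
    Tendsto (fun m => ∑ k ∈ Finset.range (m + 1),
      ((jumpPath T₁ x₁ (gridPoint τ m (k + 1)) - A₁ (gridPoint τ m (k + 1))) -
        (jumpPath T₁ x₁ (gridPoint τ m k) - A₁ (gridPoint τ m k))) *
      ((jumpPath T₂ x₂ (gridPoint τ m (k + 1)) - A₂ (gridPoint τ m (k + 1))) -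
        (jumpPath T₂ x₂ (gridPoint τ m k) - A₂ (gridPoint τ m k)))) atTop (𝓝 0) := by
  have hmesh : Tendsto (fun m : ℕ => (τ : ℝ) / (m + 1 : ℕ)) atTop (𝓝 0) :=
    (tendsto_const_div_atTop_nhds_zero_nat (τ : ℝ)).comp (tendsto_add_atTop_nat 1)
  -- Once the mesh is smaller than the distance between the jumps, no interval of the partition
  -- contains both.
  have hjump : ∀ᶠ m : ℕ in atTop, ∀ k,
      (jumpPath T₁ x₁ (gridPoint τ m (k + 1)) - jumpPath T₁ x₁ (gridPoint τ m k)) *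
      (jumpPath T₂ x₂ (gridPoint τ m (k + 1)) - jumpPath T₂ x₂ (gridPoint τ m k)) = 0 := by
    by_cases h1 : x₁ = 0
    · exact Eventually.of_forall fun m k => by simp [jumpPath, h1]
    by_cases h2 : x₂ = 0
    · exact Eventually.of_forall fun m k => by simp [jumpPath, h2]
    have hd : 0 < |(T₁ : ℝ) - T₂| := abs_pos.2 (sub_ne_zero.2 (by exact_mod_cast hne h1 h2))
    filter_upwards [(tendsto_order.1 hmesh).2 _ hd] with m hm k
    by_contra hcon
    have hg := gridPoint_succ_sub τ m k
    have hmem : ∀ {T : ℝ≥0} {x : ℝ}, jumpPath T x (gridPoint τ m (k + 1)) -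
        jumpPath T x (gridPoint τ m k) ≠ 0 →
        (gridPoint τ m k : ℝ) < T ∧ (T : ℝ) ≤ gridPoint τ m (k + 1) := by
      intro T x h
      unfold jumpPath at h
      split_ifs at h with h3 h4 h4
      · simp at h
      · exact ⟨by exact_mod_cast not_le.1 h4, by exact_mod_cast h3⟩
      · exact absurd (h4.trans (gridPoint_mono τ m (Nat.le_succ k))) h3
      · simp at h
    have m1 := hmem (left_ne_zero_of_mul hcon)
    have m2 := hmem (right_ne_zero_of_mul hcon)
    have : |(T₁ : ℝ) - T₂| ≤ τ / (m + 1 : ℕ) := by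
      rw [abs_le]
      constructor <;> linarith [m1.1, m1.2, m2.1, m2.2]
    linarith
  rw [Metric.tendsto_nhds]
  intro ε hε
  set V := |x₁| + |x₂| + c * (L τ - L 0) + 1 with hV
  have hA0 : 0 ≤ c * (L τ - L 0) := (abs_nonneg _).trans (hA₁ 0 τ zero_le le_rfl)
  have hV0 : 0 < V := by positivity
  -- `V` exceeds the sum of all total variations involved, so a factor `η` in each term gives a
  -- total below `ε`.
  set η := ε / V with hη
  have hη0 : 0 < η := by positivity
  have hunif := isCompact_Icc.uniformContinuousOn_of_continuous hL
  rw [Metric.uniformContinuousOn_iff] at hunif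
  obtain ⟨ρ, hρ, hρ'⟩ := hunif (η / (c + 1)) (by positivity)
  filter_upwards [hjump, (tendsto_order.1 hmesh).2 ρ hρ] with m hm1 hm2
  have hinc : ∀ A : ℝ≥0 → ℝ, (∀ u v, u ≤ v → v ≤ τ → |A v - A u| ≤ c * (L v - L u)) →
      ∀ k ∈ Finset.range (m + 1), |A (gridPoint τ m (k + 1)) - A (gridPoint τ m k)| ≤ η := by
    intro A hA k hk
    have hk' : k + 1 ≤ m + 1 := Finset.mem_range.1 hk
    have h1 := hρ' (gridPoint τ m (k + 1)) ⟨zero_le, gridPoint_le τ hk'⟩ (gridPoint τ m k)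
      ⟨zero_le, gridPoint_le τ (by omega)⟩ (by
        rw [NNReal.dist_eq, gridPoint_succ_sub, abs_of_nonneg (by positivity)]
        exact hm2)
    rw [Real.dist_eq] at h1
    refine (hA _ _ (gridPoint_mono τ m (Nat.le_succ _)) (gridPoint_le τ hk')).trans ?_
    calc c * (L (gridPoint τ m (k + 1)) - L (gridPoint τ m k))
        ≤ (c + 1) * |L (gridPoint τ m (k + 1)) - L (gridPoint τ m k)| :=
          (mul_le_mul_of_nonneg_left (le_abs_self _) hc).trans
            (mul_le_mul_of_nonneg_right (by linarith) (abs_nonneg _))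
      _ ≤ (c + 1) * (η / (c + 1)) := mul_le_mul_of_nonneg_left h1.le (by positivity)
      _ = η := by field_simp
  rw [dist_zero_right, Real.norm_eq_abs]
  -- The product of the jump increments vanishes. Every other term in the expansion contains an
  -- increment of a compensator, which is at most `η` by uniform continuity.
  have hterm : ∀ a₁ a₂ b₁ b₂ : ℝ, a₁ * a₂ = 0 → |b₁| ≤ η → |b₂| ≤ η →
      |(a₁ - b₁) * (a₂ - b₂)| ≤ η * (|a₁| + |a₂| + |b₂|) := by
    intro a₁ a₂ b₁ b₂ h0 hb₁ hb₂
    rw [show (a₁ - b₁) * (a₂ - b₂) = a₁ * a₂ - (a₁ * b₂ + b₁ * (a₂ - b₂)) by ring, h0, zero_sub,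
      abs_neg]
    refine (abs_add_le _ _).trans ?_
    rw [abs_mul, abs_mul]
    have e1 : |a₁| * |b₂| ≤ |a₁| * η := mul_le_mul_of_nonneg_left hb₂ (abs_nonneg _)
    have e2 : |b₁| * |a₂ - b₂| ≤ η * (|a₂| + |b₂|) :=
      mul_le_mul hb₁ (abs_sub _ _) (abs_nonneg _) hη0.le
    linarith
  calc _ ≤ ∑ k ∈ Finset.range (m + 1), η *
        (|jumpPath T₁ x₁ (gridPoint τ m (k + 1)) - jumpPath T₁ x₁ (gridPoint τ m k)| +
        |jumpPath T₂ x₂ (gridPoint τ m (k + 1)) - jumpPath T₂ x₂ (gridPoint τ m k)| +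
        |A₂ (gridPoint τ m (k + 1)) - A₂ (gridPoint τ m k)|) := by
        refine (Finset.abs_sum_le_sum_abs _ _).trans (Finset.sum_le_sum fun k hk => ?_)
        rw [sub_sub_sub_comm, sub_sub_sub_comm (jumpPath T₂ x₂ _)]
        exact hterm _ _ _ _ (hm1 k) (hinc A₁ hA₁ k hk) (hinc A₂ hA₂ k hk)
    _ ≤ η * (|x₁| + |x₂| + c * (L τ - L 0)) := by
        rw [← Finset.mul_sum, Finset.sum_add_distrib, Finset.sum_add_distrib]
        refine mul_le_mul_of_nonneg_left (add_le_add (add_le_add ?_ ?_) ?_) hη0.le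
        · exact sum_abs_jumpPath_le τ m T₁ x₁
        · exact sum_abs_jumpPath_le τ m T₂ x₂
        · exact sum_abs_compensator_le hA₂ m
    _ < η * V := mul_lt_mul_of_pos_left (by linarith) hη0
    _ = ε := by rw [hη]; field_simp

end Paths

/-! ### Compensated integrals as martingales -/

section MartingaleIntegral

variable {Ω : Type*} [mΩ : MeasurableSpace Ω] {μ : Measure Ω} {n p : ℕ}
    {D : SurvivalData Ω n p} {ℱ : Filtration ℝ≥0 mΩ} {τ : ℝ≥0} {haz : ℝ≥0 → ℝ} {β₀ : Vec p}
    {F : Set (Vec p)} {C K : ℝ} {H : ℝ≥0 → Ω → ℝ} {i : Fin n}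

/-- `∫₀ᵗ H dN_i - ∫₀ᵗ H dΛ_i`. -/
def SurvivalData.martingaleIntegral (D : SurvivalData Ω n p) (haz : ℝ≥0 → ℝ) (β₀ : Vec p)
    (τ : ℝ≥0) (i : Fin n) (H : ℝ≥0 → Ω → ℝ) (t : ℝ≥0) (ω : Ω) : ℝ :=
  jumpPath (D.jumpTime τ i ω) ((D.N i τ ω : ℝ) * H (D.jumpTime τ i ω) ω) t -
    D.compensator haz β₀ i H t ω

lemma continuousOn_timeIntegral
    (hzi : IntervalIntegrable (fun s : ℝ => haz s.toNNReal) volume 0 τ) :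
    ContinuousOn (fun t => timeIntegral t haz) (Set.Icc 0 τ) := by
  have h := intervalIntegral.continuousOn_primitive_interval' hzi Set.left_mem_uIcc
  refine h.comp NNReal.continuous_coe.continuousOn fun t ht => ?_
  rw [Set.uIcc_of_le (NNReal.coe_nonneg τ)]
  exact ⟨t.2, by exact_mod_cast ht.2⟩

lemma measurable_setIntegral {m : MeasurableSpace Ω} {g : Ω → ℝ → ℝ}
    (hg : @Measurable (Ω × ℝ) ℝ (m.prod inferInstance) _ fun q => g q.1 q.2) (S : Set ℝ) :
    Measurable[m] fun ω => ∫ u in S, g ω u :=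
  (hg.stronglyMeasurable.integral_prod_right' (ν := volume.restrict S)).measurable

namespace IsCoxModel

lemma integrableOn_intensity (hC : IsCoxModel μ D ℱ τ haz β₀ F) (hF : ∀ x ∈ F, ‖x‖ ≤ C)
    (hzi : IntervalIntegrable (fun s : ℝ => haz s.toNNReal) volume 0 τ)
    (hH : Measurable (Function.uncurry H)) (hK : ∀ t ≤ τ, ∀ ω, |H t ω| ≤ K) (ω : Ω) :
    IntegrableOn (fun u : ℝ => H u.toNNReal ω * (D.risk i u.toNNReal β₀ ω * haz u.toNNReal))
      (Set.Ioc (0 : ℝ) τ) := by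
  have hmap : Measurable fun u : ℝ => (u.toNNReal, ω) :=
    measurable_real_toNNReal.prodMk measurable_const
  have h1 : Measurable fun u : ℝ => H u.toNNReal ω := hH.comp hmap
  have h2 : Measurable fun u : ℝ => D.risk i u.toNNReal β₀ ω :=
    (IsStronglyPredictable_measurable (hC.risk_predictable i)).comp hmap
  have hi := (intervalIntegrable_iff_integrableOn_Ioc_of_le τ.2).1 hzi
  have := hi.bdd_mul (c := K * Real.exp (C * ‖β₀‖)) (f := fun u : ℝ =>
    H u.toNNReal ω * D.risk i u.toNNReal β₀ ω) (h1.mul h2).aestronglyMeasurable ?_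
  · refine this.congr (Eventually.of_forall fun q => ?_)
    exact mul_assoc _ _ _
  · filter_upwards [ae_restrict_mem measurableSet_Ioc] with u hu
    have ht := toNNReal_le_of_mem_Ioc hu
    rw [Real.norm_eq_abs, abs_mul, abs_of_nonneg (hC.risk_nonneg i ht _ _)]
    exact mul_le_mul (hK _ ht _) (hC.risk_le hF i ht _ _) (hC.risk_nonneg i ht _ _)
      ((abs_nonneg _).trans (hK _ ht ω))

lemma compensator_sub (hC : IsCoxModel μ D ℱ τ haz β₀ F) (hF : ∀ x ∈ F, ‖x‖ ≤ C)
    (hzi : IntervalIntegrable (fun s : ℝ => haz s.toNNReal) volume 0 τ)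
    (hH : Measurable (Function.uncurry H)) (hK : ∀ t ≤ τ, ∀ ω, |H t ω| ≤ K) (ω : Ω) {u v : ℝ≥0}
    (huv : u ≤ v) (hv : v ≤ τ) :
    D.compensator haz β₀ i H v ω - D.compensator haz β₀ i H u ω =
      ∫ s in Set.Ioc (u : ℝ) v, H s.toNNReal ω * (D.risk i s.toNNReal β₀ ω * haz s.toNNReal) := by
  have h := hC.integrableOn_intensity (i := i) hF hzi hH hK ω
  have h1 : ∀ t ≤ τ, IntervalIntegrable (fun u : ℝ => H u.toNNReal ω *
      (D.risk i u.toNNReal β₀ ω * haz u.toNNReal)) volume 0 t := fun t ht =>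
    (intervalIntegrable_iff_integrableOn_Ioc_of_le t.2).2
      (h.mono_set (Set.Ioc_subset_Ioc_right (by exact_mod_cast ht)))
  unfold SurvivalData.compensator timeIntegral
  rw [intervalIntegral.integral_interval_sub_left (h1 v hv) (h1 u (huv.trans hv)),
    intervalIntegral.integral_of_le (by exact_mod_cast huv)]

/-- Risks and integrands are bounded, so increments are dominated by those of the deterministic
cumulative hazard. This gives continuity and bounded variation uniformly over all outcomes. -/
lemma abs_compensator_sub_le (hC : IsCoxModel μ D ℱ τ haz β₀ F) (hF : ∀ x ∈ F, ‖x‖ ≤ C)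
    (hz0 : ∀ t, 0 ≤ haz t)
    (hzi : IntervalIntegrable (fun s : ℝ => haz s.toNNReal) volume 0 τ)
    (hH : Measurable (Function.uncurry H)) (hK : ∀ t ≤ τ, ∀ ω, |H t ω| ≤ K) (ω : Ω) {u v : ℝ≥0}
    (huv : u ≤ v) (hv : v ≤ τ) :
    |D.compensator haz β₀ i H v ω - D.compensator haz β₀ i H u ω| ≤
      K * Real.exp (C * ‖β₀‖) * (timeIntegral v haz - timeIntegral u haz) := by
  have hi := (intervalIntegrable_iff_integrableOn_Ioc_of_le τ.2).1 hzi
  have h1 : ∀ t ≤ τ, IntervalIntegrable (fun u : ℝ => haz u.toNNReal) volume 0 t := fun t ht =>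
    (intervalIntegrable_iff_integrableOn_Ioc_of_le t.2).2
      (hi.mono_set (Set.Ioc_subset_Ioc_right (by exact_mod_cast ht)))
  have hsub : Set.Ioc (u : ℝ) v ⊆ Set.Ioc (0 : ℝ) τ :=
    Set.Ioc_subset_Ioc u.2 (by exact_mod_cast hv)
  rw [hC.compensator_sub hF hzi hH hK ω huv hv]
  unfold timeIntegral
  rw [intervalIntegral.integral_interval_sub_left (h1 v hv) (h1 u (huv.trans hv)),
    intervalIntegral.integral_of_le (by exact_mod_cast huv), ← integral_const_mul]
  refine abs_integral_le_integral_abs.trans (setIntegral_mono_on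
    ((hC.integrableOn_intensity hF hzi hH hK ω).mono_set hsub).abs
    ((hi.mono_set hsub).const_mul _) measurableSet_Ioc fun s hs => ?_)
  have ht := toNNReal_le_of_mem_Ioc (hsub hs)
  rw [← mul_assoc, abs_mul, abs_of_nonneg (hz0 _), abs_mul,
    abs_of_nonneg (hC.risk_nonneg i ht _ _)]
  refine mul_le_mul_of_nonneg_right ?_ (hz0 _)
  exact mul_le_mul (hK _ ht _) (hC.risk_le hF i ht _ _) (hC.risk_nonneg i ht _ _)
    ((abs_nonneg _).trans (hK _ ht ω))

lemma compensator_zero (ω : Ω) : D.compensator haz β₀ i H 0 ω = 0 := by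
  simp [SurvivalData.compensator, timeIntegral]

lemma martingaleIntegral_zero (hC : IsCoxModel μ D ℱ τ haz β₀ F) (ω : Ω) :
    D.martingaleIntegral haz β₀ τ i H 0 ω = 0 := by
  unfold SurvivalData.martingaleIntegral jumpPath
  rw [compensator_zero]
  rcases hC.N_eq_zero_or_one i ω with h | h
  · simp [h]
  · rw [if_neg (not_le.2 (hC.jumpTime_pos h))]
    simp

lemma abs_N_mul_le (hC : IsCoxModel μ D ℱ τ haz β₀ F) (hK : ∀ t ≤ τ, ∀ ω, |H t ω| ≤ K) (ω : Ω) :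
    |(D.N i τ ω : ℝ) * H (D.jumpTime τ i ω) ω| ≤ K := by
  have h1 := hK _ (D.jumpTime_le τ i ω) ω
  rcases hC.N_eq_zero_or_one i ω with h | h
  · simpa [h] using (abs_nonneg _).trans h1
  · simpa [h] using h1

lemma abs_martingaleIntegral_le (hC : IsCoxModel μ D ℱ τ haz β₀ F) (hF : ∀ x ∈ F, ‖x‖ ≤ C)
    (hz0 : ∀ t, 0 ≤ haz t)
    (hzi : IntervalIntegrable (fun s : ℝ => haz s.toNNReal) volume 0 τ)
    (hH : Measurable (Function.uncurry H)) (hK0 : 0 ≤ K) (hK : ∀ t ≤ τ, ∀ ω, |H t ω| ≤ K) (ω : Ω)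
    {t : ℝ≥0} (ht : t ≤ τ) :
    |D.martingaleIntegral haz β₀ τ i H t ω| ≤
      K + K * Real.exp (C * ‖β₀‖) * timeIntegral τ haz := by
  unfold SurvivalData.martingaleIntegral
  refine (abs_sub _ _).trans (add_le_add ?_ ?_)
  · refine le_trans ?_ (hC.abs_N_mul_le (i := i) hK ω)
    unfold jumpPath
    split_ifs
    · exact le_rfl
    · rw [abs_zero]
      exact abs_nonneg _
  · have h1 := hC.abs_compensator_sub_le (i := i) hF hz0 hzi hH hK ω zero_le ht
    have h2 : timeIntegral t haz ≤ timeIntegral τ haz := by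
      rw [timeIntegral_eq, timeIntegral_eq]
      refine setIntegral_mono_set ((intervalIntegrable_iff_integrableOn_Ioc_of_le τ.2).1 hzi)
        (Eventually.of_forall fun u => hz0 _) (LE.le.eventuallyLE ?_)
      exact Set.Ioc_subset_Ioc_right (by exact_mod_cast ht)
    have h3 : timeIntegral 0 haz = 0 := by simp [timeIntegral]
    rw [compensator_zero, sub_zero, h3, sub_zero] at h1
    exact h1.trans (mul_le_mul_of_nonneg_left h2 (by positivity))

/-- Truncating the time argument at `u` leaves the integral up to `u` unchanged and makes
progressive measurability applicable. -/
lemma measurable_compensator (hC : IsCoxModel μ D ℱ τ haz β₀ F) (hz : Measurable haz)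
    (hH : IsStronglyPredictable ℱ H) (u : ℝ≥0) :
    Measurable[ℱ u] (D.compensator haz β₀ i H u) := by
  have hprog : ∀ {Z : ℝ≥0 → Ω → ℝ}, IsStronglyPredictable ℱ Z →
      @Measurable (Ω × ℝ) ℝ ((ℱ u).prod inferInstance) _
        fun q => Z (min q.2.toNNReal u) q.1 := by
    intro Z hZ
    have h1 : Measurable[Subtype.instMeasurableSpace.prod (ℱ u)]
        fun q : Set.Iic u × Ω => Z q.1 q.2 :=
      StronglyMeasurable.measurable (hZ.isStronglyProgressive u)
    have h2 : @Measurable (Ω × ℝ) (Set.Iic u × Ω) ((ℱ u).prod inferInstance)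
        (Subtype.instMeasurableSpace.prod (ℱ u))
        fun q => (⟨min q.2.toNNReal u, Set.mem_Iic.2 (min_le_right _ _)⟩, q.1) := by
      refine Measurable.prodMk (Measurable.subtype_mk ?_) measurable_fst
      exact (measurable_real_toNNReal.comp measurable_snd).min measurable_const
    exact h1.comp h2
  have hhaz : @Measurable (Ω × ℝ) ℝ ((ℱ u).prod inferInstance) _
      fun q => haz (min q.2.toNNReal u) := by
    refine hz.comp ?_
    exact (measurable_real_toNNReal.comp measurable_snd).min measurable_const
  have hprod := (hprog hH).mul ((hprog (hC.risk_predictable i)).mul hhaz)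
  have h := measurable_setIntegral (g := fun ω s => H (min s.toNNReal u) ω *
    (D.risk i (min s.toNNReal u) β₀ ω * haz (min s.toNNReal u))) hprod (Set.Ioc (0 : ℝ) u)
  convert h using 1
  ext ω
  unfold SurvivalData.compensator
  rw [timeIntegral_eq]
  refine setIntegral_congr_fun measurableSet_Ioc fun s hs => ?_
  simp only [min_eq_left (toNNReal_le_of_mem_Ioc hs)]

/-- If the jump has occurred by `u`, truncating the jump time at `u` changes nothing; if not, the
factor `N i u` is zero. -/
lemma measurable_martingaleIntegral (hC : IsCoxModel μ D ℱ τ haz β₀ F) (hz : Measurable haz)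
    (hH : IsStronglyPredictable ℱ H) {u : ℝ≥0} (hu : u ≤ τ) :
    Measurable[ℱ u] (D.martingaleIntegral haz β₀ τ i H u) := by
  have hN : Measurable[ℱ u] fun ω => (D.N i u ω : ℝ) :=
    (measurable_of_countable (fun k : ℕ => (k : ℝ))).comp (hC.N_adapted i u hu)
  have h1 := (hN.mul (hC.measurable_comp_min_jumpTime i (u := u) hH)).sub
    (hC.measurable_compensator (i := i) hz hH u)
  convert h1 using 1
  ext ω
  simp only [SurvivalData.martingaleIntegral, Pi.sub_apply, Pi.mul_apply, jumpPath]
  rw [hC.N_eq_ite hu]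
  by_cases h : D.jumpTime τ i ω ≤ u
  · simp [h]
  · simp [h]

/-- The martingale property of `∫ H dN_i - ∫ H dΛ_i`. -/
lemma integral_mul_increment_eq_zero [IsProbabilityMeasure μ]
    (hC : IsCoxModel μ D ℱ τ haz β₀ F) (hF : ∀ x ∈ F, ‖x‖ ≤ C)
    (hz : Measurable haz) (hz0 : ∀ t, 0 ≤ haz t)
    (hzi : IntervalIntegrable (fun s : ℝ => haz s.toNNReal) volume 0 τ)
    (hH : IsStronglyPredictable ℱ H) (hK0 : 0 ≤ K) (hK : ∀ t ≤ τ, ∀ ω, |H t ω| ≤ K) {u v : ℝ≥0}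
    (huv : u ≤ v) (hv : v ≤ τ) {ξ : Ω → ℝ} (hξ : Measurable[ℱ u] ξ) {R : ℝ} (hR : ∀ ω, |ξ ω| ≤ R) :
    ∫ ω, ξ ω * (D.martingaleIntegral haz β₀ τ i H v ω -
      D.martingaleIntegral haz β₀ τ i H u ω) ∂μ = 0 := by
  -- Multiplying the integrand by `ξ` on `(u, v]` keeps it predictable, so the claim is the equality
  -- of expectations for `H'`.
  set H' : ℝ≥0 → Ω → ℝ := fun t ω => H t ω * (Set.Ioc u v).indicator (fun _ => ξ ω) t with hH'
  have hp : IsStronglyPredictable ℱ H' :=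
    isStronglyPredictable_mul hH (isStronglyPredictable_indicator_Ioc u v hξ)
  have hK' : ∀ t ≤ τ, ∀ ω, |H' t ω| ≤ K * R := by
    intro t ht ω
    have hR0 : 0 ≤ R := (abs_nonneg _).trans (hR ω)
    rw [hH', abs_mul]
    refine mul_le_mul (hK t ht ω) ?_ (abs_nonneg _) hK0
    by_cases h : t ∈ Set.Ioc u v
    · simpa [h] using hR ω
    · simpa [h] using hR0
  have key := hC.integral_N_mul_eq hF hz hz0 hzi i hp hK'
  have hcomp : ∀ ω, D.compensator haz β₀ i H' τ ω =
      ξ ω * (D.compensator haz β₀ i H v ω - D.compensator haz β₀ i H u ω) := by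
    intro ω
    rw [hC.compensator_sub hF hzi (IsStronglyPredictable_measurable hH) hK ω huv hv]
    unfold SurvivalData.compensator
    rw [timeIntegral_eq, ← integral_const_mul]
    have hsub : Set.Ioc (u : ℝ) v ⊆ Set.Ioc (0 : ℝ) τ :=
      Set.Ioc_subset_Ioc u.2 (by exact_mod_cast hv)
    have hr : (volume.restrict (Set.Ioc (u : ℝ) v)) =
        (volume.restrict (Set.Ioc (0 : ℝ) τ)).restrict (Set.Ioc (u : ℝ) v) := by
      rw [Measure.restrict_restrict measurableSet_Ioc, Set.inter_eq_self_of_subset_left hsub]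
    rw [hr, ← integral_indicator (measurableSet_Ioc (a := (u : ℝ)) (b := v))]
    refine integral_congr_ae (Eventually.of_forall fun s => ?_)
    have hiff : s.toNNReal ∈ Set.Ioc u v ↔ s ∈ Set.Ioc (u : ℝ) v := by
      simp only [Set.mem_Ioc, Real.lt_toNNReal_iff_coe_lt, Real.toNNReal_le_iff_le_coe]
    by_cases hs : s ∈ Set.Ioc (u : ℝ) v
    · rw [Set.indicator_of_mem hs, hH']
      simp only [Set.indicator_of_mem (hiff.2 hs)]
      ring
    · rw [Set.indicator_of_notMem hs, hH']
      simp only [Set.indicator_of_notMem (fun h => hs (hiff.1 h)), mul_zero, zero_mul]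
  have hjump : ∀ ω, (D.N i τ ω : ℝ) * H' (D.jumpTime τ i ω) ω =
      ξ ω * (jumpPath (D.jumpTime τ i ω) ((D.N i τ ω : ℝ) * H (D.jumpTime τ i ω) ω) v -
        jumpPath (D.jumpTime τ i ω) ((D.N i τ ω : ℝ) * H (D.jumpTime τ i ω) ω) u) := by
    intro ω
    simp only [hH', jumpPath, Set.indicator_apply, Set.mem_Ioc]
    by_cases h1 : D.jumpTime τ i ω ≤ u
    · simp [h1, not_lt.2 h1, h1.trans huv]
    · by_cases h2 : D.jumpTime τ i ω ≤ v
      · simp only [not_le.1 h1, h2, h1, and_self, if_true, if_false]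
        ring
      · simp [h1, h2]
  have hξm : Measurable ξ := hξ.mono (ℱ.le _) le_rfl
  have i2 : Integrable (D.compensator haz β₀ i H' τ) μ := by
    refine Integrable.of_bound ((hC.measurable_compensator hz hp τ).mono (ℱ.le _)
      le_rfl).aestronglyMeasurable
      (K * R * Real.exp (C * ‖β₀‖) * (timeIntegral τ haz - timeIntegral 0 haz))
      (Eventually.of_forall fun ω => ?_)
    have := hC.abs_compensator_sub_le (i := i) hF hz0 hzi (IsStronglyPredictable_measurable hp)
      hK' ω zero_le le_rfl
    rwa [compensator_zero, sub_zero] at this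
  have i1 : Integrable (fun ω => (D.N i τ ω : ℝ) * H' (D.jumpTime τ i ω) ω) μ := by
    have hN : Measurable[ℱ τ] fun ω => (D.N i τ ω : ℝ) :=
      (measurable_of_countable (fun k : ℕ => (k : ℝ))).comp (hC.N_adapted i τ le_rfl)
    have hm := hN.mul (hC.measurable_comp_min_jumpTime i (u := τ) hp)
    have e : (fun ω => (D.N i τ ω : ℝ) * H' (D.jumpTime τ i ω) ω) =
        fun ω => (D.N i τ ω : ℝ) * H' (min (D.jumpTime τ i ω) τ) ω := by
      ext ω; rw [min_eq_left (D.jumpTime_le τ i ω)]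
    rw [e]
    refine Integrable.of_bound (Measurable.mono hm (ℱ.le _) le_rfl).aestronglyMeasurable (K * R)
      (Eventually.of_forall fun ω => ?_)
    rw [min_eq_left (D.jumpTime_le τ i ω)]
    exact hC.abs_N_mul_le hK' ω
  rw [← sub_eq_zero, ← integral_sub i1 i2] at key
  rw [← key]
  congr 1
  ext ω
  rw [hcomp, hjump]
  unfold SurvivalData.martingaleIntegral
  ring

end IsCoxModel
end MartingaleIntegral

/-! ### Orthogonality and the law of large numbers -/

section LawOfLargeNumbers

variable {Ω : Type*} [mΩ : MeasurableSpace Ω] {μ : Measure Ω} [IsProbabilityMeasure μ] {p : ℕ}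
    {τ : ℝ≥0} {haz : ℝ≥0 → ℝ} {β₀ : Vec p} {F : Set (Vec p)} {C K : ℝ}

namespace IsCoxModel

variable {n : ℕ} {D : SurvivalData Ω n p} {ℱ : Filtration ℝ≥0 mΩ} 

/-- Martingale integrals for distinct individuals are orthogonal. -/
lemma integral_mul_eq_zero (hC : IsCoxModel μ D ℱ τ haz β₀ F) (hF : ∀ x ∈ F, ‖x‖ ≤ C)
    (hz : Measurable haz) (hz0 : ∀ t, 0 ≤ haz t)
    (hzi : IntervalIntegrable (fun s : ℝ => haz s.toNNReal) volume 0 τ) {i j : Fin n} (hij : i ≠ j)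
    {H₁ H₂ : ℝ≥0 → Ω → ℝ} (hH₁ : IsStronglyPredictable ℱ H₁) (hH₂ : IsStronglyPredictable ℱ H₂)
    (hK0 : 0 ≤ K) (hK₁ : ∀ t ≤ τ, ∀ ω, |H₁ t ω| ≤ K) (hK₂ : ∀ t ≤ τ, ∀ ω, |H₂ t ω| ≤ K) :
    ∫ ω, D.martingaleIntegral haz β₀ τ i H₁ τ ω * D.martingaleIntegral haz β₀ τ j H₂ τ ω ∂μ = 0 := by
  set M₁ := D.martingaleIntegral haz β₀ τ i H₁ with hM₁
  set M₂ := D.martingaleIntegral haz β₀ τ j H₂ with hM₂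
  set R := K + K * Real.exp (C * ‖β₀‖) * timeIntegral τ haz with hR
  have e₁ : ∀ t ω, M₁ t ω = jumpPath (D.jumpTime τ i ω)
    ((D.N i τ ω : ℝ) * H₁ (D.jumpTime τ i ω) ω) t - D.compensator haz β₀ i H₁ t ω :=
      fun _ _ => rfl
  have e₂ : ∀ t ω, M₂ t ω = jumpPath (D.jumpTime τ j ω)
    ((D.N j τ ω : ℝ) * H₂ (D.jumpTime τ j ω) ω) t - D.compensator haz β₀ j H₂ t ω :=
      fun _ _ => rfl
  have b₁ : ∀ t ≤ τ, ∀ ω, |M₁ t ω| ≤ R := fun t ht ω =>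
    hC.abs_martingaleIntegral_le hF hz0 hzi (IsStronglyPredictable_measurable hH₁) hK0 hK₁ ω ht
  have b₂ : ∀ t ≤ τ, ∀ ω, |M₂ t ω| ≤ R := fun t ht ω =>
    hC.abs_martingaleIntegral_le hF hz0 hzi (IsStronglyPredictable_measurable hH₂) hK0 hK₂ ω ht
  have m₁ : ∀ t ≤ τ, Measurable[ℱ t] (M₁ t) := fun t ht =>
    hC.measurable_martingaleIntegral hz hH₁ ht
  have m₂ : ∀ t ≤ τ, Measurable[ℱ t] (M₂ t) := fun t ht =>
    hC.measurable_martingaleIntegral hz hH₂ ht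
  have n₁ : ∀ t ≤ τ, Measurable (M₁ t) := fun t ht => (m₁ t ht).mono (ℱ.le _) le_rfl
  have n₂ : ∀ t ≤ τ, Measurable (M₂ t) := fun t ht => (m₂ t ht).mono (ℱ.le _) le_rfl
  have ib : ∀ {f g : Ω → ℝ}, Measurable f → Measurable g → (∀ ω, |f ω| ≤ R) → (∀ ω, |g ω| ≤ R + R) →
      Integrable (fun ω => f ω * g ω) μ := by
    intro f g hf hg h1 h2
    refine Integrable.of_bound (hf.mul hg).aestronglyMeasurable (R * (R + R))
      (Eventually.of_forall fun ω => ?_)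
    rw [Real.norm_eq_abs, abs_mul]
    exact mul_le_mul (h1 ω) (h2 ω) (abs_nonneg _) ((abs_nonneg _).trans (h1 ω))
  have o₁ : ∀ u v, u ≤ v → v ≤ τ → ∀ ξ : Ω → ℝ, Measurable[ℱ u] ξ → (∀ ω, |ξ ω| ≤ R) →
      ∫ ω, ξ ω * (M₁ v ω - M₁ u ω) ∂μ = 0 := fun u v huv hv ξ h1 h2 =>
    hC.integral_mul_increment_eq_zero hF hz hz0 hzi hH₁ hK0 hK₁ huv hv h1 h2
  have o₂ : ∀ u v, u ≤ v → v ≤ τ → ∀ ξ : Ω → ℝ, Measurable[ℱ u] ξ → (∀ ω, |ξ ω| ≤ R) →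
      ∫ ω, ξ ω * (M₂ v ω - M₂ u ω) ∂μ = 0 := fun u v huv hv ξ h1 h2 =>
    hC.integral_mul_increment_eq_zero hF hz hz0 hzi hH₂ hK0 hK₂ huv hv h1 h2
  have hM0 : ∀ ω, M₁ 0 ω = 0 := fun ω => hC.martingaleIntegral_zero ω
  clear_value M₁ M₂
  have hR0 : ∀ ω : Ω, 0 ≤ R := fun ω => (abs_nonneg _).trans (b₁ 0 zero_le ω)
  set S : ℕ → Ω → ℝ := fun m ω => ∑ k ∈ Finset.range (m + 1),
    (M₁ (gridPoint τ m (k + 1)) ω - M₁ (gridPoint τ m k) ω) *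
      (M₂ (gridPoint τ m (k + 1)) ω - M₂ (gridPoint τ m k) ω) with hS
  have hsub : ∀ {f g : Ω → ℝ}, (∀ ω, |f ω| ≤ R) → (∀ ω, |g ω| ≤ R) → ∀ ω, |f ω - g ω| ≤ R + R :=
    fun h1 h2 ω => (abs_sub _ _).trans (add_le_add (h1 ω) (h2 ω))
  -- Summation by parts: the product of the end values is the discrete covariation plus sums of an
  -- increment times a quantity known at the start of its interval, and the latter have mean zero.
  have hconst : ∀ m, ∫ ω, S m ω ∂μ = ∫ ω, M₁ τ ω * M₂ τ ω ∂μ := by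
    intro m
    have htel : ∀ ω, M₁ τ ω * M₂ τ ω = S m ω +
        ((∑ k ∈ Finset.range (m + 1), M₁ (gridPoint τ m k) ω *
          (M₂ (gridPoint τ m (k + 1)) ω - M₂ (gridPoint τ m k) ω)) +
        ∑ k ∈ Finset.range (m + 1), M₂ (gridPoint τ m k) ω *
          (M₁ (gridPoint τ m (k + 1)) ω - M₁ (gridPoint τ m k) ω)) := by
      intro ω
      have h := Finset.sum_range_sub (fun k => M₁ (gridPoint τ m k) ω * M₂ (gridPoint τ m k) ω)
        (m + 1)
      rw [gridPoint_zero, gridPoint_last, hM0, zero_mul, sub_zero] at h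
      rw [← h, hS, ← Finset.sum_add_distrib, ← Finset.sum_add_distrib]
      exact Finset.sum_congr rfl fun k _ => by ring
    have hle : ∀ k ∈ Finset.range (m + 1), gridPoint τ m k ≤ τ ∧ gridPoint τ m (k + 1) ≤ τ :=
      fun k hk => ⟨gridPoint_le τ (Finset.mem_range.1 hk).le, gridPoint_le τ (Finset.mem_range.1 hk)⟩
    have i0 : Integrable (S m) μ := by
      refine integrable_finsetSum _ fun k hk => ?_
      have hk' := hle k hk
      refine Integrable.of_bound (((n₁ _ hk'.2).sub (n₁ _ hk'.1)).mul
        ((n₂ _ hk'.2).sub (n₂ _ hk'.1))).aestronglyMeasurable ((R + R) * (R + R))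
        (Eventually.of_forall fun ω => ?_)
      rw [Real.norm_eq_abs]
      rw [abs_mul]
      have h1 := hsub (b₁ _ hk'.2) (b₁ _ hk'.1) ω
      exact mul_le_mul h1 (hsub (b₂ _ hk'.2) (b₂ _ hk'.1) ω) (abs_nonneg _)
        ((abs_nonneg _).trans h1)
    have i1 : ∀ k ∈ Finset.range (m + 1), Integrable (fun ω => M₁ (gridPoint τ m k) ω *
        (M₂ (gridPoint τ m (k + 1)) ω - M₂ (gridPoint τ m k) ω)) μ := fun k hk =>
      ib (n₁ _ (hle k hk).1) ((n₂ _ (hle k hk).2).sub (n₂ _ (hle k hk).1)) (b₁ _ (hle k hk).1)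
        (hsub (b₂ _ (hle k hk).2) (b₂ _ (hle k hk).1))
    have i2 : ∀ k ∈ Finset.range (m + 1), Integrable (fun ω => M₂ (gridPoint τ m k) ω *
        (M₁ (gridPoint τ m (k + 1)) ω - M₁ (gridPoint τ m k) ω)) μ := fun k hk =>
      ib (n₂ _ (hle k hk).1) ((n₁ _ (hle k hk).2).sub (n₁ _ (hle k hk).1)) (b₂ _ (hle k hk).1)
        (hsub (b₁ _ (hle k hk).2) (b₁ _ (hle k hk).1))
    have i3 := (integrable_finsetSum _ i1).add (integrable_finsetSum _ i2)
    rw [integral_congr_ae (Eventually.of_forall htel), integral_add i0 (by exact i3),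
      integral_add (integrable_finsetSum _ i1) (integrable_finsetSum _ i2),
      integral_finsetSum _ i1, integral_finsetSum _ i2, Finset.sum_eq_zero, Finset.sum_eq_zero,
      add_zero, add_zero]
    · intro k hk
      exact o₁ _ _ (gridPoint_mono τ m k.le_succ) (hle k hk).2 _ (m₂ _ (hle k hk).1)
        (b₂ _ (hle k hk).1)
    · intro k hk
      exact o₂ _ _ (gridPoint_mono τ m k.le_succ) (hle k hk).2 _ (m₁ _ (hle k hk).1)
        (b₁ _ (hle k hk).1)
  have hcomp₁ := fun ω (u v : ℝ≥0) (huv : u ≤ v) (hv : v ≤ τ) => hC.abs_compensator_sub_le (i := i)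
    hF hz0 hzi (IsStronglyPredictable_measurable hH₁) hK₁ ω huv hv
  have hcomp₂ := fun ω (u v : ℝ≥0) (huv : u ≤ v) (hv : v ≤ τ) => hC.abs_compensator_sub_le (i := j)
    hF hz0 hzi (IsStronglyPredictable_measurable hH₂) hK₂ ω huv hv
  have hL0 : timeIntegral 0 haz = 0 := by simp [timeIntegral]
  -- As the partition is refined, the discrete covariation tends to zero almost surely and stays
  -- bounded by the product of the variations. Its mean is constant, hence zero.
  have hlim : Tendsto (fun m => ∫ ω, S m ω ∂μ) atTop (𝓝 (∫ _, (0 : ℝ) ∂μ)) := by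
    refine tendsto_integral_of_dominated_convergence (fun _ => R * R) (fun m => ?_)
      (integrable_const _) (fun m => Eventually.of_forall fun ω => ?_) ?_
    · refine Measurable.aestronglyMeasurable (Finset.measurable_sum _ fun k hk => ?_)
      have h1 : gridPoint τ m k ≤ τ := gridPoint_le τ (Finset.mem_range.1 hk).le
      have h2 : gridPoint τ m (k + 1) ≤ τ := gridPoint_le τ (Finset.mem_range.1 hk)
      exact ((n₁ _ h2).sub (n₁ _ h1)).mul ((n₂ _ h2).sub (n₂ _ h1))
    · refine (abs_sum_mul_le _ _ _).trans (mul_le_mul ?_ ?_ (Finset.sum_nonneg fun _ _ =>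
        abs_nonneg _) (hR0 ω))
      · simp only [e₁]
        refine (sum_abs_path_le (hcomp₁ ω) m).trans ?_
        rw [hL0, sub_zero]
        exact add_le_add (hC.abs_N_mul_le hK₁ ω) le_rfl
      · simp only [e₂]
        refine (sum_abs_path_le (hcomp₂ ω) m).trans ?_
        rw [hL0, sub_zero]
        exact add_le_add (hC.abs_N_mul_le hK₂ ω) le_rfl
    · filter_upwards [hC.ae_jumpTime_ne hij] with ω hω
      simp only [hS, e₁, e₂]
      refine tendsto_sum_increments_mul (c := K * Real.exp (C * ‖β₀‖))
        (L := fun t => timeIntegral t haz) (A₁ := fun t => D.compensator haz β₀ i H₁ t ω)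
        (A₂ := fun t => D.compensator haz β₀ j H₂ t ω) (fun h1 h2 => ?_)
        (mul_nonneg hK0 (Real.exp_pos _).le) (continuousOn_timeIntegral hzi) (hcomp₁ ω) (hcomp₂ ω)
      refine hω ?_ ?_
      · exact (hC.N_eq_zero_or_one i ω).resolve_left fun h => h1 (by simp [h])
      · exact (hC.N_eq_zero_or_one j ω).resolve_left fun h => h2 (by simp [h])
  simp only [hconst, integral_zero] at hlim
  exact tendsto_nhds_unique tendsto_const_nhds hlim

end IsCoxModel

/-- Averages of uniformly bounded orthogonal random variables tend to zero. -/
lemma tendsto_average_of_orthogonal {M : (n : ℕ) → Fin n → Ω → ℝ} {R : ℝ}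
    (hm : ∀ n i, Measurable (M n i)) (hb : ∀ n i ω, |M n i ω| ≤ R)
    (ho : ∀ n i j, i ≠ j → ∫ ω, M n i ω * M n j ω ∂μ = 0) :
    Tendsto (fun q : ℕ × Ω => (q.1 : ℝ)⁻¹ * ∑ i, M q.1 i q.2) (probFilter μ) (𝓝 0) := by
  have hi : ∀ n i j, Integrable (fun ω => M n i ω * M n j ω) μ := by
    intro n i j
    refine Integrable.of_bound ((hm n i).mul (hm n j)).aestronglyMeasurable (R * R)
      (Eventually.of_forall fun ω => ?_)
    rw [Real.norm_eq_abs, abs_mul]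
    exact mul_le_mul (hb n i ω) (hb n j ω) (abs_nonneg _) ((abs_nonneg _).trans (hb n i ω))
  have hsq : ∀ (n : ℕ) ω, ((n : ℝ)⁻¹ * ∑ i, M n i ω) ^ 2 =
      ((n : ℝ)⁻¹) ^ 2 * ∑ i, ∑ j, M n i ω * M n j ω := by
    intro n ω
    rw [mul_pow, sq (∑ i, M n i ω), Finset.sum_mul_sum]
  refine tendsto_probFilter_of_integral_sq_le (Z := fun n ω => (n : ℝ)⁻¹ * ∑ i, M n i ω)
    (c := fun n : ℕ => (n : ℝ)⁻¹ * R ^ 2) (fun n => ?_) (fun n => ?_) ?_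
  · simp only [hsq]
    exact (integrable_finsetSum _ fun i _ => integrable_finsetSum _ fun j _ => hi n i j).const_mul _
  · simp only [hsq]
    rw [integral_const_mul, integral_finsetSum _ fun i _ => integrable_finsetSum _ fun j _ => hi n i j]
    have h1 : ∀ i : Fin n, ∫ ω, ∑ j, M n i ω * M n j ω ∂μ ≤ R ^ 2 := by
      intro i
      rw [integral_finsetSum _ fun j _ => hi n i j, Finset.sum_eq_single i]
      · refine (integral_mono (hi n i i) (integrable_const (R ^ 2)) fun ω => ?_).trans ?_
        · change M n i ω * M n i ω ≤ R ^ 2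
          rw [← sq, ← sq_abs]
          exact pow_le_pow_left₀ (abs_nonneg _) (hb n i ω) 2
        · simp
      · intro j _ hj
        exact ho n i j hj.symm
      · simp
    rcases Nat.eq_zero_or_pos n with rfl | hn
    · simp
    calc _ ≤ ((n : ℝ)⁻¹) ^ 2 * ∑ i : Fin n, R ^ 2 :=
          mul_le_mul_of_nonneg_left (Finset.sum_le_sum fun i _ => h1 i) (by positivity)
      _ = _ := by
        have : (n : ℝ) ≠ 0 := by positivity
        simp only [Finset.sum_const, Finset.card_univ, Fintype.card_fin, nsmul_eq_mul]
        field_simp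
  · simpa using (tendsto_inv_atTop_nhds_zero_nat (𝕜 := ℝ)).mul_const (R ^ 2)

/-- The law of large numbers for integrals with respect to the counting processes. -/
lemma tendsto_average_integral {D : (n : ℕ) → SurvivalData Ω n p} {ℱ : ℕ → Filtration ℝ≥0 mΩ}
    (hC : ∀ n, IsCoxModel μ (D n) (ℱ n) τ haz β₀ F) (hF : ∀ x ∈ F, ‖x‖ ≤ C)
    (hz : Measurable haz) (hz0 : ∀ t, 0 ≤ haz t)
    (hzi : IntervalIntegrable (fun s : ℝ => haz s.toNNReal) volume 0 τ)
    {H : (n : ℕ) → Fin n → ℝ≥0 → Ω → ℝ} (hH : ∀ n i, IsStronglyPredictable (ℱ n) (H n i))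
    (hK0 : 0 ≤ K) (hK : ∀ n i, ∀ t ≤ τ, ∀ ω, |H n i t ω| ≤ K) :
    Tendsto (fun q : ℕ × Ω => (q.1 : ℝ)⁻¹ * ∑ i, (((D q.1).N i τ q.2 : ℝ) *
      H q.1 i ((D q.1).jumpTime τ i q.2) q.2 - (D q.1).compensator haz β₀ i (H q.1 i) τ q.2))
      (probFilter μ) (𝓝 0) := by
  have e : ∀ n i ω, (D n).martingaleIntegral haz β₀ τ i (H n i) τ ω =
      ((D n).N i τ ω : ℝ) * H n i ((D n).jumpTime τ i ω) ω -
      (D n).compensator haz β₀ i (H n i) τ ω := by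
    intro n i ω
    simp only [SurvivalData.martingaleIntegral, jumpPath]
    rw [if_pos ((D n).jumpTime_le τ i ω)]
  have h := tendsto_average_of_orthogonal (μ := μ)
    (M := fun n i ω => (D n).martingaleIntegral haz β₀ τ i (H n i) τ ω)
    (R := K + K * Real.exp (C * ‖β₀‖) * timeIntegral τ haz)
    (fun n i => ((hC n).measurable_martingaleIntegral hz (hH n i) le_rfl).mono ((ℱ n).le _) le_rfl)
    (fun n i ω => (hC n).abs_martingaleIntegral_le hF hz0 hzi
      (IsStronglyPredictable_measurable (hH n i)) hK0 (hK n i) ω le_rfl)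
    (fun n i j hij => (hC n).integral_mul_eq_zero hF hz hz0 hzi hij (hH n i) (hH n j) hK0
      (hK n i) (hK n j))
  simpa only [e] using h

end LawOfLargeNumbers

/-! ### Gradient estimating functions and their zeros -/

section EstimatingFunction

variable {κ ι : Type*} [Fintype κ] [Fintype ι] {p : ℕ}

lemma inner_eq_sum (x u : Vec p) : inner ℝ x u = ∑ a, u a * x a := by
  simp [PiLp.inner_apply]

lemma abs_coord_le (x : Vec p) (a : Fin p) : |x a| ≤ ‖x‖ := by
  simpa using PiLp.norm_apply_le x a

lemma norm_le_sum_abs (x : Vec p) : ‖x‖ ≤ ∑ a, |x a| := by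
  rw [EuclideanSpace.norm_eq, Real.sqrt_le_left (Finset.sum_nonneg fun _ _ => abs_nonneg _)]
  simp only [Real.norm_eq_abs]
  exact Finset.sum_sq_le_sq_sum_of_nonneg fun _ _ => abs_nonneg _

/-- The mean of `x` with weights `wⱼ exp(xⱼᵀ β)`. -/
def wmean (w : ι → ℝ) (x : ι → Vec p) (β : Vec p) : Vec p :=
  (wsum w x (fun _ => 1) β)⁻¹ • ∑ j, (w j * Real.exp (inner ℝ (x j) β)) • x j

lemma wmean_apply (w : ι → ℝ) (x : ι → Vec p) (β : Vec p) (a : Fin p) :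
    wmean w x β a = wavg w x (fun j => x j a) β := by
  simp [wmean, wavg, wsum, mul_comm]

lemma inner_wmean (w : ι → ℝ) (x : ι → Vec p) (β u : Vec p) :
    inner ℝ (wmean w x β) u = wavg w x (fun j => inner ℝ (x j) u) β := by
  rw [wmean, inner_smul_left, sum_inner]
  simp only [inner_smul_left, conj_trivial, wavg, wsum]
  congr 1
  exact Finset.sum_congr rfl fun j _ => by ring

/-- `∑ᵢ aᵢ (zᵢ - Eᵢ(β))`, where `Eᵢ` is the weighted mean over the `i`-th risk set. -/
def linScore (w : κ → ι → ℝ) (x : κ → ι → Vec p) (z : κ → Vec p) (a : κ → ℝ) (β : Vec p) : Vec p :=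
  ∑ i, a i • (z i - wmean (w i) (x i) β)

variable {w : κ → ι → ℝ} {x : κ → ι → Vec p} {z : κ → Vec p} {a : κ → ℝ} {C : ℝ}

lemma inner_linScore (β u : Vec p) : inner ℝ (linScore w x z a β) u =
    ∑ i, a i * (inner ℝ (z i) u - wavg (w i) (x i) (fun j => inner ℝ (x i j) u) β) := by
  rw [linScore, sum_inner]
  simp only [inner_smul_left, inner_sub_left, inner_wmean, conj_trivial]

/-- The estimating function is a gradient field. -/
lemma exists_potential (hw : ∀ i j, 0 ≤ w i j) (z : κ → Vec p) (a : κ → ℝ) :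
    ∃ f : Vec p → ℝ, ∀ β, HasFDerivAt f (innerSL ℝ (linScore w x z a β)) β := by
  -- The potential is the log partial likelihood, with weight `a i` on the contribution of
  -- individual `i`. No sign of the weights is required.
  refine ⟨fun β => ∑ i, a i * (inner ℝ (z i) β - Real.log (wsum (w i) (x i) (fun _ => 1) β)),
    fun β => ?_⟩
  choose L hL e using fun i => log_wsum_hasFDerivAt (hw i) (x i) β
  have h : HasFDerivAt
      (fun β => ∑ i, a i * (inner ℝ (z i) β - Real.log (wsum (w i) (x i) (fun _ => 1) β)))
      (∑ i, a i • (innerSL ℝ (z i) - L i)) β :=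
    HasFDerivAt.fun_sum fun i _ => (((innerSL ℝ (z i)).hasFDerivAt).sub (hL i)).const_mul (a i)
  convert h using 1
  ext u
  simp [inner_linScore, e]

/-- A gradient field that points inwards on a sphere has a zero inside. -/
lemma exists_zero_of_inner_neg {f : Vec p → ℝ} {S : Vec p → Vec p}
    (hf : ∀ β, HasFDerivAt f (innerSL ℝ (S β)) β) (β₀ : Vec p) {r : ℝ} (hr : 0 < r)
    (h : ∀ β, ‖β - β₀‖ = r → inner ℝ (S β) (β - β₀) < 0) : ∃ β, ‖β - β₀‖ < r ∧ S β = 0 := by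
  have hcont : Continuous f := continuous_iff_continuousAt.2 fun β => (hf β).continuousAt
  -- The zero is a maximiser of the potential on the closed ball, which replaces a degree or
  -- fixed-point argument.
  obtain ⟨b, hb, hmax⟩ := (isCompact_closedBall β₀ r).exists_isMaxOn
    ⟨β₀, Metric.mem_closedBall_self hr.le⟩ hcont.continuousOn
  rw [mem_closedBall_iff_norm] at hb
  rcases hb.lt_or_eq with hlt | heq
  · refine ⟨b, hlt, ?_⟩
    have hloc : IsLocalMax f b := by
      refine hmax.isLocalMax (Metric.closedBall_mem_nhds_of_mem ?_)
      rwa [mem_ball_iff_norm]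
    have h0 := hloc.hasFDerivAt_eq_zero (hf b)
    have : inner ℝ (S b) (S b) = (0 : ℝ) := by
      have := congrArg (fun L => L (S b)) h0
      simpa using this
    exact inner_self_eq_zero.1 this
  · exfalso
    -- At a boundary maximiser the derivative towards the centre would be nonpositive, contrary to
    -- the field pointing inwards there.
    have hcone : β₀ - b ∈ posTangentConeAt (Metric.closedBall β₀ r) b := by
      refine sub_mem_posTangentConeAt_of_segment_subset
        ((convex_closedBall β₀ r).segment_subset ?_ (Metric.mem_closedBall_self hr.le))
      rw [mem_closedBall_iff_norm]
      exact hb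
    have h1 := hmax.localize.hasFDerivWithinAt_nonpos (hf b).hasFDerivWithinAt hcone
    have h2 := h b heq
    rw [← neg_sub, inner_neg_right] at h2
    rw [innerSL_apply_apply] at h1
    linarith

/-- The estimating function points inwards outside a small ball around `β₀`. -/
lemma inner_linScore_le (hw : ∀ i j, 0 ≤ w i j) (hC : 0 ≤ C) (hx : ∀ i j, ‖x i j‖ ≤ C)
    (ha : ∀ i, 0 ≤ a i) (ha1 : ∑ i, a i ≤ 1) {β₀ u : Vec p} (hu : ‖u‖ = 1) {lam δ r s : ℝ}
    (hlam : lam ≤ ∑ i, a i * wcov (w i) (x i) (fun j => inner ℝ (x i j) u)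
      (fun j => inner ℝ (x i j) u) β₀)
    (hδ : inner ℝ (linScore w x z a β₀) u ≤ δ) (hr : 0 ≤ r) (hrl : 6 * C ^ 3 * r ≤ lam / 2)
    (hs : r ≤ s) : inner ℝ (linScore w x z a (β₀ + s • u)) u ≤ δ - r * (lam / 2) := by
  set g : ℝ → ℝ := fun s => inner ℝ (linScore w x z a (β₀ + s • u)) u with hg
  set g' : ℝ → ℝ := fun s => -∑ i, a i * wcov (w i) (x i) (fun j => inner ℝ (x i j) u)
      (fun j => inner ℝ (x i j) u) (β₀ + s • u) with hg'
  have hxu : ∀ i j, |inner ℝ (x i j) u| ≤ C := fun i j => by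
    refine (abs_real_inner_le_norm _ _).trans ?_
    rw [hu, mul_one]
    exact hx i j
  have hderiv : ∀ s, HasDerivAt g (g' s) s := by
    intro s
    have : HasDerivAt (fun s : ℝ => ∑ i, a i * (inner ℝ (z i) u - wavg (w i) (x i)
        (fun j => inner ℝ (x i j) u) (β₀ + s • u))) (∑ i, a i * -wcov (w i) (x i)
        (fun j => inner ℝ (x i j) u) (fun j => inner ℝ (x i j) u) (β₀ + s • u)) s :=
      HasDerivAt.fun_sum fun i _ => ((hasDerivAt_wavg_line (hw i) (x i) _ β₀ u s).const_sub
        (inner ℝ (z i) u)).const_mul (a i)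
    simp only [hg, hg', inner_linScore]
    simpa only [mul_neg, Finset.sum_neg_distrib] using this
  -- Along the ray the derivative is minus a nonnegative combination of variances, so the radial
  -- component never increases.
  have hneg : ∀ s, g' s ≤ 0 := fun s => neg_nonpos.2 (Finset.sum_nonneg fun i _ =>
    mul_nonneg (ha i) (wcov_self_nonneg (hw i)))
  have hanti : Antitone g := antitone_of_hasDerivAt_nonpos hderiv hneg
  -- The variances are Lipschitz with constant `6 * C ^ 3` along unit directions. Within distance
  -- `r` they lose at most `lam / 2`, and half of the initial slope remains.
  have hnear : ∀ t ∈ Set.Icc 0 r, g' t ≤ -(lam / 2) := by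
    intro t ht
    have h1 : ∀ i, a i * wcov (w i) (x i) (fun j => inner ℝ (x i j) u)
        (fun j => inner ℝ (x i j) u) β₀ - a i * (lam / 2) ≤ a i * wcov (w i) (x i)
        (fun j => inner ℝ (x i j) u) (fun j => inner ℝ (x i j) u) (β₀ + t • u) := by
      intro i
      rw [← mul_sub]
      refine mul_le_mul_of_nonneg_left ?_ (ha i)
      have h2 := abs_wcov_sub_le (hw i) hC hC (hxu i) (hxu i) (hx i) β₀ (β₀ + t • u)
      rw [add_sub_cancel_left, norm_smul, hu, mul_one, Real.norm_of_nonneg ht.1] at h2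
      have h3 := (abs_le.1 h2).1
      have h4 : 6 * (C ^ 2 * C) * t ≤ lam / 2 := le_trans (by
        rw [show 6 * (C ^ 2 * C) * t = 6 * C ^ 3 * t by ring]
        exact mul_le_mul_of_nonneg_left ht.2 (by positivity)) hrl
      linarith
    have h5 := Finset.sum_le_sum fun i (_ : i ∈ Finset.univ) => h1 i
    rw [Finset.sum_sub_distrib, ← Finset.sum_mul] at h5
    have h6 : (∑ i, a i) * (lam / 2) ≤ lam / 2 :=
      mul_le_of_le_one_left (le_trans (by positivity) hrl) ha1
    simp only [hg']
    linarith
  have hgr : g r - g 0 ≤ -(lam / 2) * (r - 0) := by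
    refine Convex.image_sub_le_mul_sub_of_deriv_le (convex_Icc 0 r)
      (fun t _ => (hderiv t).continuousAt.continuousWithinAt)
      (fun t _ => (hderiv t).differentiableAt.differentiableWithinAt) (fun t ht => ?_) 0
      ⟨le_rfl, hr⟩ r ⟨hr, le_rfl⟩ hr
    rw [(hderiv t).deriv]
    exact hnear t (interior_subset ht)
  have hg0 : g 0 ≤ δ := by simpa [hg] using hδ
  have := hanti hs
  change g s ≤ _
  linarith

lemma wcov_inner (w : ι → ℝ) (x : ι → Vec p) (β u : Vec p) :
    wcov w x (fun j => inner ℝ (x j) u) (fun j => inner ℝ (x j) u) β =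
      ∑ a, ∑ c, u a * u c * wcov w x (fun j => x j a) (fun j => x j c) β := by
  unfold wcov
  have h1 : (fun j => inner ℝ (x j) u * inner ℝ (x j) u) =
      fun j => ∑ a, ∑ c, u a * u c * (x j a * x j c) := by
    ext j
    rw [inner_eq_sum, Finset.sum_mul_sum]
    exact Finset.sum_congr rfl fun a _ => Finset.sum_congr rfl fun c _ => by ring
  have h2 : wavg w x (fun j => inner ℝ (x j) u) β = ∑ a, u a * wavg w x (fun j => x j a) β := by
    simp only [inner_eq_sum, wavg_sum, wavg_const_mul]
  rw [h1, h2, Finset.sum_mul_sum]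
  simp only [wavg_sum, wavg_const_mul, mul_sub, Finset.sum_sub_distrib]
  congr 1
  exact Finset.sum_congr rfl fun a _ => Finset.sum_congr rfl fun c _ => by ring

end EstimatingFunction

/-! ### Scores as sums over event times -/

section ScoreSums

variable {Ω : Type*} {n p : ℕ}

namespace SurvivalData

variable (D : SurvivalData Ω n p) (τ : ℝ≥0)

/-- At-risk indicator of individual `j` at the event time of individual `i`. -/
def riskAt (ω : Ω) (i j : Fin n) : ℝ := D.Y j (D.jumpTime τ i ω) ω

/-- Covariates of individual `j` at the event time of individual `i`. -/
def covAt (ω : Ω) (i j : Fin n) : Vec p := D.X j (D.jumpTime τ i ω) ω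

/-- `n⁻¹ ∑ᵢ cᵢ ∫₀^τ [X_i(t) - E(t, β)] dN_i(t)`. -/
def avgScore (c : Fin n → ℝ) (β : Vec p) (ω : Ω) : Vec p :=
  linScore (D.riskAt τ ω) (D.covAt τ ω) (fun i => D.covAt τ ω i i)
    (fun i => (n : ℝ)⁻¹ * (c i * D.N i τ ω)) β

/-- `n⁻¹ ∑ᵢ cᵢ ∫₀^τ V(t, β) dN_i(t)`, with the covariance `V` of the covariates over the risk set. -/
def avgCov (c : Fin n → ℝ) (β : Vec p) (ω : Ω) (a d : Fin p) : ℝ :=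
  (n : ℝ)⁻¹ * ∑ i, c i * ((D.N i τ ω : ℝ) * wcov (D.riskAt τ ω i) (D.covAt τ ω i)
    (fun j => D.covAt τ ω i j a) (fun j => D.covAt τ ω i j d) β)

lemma Ebar_eq (t : ℝ≥0) (β : Vec p) (ω : Ω) :
    D.Ebar t β ω = wmean (fun j => D.Y j t ω) (fun j => D.X j t ω) β := by
  simp [Ebar, S0, S1, risk, wmean, wsum]

/-- `X_i(T_i) - E(T_i, β)` at the event time `T_i`, and `0` if there is no event. -/
def residual (i : Fin n) (β : Vec p) (ω : Ω) : Vec p :=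
  (D.N i τ ω : ℝ) • (D.covAt τ ω i i - wmean (D.riskAt τ ω i) (D.covAt τ ω i) β)

lemma avgScore_eq (c : Fin n → ℝ) (β : Vec p) (ω : Ω) :
    D.avgScore τ c β ω = (n : ℝ)⁻¹ • ∑ i, c i • D.residual τ i β ω := by
  simp [avgScore, linScore, residual, Finset.smul_sum, smul_smul]

lemma smul_avgScore (c : Fin n → ℝ) (β : Vec p) (ω : Ω) :
    (n : ℝ) • D.avgScore τ c β ω = ∑ i, c i • D.residual τ i β ω := by
  rw [avgScore_eq, smul_smul]
  rcases Nat.eq_zero_or_pos n with rfl | hn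
  · simp
  · rw [mul_inv_cancel₀ (by positivity), one_smul]

lemma avgScore_add (c d : Fin n → ℝ) (β : Vec p) (ω : Ω) :
    D.avgScore τ (fun i => c i + d i) β ω = D.avgScore τ c β ω + D.avgScore τ d β ω := by
  simp only [avgScore_eq, add_smul, Finset.sum_add_distrib, smul_add]

lemma avgCov_add (c d : Fin n → ℝ) (β : Vec p) (ω : Ω) (a b : Fin p) :
    D.avgCov τ (fun i => c i + d i) β ω a b = D.avgCov τ c β ω a b + D.avgCov τ d β ω a b := by
  simp only [avgCov, add_mul, Finset.sum_add_distrib, mul_add]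

end SurvivalData

variable [mΩ : MeasurableSpace Ω] {μ : Measure Ω} {D : SurvivalData Ω n p}
  {ℱ : Filtration ℝ≥0 mΩ} {τ : ℝ≥0} {haz : ℝ≥0 → ℝ} {β₀ : Vec p} {F : Set (Vec p)} {C : ℝ}

namespace IsCoxModel

lemma intN_residual (hC : IsCoxModel μ D ℱ τ haz β₀ F) (i : Fin n) (β : Vec p) (ω : Ω) :
    (D.intN τ i ω fun t => D.X i t ω - D.Ebar t β ω) = D.residual τ i β ω := by
  rw [hC.intN_eq, SurvivalData.Ebar_eq]
  rfl

lemma score_eq (hC : IsCoxModel μ D ℱ τ haz β₀ F) (β : Vec p) (ω : Ω) :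
    D.score τ β ω = (n : ℝ) • D.avgScore τ (fun _ => 1) β ω := by
  simp only [SurvivalData.smul_avgScore, SurvivalData.score, hC.intN_residual, one_smul]

lemma classicalScore_eq (hC : IsCoxModel μ D ℱ τ haz β₀ F) (G : Fin n → Ω → ℝ) (β : Vec p) (ω : Ω) :
    D.classicalScore τ G β ω = ∑ i, G i ω • D.residual τ i β ω := by
  simp only [SurvivalData.classicalScore, hC.intN_residual]

lemma bootScore_eq (hC : IsCoxModel μ D ℱ τ haz β₀ F) (G : Fin n → Ω → ℝ) (β : Vec p) (ω : Ω) :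
    D.bootScore τ G β ω = (n : ℝ) • D.avgScore τ (fun i => G i ω + 1) β ω := by
  simp only [SurvivalData.smul_avgScore, SurvivalData.bootScore, hC.intN_residual]

/-- The two resampled scores differ by the score itself, so they coincide at a zero of the score. -/
lemma bootScore_eq_add (hC : IsCoxModel μ D ℱ τ haz β₀ F) (G : Fin n → Ω → ℝ) (β : Vec p) (ω : Ω) :
    D.bootScore τ G β ω = D.classicalScore τ G β ω + D.score τ β ω := by
  rw [hC.bootScore_eq, hC.score_eq, hC.classicalScore_eq, SurvivalData.avgScore_add, smul_add,
    SurvivalData.smul_avgScore]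

lemma covAt_norm_le (hC : IsCoxModel μ D ℱ τ haz β₀ F) (hF : ∀ x ∈ F, ‖x‖ ≤ C) (ω : Ω)
    (i j : Fin n) : ‖D.covAt τ ω i j‖ ≤ C :=
  hF _ (hC.X_mem j _ (D.jumpTime_le τ i ω) ω)

lemma covAt_abs_le (hC : IsCoxModel μ D ℱ τ haz β₀ F) (hF : ∀ x ∈ F, ‖x‖ ≤ C) (ω : Ω)
    (i j : Fin n) (a : Fin p) : |D.covAt τ ω i j a| ≤ C :=
  (abs_coord_le _ a).trans (hC.covAt_norm_le hF ω i j)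

lemma riskAt_eq (hC : IsCoxModel μ D ℱ τ haz β₀ F) (ω : Ω) (i j : Fin n) :
    D.riskAt τ ω i j = 0 ∨ D.riskAt τ ω i j = 1 :=
  hC.Y_indicator j _ (D.jumpTime_le τ i ω) ω

lemma riskAt_nonneg (hC : IsCoxModel μ D ℱ τ haz β₀ F) (ω : Ω) (i j : Fin n) :
    0 ≤ D.riskAt τ ω i j := by
  rcases hC.riskAt_eq ω i j with h | h <;> simp [h]

lemma residual_apply (i : Fin n) (β : Vec p) (ω : Ω) (a : Fin p) : D.residual τ i β ω a =
    (D.N i τ ω : ℝ) * (D.covAt τ ω i i a -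
      wavg (D.riskAt τ ω i) (D.covAt τ ω i) (fun j => D.covAt τ ω i j a) β) := by
  simp [SurvivalData.residual, wmean_apply]

lemma N_abs_le (hC : IsCoxModel μ D ℱ τ haz β₀ F) (i : Fin n) (ω : Ω) : |(D.N i τ ω : ℝ)| ≤ 1 := by
  rcases hC.N_eq_zero_or_one i ω with h | h <;> simp [h]

lemma N_mul_abs_le (hC : IsCoxModel μ D ℱ τ haz β₀ F) (i : Fin n) (ω : Ω) (y : ℝ) :
    |(D.N i τ ω : ℝ) * y| ≤ |y| := by
  rw [abs_mul]
  exact mul_le_of_le_one_left (abs_nonneg _) (hC.N_abs_le i ω)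

lemma residual_abs_le (hC : IsCoxModel μ D ℱ τ haz β₀ F) (hC0 : 0 ≤ C) (hF : ∀ x ∈ F, ‖x‖ ≤ C)
    (i : Fin n) (β : Vec p) (ω : Ω) (a : Fin p) : |D.residual τ i β ω a| ≤ 2 * C := by
  rw [residual_apply]
  refine (hC.N_mul_abs_le i ω _).trans ((abs_sub _ _).trans ?_)
  have h1 := hC.covAt_abs_le hF ω i i a
  have h2 := abs_wavg_le (x := D.covAt τ ω i) (β := β) (hC.riskAt_nonneg ω i) hC0
    fun j => hC.covAt_abs_le hF ω i j a
  linarith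

lemma residual_norm_le (hC : IsCoxModel μ D ℱ τ haz β₀ F) (hC0 : 0 ≤ C) (hF : ∀ x ∈ F, ‖x‖ ≤ C)
    (i : Fin n) (β : Vec p) (ω : Ω) : ‖D.residual τ i β ω‖ ≤ p * (2 * C) := by
  refine (norm_le_sum_abs _).trans ((Finset.sum_le_sum fun a _ =>
    hC.residual_abs_le hC0 hF i β ω a).trans ?_)
  simp

/-- Only the risk-set mean in a residual depends on the parameter, and it is Lipschitz with a
constant independent of the sample. -/
lemma residual_sub_abs_le (hC : IsCoxModel μ D ℱ τ haz β₀ F) (hC0 : 0 ≤ C) (hF : ∀ x ∈ F, ‖x‖ ≤ C)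
    (i : Fin n) (β β' : Vec p) (ω : Ω) (a : Fin p) :
    |D.residual τ i β' ω a - D.residual τ i β ω a| ≤ 2 * (C * C) * ‖β' - β‖ := by
  rw [residual_apply, residual_apply, ← mul_sub, sub_sub_sub_cancel_left, ← neg_sub, mul_neg, abs_neg]
  exact (hC.N_mul_abs_le i ω _).trans (abs_wavg_sub_le (hC.riskAt_nonneg ω i) hC0 hC0
    (fun j => hC.covAt_abs_le hF ω i j a) (hC.covAt_norm_le hF ω i) β β')

/-- The derivative of the resampled score is given by the covariances over the risk sets. -/
lemma bootJacobian_eq (hC : IsCoxModel μ D ℱ τ haz β₀ F) (G : Fin n → Ω → ℝ) (b : Fin p → Vec p)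
    (ω : Ω) (a c : Fin p) : -((n : ℝ)⁻¹ * D.bootJacobian τ G b ω a c) =
      D.avgCov τ (fun i => G i ω + 1) (b a) ω a c := by
  choose L hL e using fun i => wavg_hasFDerivAt (hC.riskAt_nonneg ω i) (D.covAt τ ω i)
    (fun j => D.covAt τ ω i j a) (b a)
  have h1 : HasFDerivAt (fun β => D.bootScore τ G β ω a)
      (∑ i, (G i ω + 1) • (D.N i τ ω : ℝ) • (-L i)) (b a) := by
    have h2 : HasFDerivAt (fun β => ∑ i, (G i ω + 1) * ((D.N i τ ω : ℝ) * (D.covAt τ ω i i a -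
        wavg (D.riskAt τ ω i) (D.covAt τ ω i) (fun j => D.covAt τ ω i j a) β)))
        (∑ i, (G i ω + 1) • (D.N i τ ω : ℝ) • (-L i)) (b a) :=
      HasFDerivAt.fun_sum fun i _ => (((hL i).const_sub _).const_mul _).const_mul _
    convert h2 using 1
    ext β
    rw [hC.bootScore_eq, SurvivalData.smul_avgScore]
    simp [residual_apply]
  have h3 : D.bootJacobian τ G b ω a c =
      (∑ i, (G i ω + 1) • (D.N i τ ω : ℝ) • (-L i)) (EuclideanSpace.single c 1) := by
    unfold SurvivalData.bootJacobian
    rw [Matrix.of_apply, h1.hasGradientAt.gradient, ← InnerProductSpace.toDual_symm_apply]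
    simp [EuclideanSpace.inner_single_right]
  rw [h3]
  simp only [SurvivalData.avgCov, sum_apply, smul_apply,
    neg_apply, e, smul_eq_mul, mul_neg, Finset.sum_neg_distrib, neg_neg,
    EuclideanSpace.inner_single_right, one_mul, conj_trivial]

lemma classicalInfo_apply (hC : IsCoxModel μ D ℱ τ haz β₀ F) (G : Fin n → Ω → ℝ) (β : Vec p)
    (ω : Ω) (a c : Fin p) : D.classicalInfo τ G β ω a c =
      ∑ i, (G i ω) ^ 2 * (D.residual τ i β ω a * D.residual τ i β ω c) := by
  unfold SurvivalData.classicalInfo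
  rw [Matrix.sum_apply]
  refine Finset.sum_congr rfl fun i _ => ?_
  rw [Matrix.smul_apply, hC.intN_eq, Matrix.smul_apply, smul_eq_mul, smul_eq_mul]
  congr 1
  rw [SurvivalData.Ebar_eq]
  unfold outer SurvivalData.residual
  rcases hC.N_eq_zero_or_one i ω with h | h
  · simp [h]
  · simp [h]
    rfl

lemma measurable_riskAt (hC : IsCoxModel μ D ℱ τ haz β₀ F) (i j : Fin n) :
    Measurable[D.obs τ] fun ω => D.riskAt τ ω i j :=
  hC.measurable_comp_jumpTime_obs i (hC.Y_jointly j)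

lemma measurable_covAt (hC : IsCoxModel μ D ℱ τ haz β₀ F) (i j : Fin n) :
    Measurable[D.obs τ] fun ω => D.covAt τ ω i j :=
  hC.measurable_comp_jumpTime_obs i (hC.X_jointly j)

lemma measurable_covAt_apply (hC : IsCoxModel μ D ℱ τ haz β₀ F) (i j : Fin n) (a : Fin p) :
    Measurable[D.obs τ] fun ω => D.covAt τ ω i j a :=
  (EuclideanSpace.proj (𝕜 := ℝ) a : Vec p →L[ℝ] ℝ).measurable.comp (hC.measurable_covAt i j)

lemma measurable_N_obs (i : Fin n) : Measurable[D.obs τ] fun ω => (D.N i τ ω : ℝ) :=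
  (measurable_of_countable (fun k : ℕ => (k : ℝ))).comp (D.measurable_N i le_rfl)

/-- The parameter may be random as long as it is a function of the data, which admits the estimator
as an argument. -/
lemma measurable_residual_apply (hC : IsCoxModel μ D ℱ τ haz β₀ F) (i : Fin n) {β : Ω → Vec p}
    (hβ : Measurable[D.obs τ] β) (a : Fin p) :
    Measurable[D.obs τ] fun ω => D.residual τ i (β ω) ω a := by
  have h1 := @measurable_wavg (Fin n) _ p Ω (D.obs τ) (fun j ω => D.riskAt τ ω i j)
    (fun j ω => D.covAt τ ω i j a) (fun j ω => D.covAt τ ω i j) β (hC.measurable_riskAt i)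
    (hC.measurable_covAt i) (fun j => hC.measurable_covAt_apply i j a) hβ
  have h2 := (measurable_N_obs (D := D) (τ := τ) i).mul ((hC.measurable_covAt_apply i i a).sub h1)
  simp only [residual_apply]
  exact h2

lemma measurable_residual (hC : IsCoxModel μ D ℱ τ haz β₀ F) (i : Fin n) {β : Ω → Vec p}
    (hβ : Measurable[D.obs τ] β) : Measurable[D.obs τ] fun ω => D.residual τ i (β ω) ω :=
  (WithLp.measurable_toLp 2 (Fin p → ℝ)).comp
    (measurable_pi_of fun a => hC.measurable_residual_apply i hβ a)

lemma measurable_N_mul_wcov (hC : IsCoxModel μ D ℱ τ haz β₀ F) (i : Fin n) (β : Vec p)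
    (a c : Fin p) : Measurable[D.obs τ] fun ω => (D.N i τ ω : ℝ) * wcov (D.riskAt τ ω i)
      (D.covAt τ ω i) (fun j => D.covAt τ ω i j a) (fun j => D.covAt τ ω i j c) β := by
  have h1 := @measurable_wcov (Fin n) _ p Ω (D.obs τ) (fun j ω => D.riskAt τ ω i j)
    (fun j ω => D.covAt τ ω i j a) (fun j ω => D.covAt τ ω i j c) (fun j ω => D.covAt τ ω i j)
    (fun _ => β) (hC.measurable_riskAt i) (hC.measurable_covAt i)
    (fun j => hC.measurable_covAt_apply i j a) (fun j => hC.measurable_covAt_apply i j c)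
    measurable_const
  exact (measurable_N_obs (D := D) (τ := τ) i).mul h1

end IsCoxModel
end ScoreSums

/-! ### Identities for compensators -/

section Covariance

variable {ι : Type*} [Fintype ι] {p : ℕ} {w : ι → ℝ} {x : ι → Vec p} {f g : ι → ℝ} {β : Vec p}

/-- Deviations from the weighted mean have weighted sum zero. Hence the compensators of the
individual score terms at the true parameter cancel. -/
lemma wsum_sub_wavg (hw : ∀ j, 0 ≤ w j) : wsum w x (fun j => f j - wavg w x f β) β = 0 := by
  have h := wavg_mul_wsum_one (f := f) (x := x) (β := β) hw
  have e : wsum w x (fun j => f j - wavg w x f β) β =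
      wsum w x f β - wavg w x f β * wsum w x (fun _ => 1) β := by
    simp only [wsum, sub_mul, Finset.sum_sub_distrib, one_mul, Finset.mul_sum]
  rw [e, h, sub_self]

/-- Products of residuals and the risk-set covariance therefore have the same aggregate intensity,
which is why both averages have the limit `Σ`. -/
lemma wsum_centered_mul (hw : ∀ j, 0 ≤ w j) :
    wsum w x (fun j => (f j - wavg w x f β) * (g j - wavg w x g β)) β =
      wcov w x f g β * wsum w x (fun _ => 1) β := by
  have hf := wavg_mul_wsum_one (f := f) (x := x) (β := β) hw
  have hfg := wavg_mul_wsum_one (f := fun j => f j * g j) (x := x) (β := β) hw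
  have h0 := wsum_sub_wavg (f := g) (x := x) (β := β) hw
  have e : wsum w x (fun j => (f j - wavg w x f β) * (g j - wavg w x g β)) β =
      wsum w x (fun j => f j * g j) β - wavg w x g β * wsum w x f β -
        wavg w x f β * wsum w x (fun j => g j - wavg w x g β) β := by
    simp only [wsum, Finset.mul_sum, ← Finset.sum_sub_distrib]
    exact Finset.sum_congr rfl fun j _ => by ring
  rw [e, h0, ← hf, ← hfg, wcov]
  ring

end Covariance

/-! ### From event-time averages to time integrals -/

section Limits

variable {Ω : Type*} [mΩ : MeasurableSpace Ω] {μ : Measure Ω} [IsProbabilityMeasure μ] {p : ℕ}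
    {τ : ℝ≥0} {haz : ℝ≥0 → ℝ} {β₀ : Vec p} {F : Set (Vec p)} {C K : ℝ}

/-- The convergence is uniform in time and the cumulative hazard is finite, so the integrals
converge. -/
lemma tendsto_timeIntegral (hz0 : ∀ t, 0 ≤ haz t)
    (hzi : IntervalIntegrable (fun s : ℝ => haz s.toNNReal) volume 0 τ)
    {Q : ℕ → Ω → ℝ≥0 → ℝ} {q : ℝ≥0 → ℝ} (hQ : ∀ n ω, Measurable (Q n ω))
    (hK : ∀ n ω, ∀ t ≤ τ, |Q n ω t| ≤ K)
    (h : ∀ ε > 0, ∀ᶠ s in probFilter μ, ∀ t ≤ τ, |Q s.1 s.2 t - q t| ≤ ε) :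
    Tendsto (fun s : ℕ × Ω => timeIntegral τ fun t => Q s.1 s.2 t * haz t) (probFilter μ)
      (𝓝 (timeIntegral τ fun t => q t * haz t)) := by
  have hne : (probFilter μ).NeBot := probFilter_neBot
  have hi : IntegrableOn (fun s : ℝ => haz s.toNNReal) (Set.Ioc (0 : ℝ) τ) :=
    (intervalIntegrable_iff_integrableOn_Ioc_of_le τ.2).1 hzi
  have hmem := ae_restrict_mem (μ := volume) (measurableSet_Ioc (a := (0 : ℝ)) (b := τ))
  have hQi : ∀ n ω, IntegrableOn (fun s : ℝ => Q n ω s.toNNReal * haz s.toNNReal)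
      (Set.Ioc (0 : ℝ) τ) := fun n ω => by
    refine Integrable.bdd_mul (c := K) hi
      ((hQ n ω).comp measurable_real_toNNReal).aestronglyMeasurable ?_
    filter_upwards [hmem] with s hs using hK n ω _ (toNNReal_le_of_mem_Ioc hs)
  -- The limit `q` is not assumed measurable. Samples chosen with uniform error at most `1 / (k +
  -- 1)` exhibit it as a pointwise limit of measurable functions.
  have hqm : AEStronglyMeasurable (fun s : ℝ => q s.toNNReal)
      (volume.restrict (Set.Ioc (0 : ℝ) τ)) := by
    choose r hr using fun k : ℕ => (h (1 / ((k : ℝ) + 1)) (by positivity)).exists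
    refine aestronglyMeasurable_of_tendsto_ae atTop
      (f := fun k (s : ℝ) => Q (r k).1 (r k).2 s.toNNReal)
      (fun k => ((hQ _ _).comp measurable_real_toNNReal).aestronglyMeasurable) ?_
    filter_upwards [hmem] with s hs
    rw [tendsto_iff_dist_tendsto_zero]
    refine squeeze_zero (fun _ => dist_nonneg) (fun k => ?_) tendsto_one_div_add_atTop_nhds_zero_nat
    exact hr k _ (toNNReal_le_of_mem_Ioc hs)
  have hqi : IntegrableOn (fun s : ℝ => q s.toNNReal * haz s.toNNReal) (Set.Ioc (0 : ℝ) τ) := by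
    obtain ⟨r, hr⟩ := (h 1 one_pos).exists
    refine Integrable.bdd_mul (c := K + 1) hi hqm ?_
    filter_upwards [hmem] with s hs
    have h1 := hK r.1 r.2 _ (toNNReal_le_of_mem_Ioc hs)
    have h2 := hr _ (toNNReal_le_of_mem_Ioc hs)
    rw [abs_sub_comm] at h2
    rw [Real.norm_eq_abs]
    calc |q s.toNNReal| = |(q s.toNNReal - Q r.1 r.2 s.toNNReal) + Q r.1 r.2 s.toNNReal| := by
          rw [sub_add_cancel]
      _ ≤ _ := (abs_add_le _ _).trans (by linarith)
  set I := ∫ s in Set.Ioc (0 : ℝ) τ, haz s.toNNReal with hI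
  have hI0 : 0 ≤ I := integral_nonneg fun s => hz0 _
  rw [Metric.tendsto_nhds]
  intro ε hε
  filter_upwards [h (ε / (I + 1)) (by positivity)] with s hs
  rw [timeIntegral_eq, timeIntegral_eq, Real.dist_eq, ← integral_sub (hQi _ _) hqi]
  calc _ ≤ ∫ u in Set.Ioc (0 : ℝ) τ, ε / (I + 1) * haz u.toNNReal := by
        refine abs_integral_le_integral_abs.trans (integral_mono_ae ((hQi _ _).sub hqi).abs
          (hi.const_mul _) ?_)
        filter_upwards [hmem] with u hu
        rw [← sub_mul, abs_mul, abs_of_nonneg (hz0 _)]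
        exact mul_le_mul_of_nonneg_right (hs _ (toNNReal_le_of_mem_Ioc hu)) (hz0 _)
    _ = ε / (I + 1) * I := integral_const_mul _ _
    _ < ε := by
      rw [div_mul_eq_mul_div, div_lt_iff₀ (by positivity)]
      nlinarith

lemma SupTendstoZero.eventually {B : Set (Vec p)} {Z : ℕ → ℝ≥0 → Vec p → Ω → ℝ}
    (h : SupTendstoZero μ τ B Z) {β : Vec p} (hβ : β ∈ B) {ε : ℝ} (hε : 0 < ε) :
    ∀ᶠ q in probFilter μ, ∀ t ≤ τ, Z q.1 t β q.2 ≤ ε := by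
  rw [eventually_probFilter]
  refine tendsto_of_tendsto_of_tendsto_of_le_of_le tendsto_const_nhds (h ε hε) (fun _ => zero_le)
    fun n => measure_mono fun ω hω => ?_
  simp only [Set.mem_ofPred_eq, not_forall, not_le] at hω ⊢
  obtain ⟨t, ht, h1⟩ := hω
  exact ⟨t, ht, β, hβ, h1⟩

variable {D : (n : ℕ) → SurvivalData Ω n p} {ℱ : ℕ → Filtration ℝ≥0 mΩ}

/-- An average of integrals with respect to the counting processes is asymptotically equal to
the average of the integrals with respect to the cumulative intensities. -/
lemma tendsto_average_sub_timeIntegral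
    (hC : ∀ n, IsCoxModel μ (D n) (ℱ n) τ haz β₀ F) (hF : ∀ x ∈ F, ‖x‖ ≤ C)
    (hz : Measurable haz) (hz0 : ∀ t, 0 ≤ haz t)
    (hzi : IntervalIntegrable (fun s : ℝ => haz s.toNNReal) volume 0 τ)
    {H : (n : ℕ) → Fin n → ℝ≥0 → Ω → ℝ} (hH : ∀ n i, IsStronglyPredictable (ℱ n) (H n i))
    (hK0 : 0 ≤ K) (hK : ∀ n i, ∀ t ≤ τ, ∀ ω, |H n i t ω| ≤ K)
    {Q : ℕ → Ω → ℝ≥0 → ℝ} (hQ : ∀ (n : ℕ) ω, ∀ t ≤ τ,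
      (n : ℝ)⁻¹ * ∑ i, H n i t ω * (D n).risk i t β₀ ω = Q n ω t) :
    Tendsto (fun q : ℕ × Ω => (q.1 : ℝ)⁻¹ * ∑ i, ((D q.1).N i τ q.2 : ℝ) *
      H q.1 i ((D q.1).jumpTime τ i q.2) q.2 - timeIntegral τ fun t => Q q.1 q.2 t * haz t)
      (probFilter μ) (𝓝 0) := by
  refine (tendsto_average_integral hC hF hz hz0 hzi hH hK0 hK).congr fun q => ?_
  rw [Finset.sum_sub_distrib, mul_sub]
  congr 1
  simp only [SurvivalData.compensator, timeIntegral_eq]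
  rw [← integral_finsetSum _ fun i _ => (hC q.1).integrableOn_intensity hF hzi
    (IsStronglyPredictable_measurable (hH q.1 i)) (hK q.1 i) q.2, ← integral_const_mul]
  refine setIntegral_congr_fun measurableSet_Ioc fun s hs => ?_
  rw [← hQ q.1 q.2 _ (toNNReal_le_of_mem_Ioc hs), Finset.mul_sum, Finset.mul_sum, Finset.sum_mul]
  exact Finset.sum_congr rfl fun i _ => by ring

end Limits

/-! ### Risk-set means and covariances as predictable processes -/

section Predictability

variable {Ω : Type*} [mΩ : MeasurableSpace Ω] {μ : Measure Ω} {n p : ℕ}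
    {D : SurvivalData Ω n p} {ℱ : Filtration ℝ≥0 mΩ} {τ : ℝ≥0} {haz : ℝ≥0 → ℝ} {β₀ : Vec p}
    {F : Set (Vec p)} {C : ℝ}

/-- The mean of the `a`-th covariate over the risk set. -/
def SurvivalData.mean (D : SurvivalData Ω n p) (β : Vec p) (a : Fin p) (t : ℝ≥0) (ω : Ω) : ℝ :=
  wavg (fun j => D.Y j t ω) (fun j => D.X j t ω) (fun j => D.X j t ω a) β

/-- The covariance of the `a`-th and the `c`-th covariate over the risk set. -/
def SurvivalData.cov (D : SurvivalData Ω n p) (β : Vec p) (a c : Fin p) (t : ℝ≥0) (ω : Ω) : ℝ :=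
  wcov (fun j => D.Y j t ω) (fun j => D.X j t ω) (fun j => D.X j t ω a) (fun j => D.X j t ω c) β

lemma SurvivalData.S0_eq (t : ℝ≥0) (β : Vec p) (ω : Ω) :
    D.S0 t β ω = wsum (fun j => D.Y j t ω) (fun j => D.X j t ω) (fun _ => 1) β := by
  simp [SurvivalData.S0, SurvivalData.risk, wsum]

lemma SurvivalData.S1_apply (t : ℝ≥0) (β : Vec p) (ω : Ω) (a : Fin p) :
    D.S1 t β ω a = wsum (fun j => D.Y j t ω) (fun j => D.X j t ω) (fun j => D.X j t ω a) β := by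
  simp [SurvivalData.S1, SurvivalData.risk, wsum, mul_comm]

lemma SurvivalData.S2_apply (t : ℝ≥0) (β : Vec p) (ω : Ω) (a c : Fin p) :
    D.S2 t β ω a c = wsum (fun j => D.Y j t ω) (fun j => D.X j t ω)
      (fun j => D.X j t ω a * D.X j t ω c) β := by
  simp [SurvivalData.S2, SurvivalData.risk, wsum, outer, Matrix.sum_apply, mul_comm]

namespace IsCoxModel

lemma Y_nonneg (hC : IsCoxModel μ D ℱ τ haz β₀ F) {t : ℝ≥0} (ht : t ≤ τ) (ω : Ω) (j : Fin n) :
    0 ≤ D.Y j t ω := by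
  rcases hC.Y_indicator j t ht ω with h | h <;> simp [h]

lemma X_abs_le (hC : IsCoxModel μ D ℱ τ haz β₀ F) (hF : ∀ x ∈ F, ‖x‖ ≤ C) {t : ℝ≥0} (ht : t ≤ τ)
    (ω : Ω) (a : Fin p) (j : Fin n) : |D.X j t ω a| ≤ C :=
  (abs_coord_le _ a).trans (hF _ (hC.X_mem j t ht ω))

lemma mean_abs_le (hC : IsCoxModel μ D ℱ τ haz β₀ F) (hC0 : 0 ≤ C) (hF : ∀ x ∈ F, ‖x‖ ≤ C)
    {t : ℝ≥0} (ht : t ≤ τ) (β : Vec p) (ω : Ω) (a : Fin p) : |D.mean β a t ω| ≤ C :=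
  abs_wavg_le (hC.Y_nonneg ht ω) hC0 (hC.X_abs_le hF ht ω a)

lemma cov_abs_le (hC : IsCoxModel μ D ℱ τ haz β₀ F) (hC0 : 0 ≤ C) (hF : ∀ x ∈ F, ‖x‖ ≤ C)
    {t : ℝ≥0} (ht : t ≤ τ) (β : Vec p) (ω : Ω) (a c : Fin p) :
    |D.cov β a c t ω| ≤ 2 * (C * C) :=
  abs_wcov_le (hC.Y_nonneg ht ω) hC0 hC0 (hC.X_abs_le hF ht ω a) (hC.X_abs_le hF ht ω c)

lemma X_apply_predictable (hC : IsCoxModel μ D ℱ τ haz β₀ F) (a : Fin p) (j : Fin n) :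
    IsStronglyPredictable ℱ fun t ω => D.X j t ω a := by
  refine isStronglyPredictable_of_measurable ?_
  exact (EuclideanSpace.proj (𝕜 := ℝ) a : Vec p →L[ℝ] ℝ).measurable.comp
    (hC.X_predictable j).measurable

lemma mean_predictable (hC : IsCoxModel μ D ℱ τ haz β₀ F) (β : Vec p) (a : Fin p) :
    IsStronglyPredictable ℱ (D.mean β a) := by
  refine isStronglyPredictable_of_measurable ?_
  exact @measurable_wavg (Fin n) _ p (ℝ≥0 × Ω) ℱ.predictable (fun j q => D.Y j q.1 q.2)
    (fun j q => D.X j q.1 q.2 a) (fun j q => D.X j q.1 q.2) (fun _ => β)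
    (fun j => (hC.Y_predictable j).measurable) (fun j => (hC.X_predictable j).measurable)
    (fun j => (hC.X_apply_predictable a j).measurable) measurable_const

lemma cov_predictable (hC : IsCoxModel μ D ℱ τ haz β₀ F) (β : Vec p) (a c : Fin p) :
    IsStronglyPredictable ℱ (D.cov β a c) := by
  refine isStronglyPredictable_of_measurable ?_
  exact @measurable_wcov (Fin n) _ p (ℝ≥0 × Ω) ℱ.predictable (fun j q => D.Y j q.1 q.2)
    (fun j q => D.X j q.1 q.2 a) (fun j q => D.X j q.1 q.2 c) (fun j q => D.X j q.1 q.2)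
    (fun _ => β) (fun j => (hC.Y_predictable j).measurable)
    (fun j => (hC.X_predictable j).measurable)
    (fun j => (hC.X_apply_predictable a j).measurable)
    (fun j => (hC.X_apply_predictable c j).measurable) measurable_const

lemma centered_predictable (hC : IsCoxModel μ D ℱ τ haz β₀ F) (β : Vec p) (a : Fin p) (i : Fin n) :
    IsStronglyPredictable ℱ fun t ω => D.X i t ω a - D.mean β a t ω := by
  refine isStronglyPredictable_of_measurable ?_
  have h := (hC.X_apply_predictable a i).measurable.sub (hC.mean_predictable β a).measurable
  exact h

lemma centered_abs_le (hC : IsCoxModel μ D ℱ τ haz β₀ F) (hC0 : 0 ≤ C) (hF : ∀ x ∈ F, ‖x‖ ≤ C)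
    {t : ℝ≥0} (ht : t ≤ τ) (β : Vec p) (ω : Ω) (a : Fin p) (i : Fin n) :
    |D.X i t ω a - D.mean β a t ω| ≤ 2 * C := by
  have h1 := hC.X_abs_le hF ht ω a i
  have h2 := hC.mean_abs_le hC0 hF ht β ω a
  exact (abs_sub _ _).trans (by linarith)

lemma S0_nonneg (hC : IsCoxModel μ D ℱ τ haz β₀ F) {t : ℝ≥0} (ht : t ≤ τ) (β : Vec p) (ω : Ω) :
    0 ≤ D.S0 t β ω := Finset.sum_nonneg fun i _ => hC.risk_nonneg i ht β ω

lemma average_S0_le (hC : IsCoxModel μ D ℱ τ haz β₀ F) (hF : ∀ x ∈ F, ‖x‖ ≤ C) {t : ℝ≥0}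
    (ht : t ≤ τ) (β : Vec p) (ω : Ω) : (n : ℝ)⁻¹ * D.S0 t β ω ≤ Real.exp (C * ‖β‖) := by
  have h : D.S0 t β ω ≤ n * Real.exp (C * ‖β‖) := by
    refine (Finset.sum_le_sum fun i _ => hC.risk_le hF i ht β ω).trans ?_
    simp
  rcases Nat.eq_zero_or_pos n with rfl | hn
  · simp [Real.exp_nonneg]
  · rwa [inv_mul_le_iff₀ (by positivity)]

lemma measurable_cov_mul_S0 (hC : IsCoxModel μ D ℱ τ haz β₀ F) (a c : Fin p) (ω : Ω) :
    Measurable fun t => D.cov β₀ a c t ω * ((n : ℝ)⁻¹ * D.S0 t β₀ ω) := by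
  have hmap : Measurable fun t : ℝ≥0 => (t, ω) := measurable_id.prodMk measurable_const
  have h1 : Measurable fun t => D.cov β₀ a c t ω :=
    (IsStronglyPredictable_measurable (hC.cov_predictable β₀ a c)).comp hmap
  have h2 : Measurable fun t => D.S0 t β₀ ω := Finset.measurable_sum _ fun i _ =>
    (IsStronglyPredictable_measurable (hC.risk_predictable i)).comp hmap
  exact h1.mul (h2.const_mul _)

end IsCoxModel
end Predictability

/-! ### Limits at the true parameter -/

section InformationLimits

variable {Ω : Type*} [mΩ : MeasurableSpace Ω] {μ : Measure Ω} [IsProbabilityMeasure μ] {p : ℕ}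
    {τ : ℝ≥0} {haz : ℝ≥0 → ℝ} {β₀ : Vec p} {F : Set (Vec p)} {C : ℝ}
    {D : (n : ℕ) → SurvivalData Ω n p} {ℱ : ℕ → Filtration ℝ≥0 mΩ}
    {B : Set (Vec p)} {s0 : ℝ≥0 → Vec p → ℝ} {s1 : ℝ≥0 → Vec p → Vec p}
    {s2 : ℝ≥0 → Vec p → Matrix (Fin p) (Fin p) ℝ}

/-- The score at the true parameter, divided by the sample size, tends to zero. -/
lemma tendsto_avgScore_one (hC : ∀ n, IsCoxModel μ (D n) (ℱ n) τ haz β₀ F) (hC0 : 0 ≤ C)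
    (hF : ∀ x ∈ F, ‖x‖ ≤ C) (hz : Measurable haz) (hz0 : ∀ t, 0 ≤ haz t)
    (hzi : IntervalIntegrable (fun s : ℝ => haz s.toNNReal) volume 0 τ) (a : Fin p) :
    Tendsto (fun q : ℕ × Ω => (D q.1).avgScore τ (fun _ => 1) β₀ q.2 a) (probFilter μ) (𝓝 0) := by
  have h := tendsto_average_sub_timeIntegral hC hF hz hz0 hzi
    (H := fun n i t ω => (D n).X i t ω a - (D n).mean β₀ a t ω) (K := 2 * C)
    (fun n i => (hC n).centered_predictable β₀ a i) (by positivity)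
    (fun n i t ht ω => (hC n).centered_abs_le hC0 hF ht β₀ ω a i) (Q := fun _ _ _ => 0) ?_
  · refine h.congr fun q => ?_
    rw [SurvivalData.avgScore_eq]
    simp only [zero_mul, timeIntegral_eq, integral_zero, sub_zero, one_smul, PiLp.smul_apply,
      smul_eq_mul, WithLp.ofLp_sum, Finset.sum_apply, IsCoxModel.residual_apply]
    rfl
  · intro n ω t ht
    have := wsum_sub_wavg (f := fun j => (D n).X j t ω a) (x := fun j => (D n).X j t ω) (β := β₀)
      ((hC n).Y_nonneg ht ω)
    rw [mul_eq_zero]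
    exact Or.inr this

/-- After multiplication by `S₀` the covariance becomes `S₂` minus the bounded risk-set mean times
`S₁`. The random `S₀`, which may vanish, is never divided by; only its limit is, and that is bounded
away from zero. -/
lemma tendsto_cov_mul_S0 (hC : ∀ n, IsCoxModel μ (D n) (ℱ n) τ haz β₀ F) (hC0 : 0 ≤ C)
    (hF : ∀ x ∈ F, ‖x‖ ≤ C) (hReg : RegularityConditions μ D τ haz β₀ B s0 s1 s2) (a c : Fin p)
    {ε : ℝ} (hε : 0 < ε) :
    ∀ᶠ q in probFilter μ, ∀ t ≤ τ,
      |(D q.1).cov β₀ a c t q.2 * ((q.1 : ℝ)⁻¹ * (D q.1).S0 t β₀ q.2) -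
        limitV s0 s1 s2 t β₀ a c * s0 t β₀| ≤ ε := by
  obtain ⟨κ, hκ, hκs⟩ := hReg.away
  obtain ⟨-, K, hK⟩ := hReg.reg1
  -- The summands of `L` are the factors of the uniform error in `S₂`, in `S₁` times the bounded
  -- mean, and in the mean times the bounded `s₁`.
  set L := 1 + C + (C + 1) / κ * (|K| + 1) with hL
  have hL0 : 0 < L := by positivity
  have hη : 0 < ε / L := by positivity
  filter_upwards [hReg.conv0.eventually hReg.mem hη, hReg.conv1.eventually hReg.mem hη,
    (hReg.conv2 a c).eventually hReg.mem hη] with q h0 h1 h2 t ht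
  obtain ⟨n, ω⟩ := q
  simp only at h0 h1 h2 ⊢
  replace h0 := h0 t ht
  have h1a := (abs_coord_le _ a).trans (h1 t ht)
  have h1c := (abs_coord_le _ c).trans (h1 t ht)
  replace h2 := h2 t ht
  have hs0 := hκs t ht
  have hs0' : s0 t β₀ ≠ 0 := (hκ.trans_le hs0).ne'
  have hm := wavg_mul_wsum_one (f := fun j => (D n).X j t ω a) (x := fun j => (D n).X j t ω)
    (β := β₀) ((hC n).Y_nonneg ht ω)
  have hmm := wavg_mul_wsum_one (f := fun j => (D n).X j t ω a * (D n).X j t ω c)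
    (x := fun j => (D n).X j t ω) (β := β₀) ((hC n).Y_nonneg ht ω)
  have hmc := wavg_mul_wsum_one (f := fun j => (D n).X j t ω c) (x := fun j => (D n).X j t ω)
    (β := β₀) ((hC n).Y_nonneg ht ω)
  rw [← SurvivalData.S0_eq, ← SurvivalData.S1_apply] at hm hmc
  rw [← SurvivalData.S0_eq, ← SurvivalData.S2_apply] at hmm
  have hE := (hC n).mean_abs_le hC0 hF ht β₀ ω a
  simp only [PiLp.sub_apply, PiLp.smul_apply, smul_eq_mul] at h1a h1c
  have hcov : (D n).cov β₀ a c t ω * ((n : ℝ)⁻¹ * (D n).S0 t β₀ ω) =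
      (n : ℝ)⁻¹ * (D n).S2 t β₀ ω a c - (D n).mean β₀ a t ω * ((n : ℝ)⁻¹ * (D n).S1 t β₀ ω c) := by
    rw [← hmc, ← hmm]
    unfold SurvivalData.cov SurvivalData.mean wcov
    ring
  have hm' : (D n).mean β₀ a t ω * ((n : ℝ)⁻¹ * (D n).S0 t β₀ ω) =
      (n : ℝ)⁻¹ * (D n).S1 t β₀ ω a := by
    rw [← hm]
    unfold SurvivalData.mean
    ring
  have hlim : limitV s0 s1 s2 t β₀ a c * s0 t β₀ =
      s2 t β₀ a c - (s0 t β₀)⁻¹ * s1 t β₀ a * s1 t β₀ c := by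
    simp only [limitV, outer, Matrix.sub_apply, Matrix.smul_apply, Matrix.of_apply, smul_eq_mul,
      PiLp.smul_apply]
    field_simp
  rw [hcov, hlim]
  have hK1 : |s1 t β₀ c| ≤ |K| + 1 :=
    (abs_coord_le _ c).trans ((hK t ht β₀ hReg.mem).trans ((le_abs_self K).trans (by linarith)))
  generalize (D n).mean β₀ a t ω = E at *
  generalize (n : ℝ)⁻¹ * (D n).S0 t β₀ ω = T0 at *
  generalize (n : ℝ)⁻¹ * (D n).S1 t β₀ ω a = T1a at *
  generalize (n : ℝ)⁻¹ * (D n).S1 t β₀ ω c = T1c at *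
  generalize (n : ℝ)⁻¹ * (D n).S2 t β₀ ω a c = T2 at *
  generalize s0 t β₀ = r0 at *
  generalize s1 t β₀ a = r1a at *
  generalize s1 t β₀ c = r1c at *
  generalize s2 t β₀ a c = r2 at *
  set η := ε / L with hηdef
  have hdiff : |E - r0⁻¹ * r1a| ≤ (C + 1) / κ * η := by
    -- Since `T1a = E * T0`, the error of the mean is a combination of the errors of `T1a` and `T0`
    -- with bounded coefficients.
    have e : E - r0⁻¹ * r1a = r0⁻¹ * ((T1a - r1a) - E * (T0 - r0)) := by
      rw [← hm']
      field_simp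
      ring
    have hr0 : |r0⁻¹| ≤ κ⁻¹ := by
      rw [abs_inv, abs_of_pos (hκ.trans_le hs0)]
      exact inv_anti₀ hκ hs0
    have h3 : |(T1a - r1a) - E * (T0 - r0)| ≤ η + C * η := by
      refine (abs_sub _ _).trans (add_le_add h1a ?_)
      rw [abs_mul]
      exact mul_le_mul hE h0 (abs_nonneg _) hC0
    rw [e, abs_mul]
    calc _ ≤ κ⁻¹ * (η + C * η) := mul_le_mul hr0 h3 (abs_nonneg _) (by positivity)
      _ = _ := by ring
  have e : T2 - E * T1c - (r2 - r0⁻¹ * r1a * r1c) =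
      (T2 - r2) - (E * (T1c - r1c) + (E - r0⁻¹ * r1a) * r1c) := by ring
  rw [e]
  have h4 : |E * (T1c - r1c)| ≤ C * η := by
    rw [abs_mul]
    exact mul_le_mul hE h1c (abs_nonneg _) hC0
  have h5 : |(E - r0⁻¹ * r1a) * r1c| ≤ (C + 1) / κ * η * (|K| + 1) := by
    rw [abs_mul]
    exact mul_le_mul hdiff hK1 (abs_nonneg _) (by positivity)
  calc _ ≤ η + (C * η + (C + 1) / κ * η * (|K| + 1)) :=
        (abs_sub _ _).trans (add_le_add h2 ((abs_add_le _ _).trans (add_le_add h4 h5)))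
    _ = η * L := by rw [hL]; ring
    _ = ε := by rw [hηdef]; field_simp

lemma tendsto_timeIntegral_cov (hC : ∀ n, IsCoxModel μ (D n) (ℱ n) τ haz β₀ F) (hC0 : 0 ≤ C)
    (hF : ∀ x ∈ F, ‖x‖ ≤ C) (hz0 : ∀ t, 0 ≤ haz t)
    (hzi : IntervalIntegrable (fun s : ℝ => haz s.toNNReal) volume 0 τ)
    (hReg : RegularityConditions μ D τ haz β₀ B s0 s1 s2) (a c : Fin p) :
    Tendsto (fun q : ℕ × Ω => timeIntegral τ fun t => (D q.1).cov β₀ a c t q.2 *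
      ((q.1 : ℝ)⁻¹ * (D q.1).S0 t β₀ q.2) * haz t) (probFilter μ)
      (𝓝 (limitSigma τ haz β₀ s0 s1 s2 a c)) := by
  refine tendsto_timeIntegral (Q := fun n ω t => (D n).cov β₀ a c t ω *
    ((n : ℝ)⁻¹ * (D n).S0 t β₀ ω)) (q := fun t => limitV s0 s1 s2 t β₀ a c * s0 t β₀)
    (K := 2 * (C * C) * Real.exp (C * ‖β₀‖)) hz0 hzi
    (fun n ω => (hC n).measurable_cov_mul_S0 a c ω) (fun n ω t ht => ?_)
    fun ε hε => tendsto_cov_mul_S0 hC hC0 hF hReg a c hε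
  rw [abs_mul, abs_of_nonneg (mul_nonneg (by positivity) ((hC n).S0_nonneg ht β₀ ω))]
  exact mul_le_mul ((hC n).cov_abs_le hC0 hF ht β₀ ω a c) ((hC n).average_S0_le hF ht β₀ ω)
    (mul_nonneg (by positivity) ((hC n).S0_nonneg ht β₀ ω)) (by positivity)

/-- The integrand is the same for all individuals, so its aggregate intensity is the covariance
times `S₀`. -/
lemma tendsto_avgCov_one (hC : ∀ n, IsCoxModel μ (D n) (ℱ n) τ haz β₀ F) (hC0 : 0 ≤ C)
    (hF : ∀ x ∈ F, ‖x‖ ≤ C) (hz : Measurable haz) (hz0 : ∀ t, 0 ≤ haz t)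
    (hzi : IntervalIntegrable (fun s : ℝ => haz s.toNNReal) volume 0 τ)
    (hReg : RegularityConditions μ D τ haz β₀ B s0 s1 s2) (a c : Fin p) :
    Tendsto (fun q : ℕ × Ω => (D q.1).avgCov τ (fun _ => 1) β₀ q.2 a c) (probFilter μ)
      (𝓝 (limitSigma τ haz β₀ s0 s1 s2 a c)) := by
  have h := tendsto_average_sub_timeIntegral hC hF hz hz0 hzi
    (H := fun n _ t ω => (D n).cov β₀ a c t ω) (K := 2 * (C * C))
    (fun n _ => (hC n).cov_predictable β₀ a c) (by positivity)
    (fun n _ t ht ω => (hC n).cov_abs_le hC0 hF ht β₀ ω a c) (Q := fun n ω t =>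
      (D n).cov β₀ a c t ω * ((n : ℝ)⁻¹ * (D n).S0 t β₀ ω)) (fun n ω t ht => ?_)
  · have h2 := h.add (tendsto_timeIntegral_cov hC hC0 hF hz0 hzi hReg a c)
    rw [zero_add] at h2
    refine h2.congr fun q => ?_
    rw [sub_add_cancel]
    simp only [SurvivalData.avgCov, one_mul]
    rfl
  · rw [← Finset.mul_sum, SurvivalData.S0]
    ring

/-- The integrand is a product of deviations from the risk-set mean; by `wsum_centered_mul` its
aggregate intensity is again the covariance times `S₀`. -/
lemma tendsto_average_residual_mul (hC : ∀ n, IsCoxModel μ (D n) (ℱ n) τ haz β₀ F) (hC0 : 0 ≤ C)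
    (hF : ∀ x ∈ F, ‖x‖ ≤ C) (hz : Measurable haz) (hz0 : ∀ t, 0 ≤ haz t)
    (hzi : IntervalIntegrable (fun s : ℝ => haz s.toNNReal) volume 0 τ)
    (hReg : RegularityConditions μ D τ haz β₀ B s0 s1 s2) (a c : Fin p) :
    Tendsto (fun q : ℕ × Ω => (q.1 : ℝ)⁻¹ * ∑ i, (D q.1).residual τ i β₀ q.2 a *
      (D q.1).residual τ i β₀ q.2 c) (probFilter μ)
      (𝓝 (limitSigma τ haz β₀ s0 s1 s2 a c)) := by
  have h := tendsto_average_sub_timeIntegral hC hF hz hz0 hzi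
    (H := fun n i t ω => ((D n).X i t ω a - (D n).mean β₀ a t ω) *
      ((D n).X i t ω c - (D n).mean β₀ c t ω)) (K := 2 * C * (2 * C))
    (fun n i => isStronglyPredictable_mul ((hC n).centered_predictable β₀ a i)
      ((hC n).centered_predictable β₀ c i)) (by positivity)
    (fun n i t ht ω => ?_) (Q := fun n ω t =>
      (D n).cov β₀ a c t ω * ((n : ℝ)⁻¹ * (D n).S0 t β₀ ω)) (fun n ω t ht => ?_)
  · have h2 := h.add (tendsto_timeIntegral_cov hC hC0 hF hz0 hzi hReg a c)
    rw [zero_add] at h2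
    refine h2.congr fun q => ?_
    rw [sub_add_cancel]
    congr 1
    refine Finset.sum_congr rfl fun i _ => ?_
    rw [IsCoxModel.residual_apply, IsCoxModel.residual_apply]
    rcases (hC q.1).N_eq_zero_or_one i q.2 with h | h
    · simp [h]
    · rw [h, Nat.cast_one, one_mul, one_mul, one_mul]
      rfl
  · rw [abs_mul]
    exact mul_le_mul ((hC n).centered_abs_le hC0 hF ht β₀ ω a i)
      ((hC n).centered_abs_le hC0 hF ht β₀ ω c i) (abs_nonneg _) (by positivity)
  · have h3 := wsum_centered_mul (f := fun j => (D n).X j t ω a) (g := fun j => (D n).X j t ω c)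
      (x := fun j => (D n).X j t ω) (β := β₀) ((hC n).Y_nonneg ht ω)
    rw [SurvivalData.S0_eq, mul_left_comm]
    exact congrArg _ h3

end InformationLimits

/-! ### Grids of logarithmic radius -/

section Grid

variable {p : ℕ}

/-- The points are those of a cubic lattice of mesh `δ`. Rounding down every coordinate moves a
point by at most `δ` in each of the `p` coordinates. -/
lemma exists_grid (β₀ : Vec p) {δ : ℝ} (hδ : 0 < δ) (M : ℕ) :
    ∃ T : Finset (Vec p), T.card ≤ (2 * M + 1) ^ p ∧
      ∀ β, ‖β - β₀‖ ≤ δ * M → ∃ t ∈ T, ‖β - t‖ ≤ p * δ := by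
  classical
  refine ⟨(Fintype.piFinset fun _ : Fin p => Finset.Icc (-(M : ℤ)) M).image
    fun k => β₀ + WithLp.toLp 2 fun a => δ * (k a : ℝ), ?_, fun β hβ => ?_⟩
  · refine Finset.card_image_le.trans (le_of_eq ?_)
    rw [Fintype.card_piFinset]
    simp only [Int.card_Icc, Finset.prod_const, Finset.card_univ, Fintype.card_fin]
    congr 1
    omega
  · refine ⟨_, Finset.mem_image_of_mem _ (Fintype.mem_piFinset.2 fun a => ?_)
      (a := fun a => ⌊(β a - β₀ a) / δ⌋), ?_⟩
    · have h1 := abs_le.1 ((abs_coord_le (β - β₀) a).trans hβ)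
      simp only [PiLp.sub_apply] at h1
      rw [Finset.mem_Icc]
      constructor
      · rw [Int.le_floor, le_div_iff₀ hδ]
        push_cast
        linarith [h1.1]
      · have h2 : (⌊(β a - β₀ a) / δ⌋ : ℝ) ≤ M := by
          refine (Int.floor_le _).trans ?_
          rw [div_le_iff₀ hδ]
          linarith [h1.2]
        exact_mod_cast h2
    · refine (norm_le_sum_abs _).trans ((Finset.sum_le_sum (g := fun _ => δ) fun a _ => ?_).trans ?_)
      · simp only [PiLp.sub_apply, PiLp.add_apply]
        have h1 := Int.floor_le ((β a - β₀ a) / δ)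
        have h2 := (Int.lt_floor_add_one ((β a - β₀ a) / δ)).le
        rw [le_div_iff₀ hδ] at h1
        rw [div_le_iff₀ hδ] at h2
        rw [abs_le]
        constructor <;> nlinarith
      · simp

/-- A grid of logarithmic radius has `o(n)` points, few enough for a union of events of probability
`O(1 / n)`. -/
lemma tendsto_pow_log_div (p : ℕ) (a b : ℝ) :
    Tendsto (fun n : ℕ => (a * Real.log n + b) ^ p / n) atTop (𝓝 0) := by
  have h1 : (fun x : ℝ => (a * Real.log x + b) ^ p) =O[atTop] fun x => Real.log x ^ p := by
    refine Asymptotics.IsBigO.pow ?_ p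
    refine ((Asymptotics.isBigO_refl _ _).const_mul_left a).add ?_
    exact (Real.isLittleO_const_log_atTop (c := b)).isBigO
  have h2 : (fun x : ℝ => (a * Real.log x + b) ^ p) =o[atTop] id :=
    h1.trans_isLittleO Real.isLittleO_pow_log_id_atTop
  exact h2.tendsto_div_nhds_zero.comp tendsto_natCast_atTop_atTop

end Grid

/-! ### Uniform smallness of the multiplier perturbation -/

section Multipliers

variable {Ω : Type*} [mΩ : MeasurableSpace Ω] {μ : Measure Ω} [IsProbabilityMeasure μ] {p : ℕ}
    {τ : ℝ≥0} {haz : ℝ≥0 → ℝ} {β₀ : Vec p} {F : Set (Vec p)} {C : ℝ}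

lemma SurvivalData.avgScore_apply {n : ℕ} (D : SurvivalData Ω n p) (c : Fin n → ℝ) (β : Vec p)
    (ω : Ω) (a : Fin p) :
    D.avgScore τ c β ω a = (n : ℝ)⁻¹ * ∑ i, c i * D.residual τ i β ω a := by
  rw [SurvivalData.avgScore_eq]
  simp

namespace IsCoxModel

variable {n : ℕ} {D : SurvivalData Ω n p} {ℱ : Filtration ℝ≥0 mΩ}

lemma abs_avgScore_sub_le (hC : IsCoxModel μ D ℱ τ haz β₀ F) (hC0 : 0 ≤ C)
    (hF : ∀ x ∈ F, ‖x‖ ≤ C) (c : Fin n → ℝ) (β β' : Vec p) (ω : Ω) (a : Fin p) :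
    |D.avgScore τ c β' ω a - D.avgScore τ c β ω a| ≤
      ((n : ℝ)⁻¹ * ∑ i, |c i|) * (2 * (C * C) * ‖β' - β‖) := by
  rw [SurvivalData.avgScore_apply, SurvivalData.avgScore_apply, ← mul_sub, ← Finset.sum_sub_distrib,
    abs_mul, abs_of_nonneg (by positivity : (0 : ℝ) ≤ (n : ℝ)⁻¹), mul_assoc, Finset.sum_mul]
  refine mul_le_mul_of_nonneg_left ((Finset.abs_sum_le_sum_abs _ _).trans
    (Finset.sum_le_sum fun i _ => ?_)) (by positivity)
  rw [← mul_sub, abs_mul]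
  exact mul_le_mul_of_nonneg_left (hC.residual_sub_abs_le hC0 hF i β β' ω a) (abs_nonneg _)

lemma inner_avgScore (c : Fin n → ℝ) (β u : Vec p) (ω : Ω) :
    inner ℝ (D.avgScore τ c β ω) u = (n : ℝ)⁻¹ * ∑ i, c i * ((D.N i τ ω : ℝ) *
      (inner ℝ (D.covAt τ ω i i) u -
        wavg (D.riskAt τ ω i) (D.covAt τ ω i) (fun j => inner ℝ (D.covAt τ ω i j) u) β)) := by
  rw [SurvivalData.avgScore, inner_linScore, Finset.mul_sum]
  exact Finset.sum_congr rfl fun i _ => by ring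

/-- Along a ray, the averaged score hardly changes beyond a distance of logarithmic order. -/
lemma abs_inner_avgScore_ray_le (hC : IsCoxModel μ D ℱ τ haz β₀ F) (hC0 : 0 ≤ C)
    (hF : ∀ x ∈ F, ‖x‖ ≤ C) (c : Fin n → ℝ) {u : Vec p} (hu : ‖u‖ = 1) (ω : Ω) {ε R s : ℝ}
    (hε : 0 ≤ ε) (hR : 0 ≤ R) (hs : R ≤ s) :
    |inner ℝ (D.avgScore τ c (β₀ + s • u) ω) u - inner ℝ (D.avgScore τ c (β₀ + R • u) ω) u| ≤
      ((n : ℝ)⁻¹ * ∑ i, |c i|) *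
        (ε + 2 * C * n * Real.exp (2 * C * ‖β₀‖) * Real.exp (-(R * ε))) := by
  rw [inner_avgScore, inner_avgScore, ← mul_sub, ← Finset.sum_sub_distrib,
    abs_mul, abs_of_nonneg (by positivity : (0 : ℝ) ≤ (n : ℝ)⁻¹), mul_assoc, Finset.sum_mul]
  refine mul_le_mul_of_nonneg_left ((Finset.abs_sum_le_sum_abs _ _).trans
    (Finset.sum_le_sum fun i _ => ?_)) (by positivity)
  rw [← mul_sub, ← mul_sub, sub_sub_sub_cancel_left, abs_mul]
  refine mul_le_mul_of_nonneg_left ((hC.N_mul_abs_le i ω _).trans ?_) (abs_nonneg _)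
  rw [abs_sub_comm]
  have := abs_wavg_radial_sub_le (hC.riskAt_eq ω i) hC0 (hC.covAt_norm_le hF ω i) β₀ u hu hε hR hs
  rwa [Fintype.card_fin] at this

end IsCoxModel

variable {D : (n : ℕ) → SurvivalData Ω n p} {ℱ : ℕ → Filtration ℝ≥0 mΩ} {ν : Measure ℝ}
    [IsProbabilityMeasure ν] {G : (n : ℕ) → Fin n → Ω → ℝ}

lemma eventually_average_abs_le (hC : ∀ n, IsCoxModel μ (D n) (ℱ n) τ haz β₀ F)
    (hG : ∀ n, IsMultiplier ((D n).obs τ) μ ν (G n)) {φ : ℝ → ℝ} (hφ : Measurable φ)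
    (hi : Integrable φ ν) :
    ∀ᶠ q in probFilter μ, (q.1 : ℝ)⁻¹ * ∑ i, |φ (G q.1 i q.2)| ≤ (∫ x, |φ x| ∂ν) + 1 := by
  have h := tendsto_multiplier_average (m := fun n => (D n).obs τ) (fun n => (hC n).obs_le) hG
    (φ := fun x => |φ x| - ∫ y, |φ y| ∂ν) (hφ.abs.sub_const _)
    (hi.abs.sub (integrable_const _)) (by rw [integral_sub hi.abs (integrable_const _)]; simp)
    (w := fun _ _ _ => 1) (fun n i => measurable_const) (C := 1) zero_le_one (by simp)
  filter_upwards [h.eventually (gt_mem_nhds one_pos),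
    tendsto_fst_probFilter.eventually (eventually_gt_atTop 0)] with q hq hn
  have : (q.1 : ℝ) ≠ 0 := by positivity
  simp only [mul_one, Finset.sum_sub_distrib, Finset.sum_const, Finset.card_univ, Fintype.card_fin,
    nsmul_eq_mul, mul_sub, inv_mul_cancel_left₀ this] at hq
  linarith

/-- Chebyshev's inequality costs `V / (n * η ^ 2)` for each grid point and coordinate, and the union
bound multiplies this by `p` and the number of points. -/
lemma eventually_abs_avgScore_lt (hC : ∀ n, IsCoxModel μ (D n) (ℱ n) τ haz β₀ F) (hC0 : 0 ≤ C)
    (hF : ∀ x ∈ F, ‖x‖ ≤ C) (hG : ∀ n, IsMultiplier ((D n).obs τ) μ ν (G n))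
    (h0 : ∫ x, x ∂ν = 0) (h2 : MemLp id 2 ν) {T : ℕ → Finset (Vec p)}
    (hT : Tendsto (fun n => ((T n).card : ℝ) / n) atTop (𝓝 0)) {η : ℝ} (hη : 0 < η) :
    ∀ᶠ q in probFilter μ, ∀ t ∈ T q.1, ∀ a, |(D q.1).avgScore τ (fun i => G q.1 i q.2) t q.2 a| < η := by
  rw [eventually_probFilter]
  set V := (2 * C) ^ 2 * (∫ x, id x ^ 2 ∂ν) with hV
  have hlim : Tendsto (fun n : ℕ => ENNReal.ofReal (p * (V / η ^ 2) * (((T n).card : ℝ) / n)))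
      atTop (𝓝 0) := by
    have := ENNReal.tendsto_ofReal (hT.const_mul (p * (V / η ^ 2)))
    simpa using this
  have hV0 : 0 ≤ V := mul_nonneg (by positivity) (integral_nonneg fun x => sq_nonneg _)
  refine tendsto_of_tendsto_of_tendsto_of_le_of_le tendsto_const_nhds hlim (fun _ => zero_le)
    fun n => ?_
  have hone : ∀ t a, μ {ω | η ≤ |(D n).avgScore τ (fun i => G n i ω) t ω a|} ≤
      ENNReal.ofReal (V / n / η ^ 2) := by
    intro t a
    have h := (hG n).integral_sq_le (hC n).obs_le measurable_id h0 h2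
      (w := fun i ω => (D n).residual τ i t ω a) (C := 2 * C)
      (fun i => (hC n).measurable_residual_apply i measurable_const a)
      (fun i ω => (hC n).residual_abs_le hC0 hF i t ω a)
    simp only [SurvivalData.avgScore_apply]
    exact measure_le_of_integral_sq_le hη h.1 h.2
  calc _ ≤ μ (⋃ t ∈ T n, ⋃ a ∈ (Finset.univ : Finset (Fin p)),
        {ω | η ≤ |(D n).avgScore τ (fun i => G n i ω) t ω a|}) := by
        refine measure_mono fun ω hω => ?_
        simp only [Set.mem_ofPred_eq, not_forall, not_lt] at hω
        obtain ⟨t, ht, a, ha⟩ := hω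
        simp only [Set.mem_iUnion]
        exact ⟨t, ht, a, Finset.mem_univ a, ha⟩
    _ ≤ ∑ t ∈ T n, ∑ a : Fin p, ENNReal.ofReal (V / n / η ^ 2) :=
        (measure_biUnion_finset_le _ _).trans (Finset.sum_le_sum fun t _ =>
          (measure_biUnion_finset_le _ _).trans (Finset.sum_le_sum fun a _ => hone t a))
    _ = _ := by
        simp only [Finset.sum_const, Finset.card_univ, Fintype.card_fin, nsmul_eq_mul]
        rw [← ENNReal.ofReal_natCast, ← ENNReal.ofReal_natCast, ← ENNReal.ofReal_mul (by positivity),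
          ← ENNReal.ofReal_mul (by positivity)]
        congr 1
        ring

/-- The perturbation of the score by the multipliers is uniformly small in all directions. -/
lemma eventually_abs_inner_avgScore_le (hC : ∀ n, IsCoxModel μ (D n) (ℱ n) τ haz β₀ F)
    (hC0 : 0 ≤ C) (hF : ∀ x ∈ F, ‖x‖ ≤ C) (hG : ∀ n, IsMultiplier ((D n).obs τ) μ ν (G n))
    (h0 : ∫ x, x ∂ν = 0) (h2 : MemLp id 2 ν) {η : ℝ} (hη : 0 < η) :
    ∀ᶠ q in probFilter μ, ∀ u : Vec p, ‖u‖ = 1 → ∀ s : ℝ, 0 ≤ s →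
      |inner ℝ ((D q.1).avgScore τ (fun i => G q.1 i q.2) (β₀ + s • u) q.2) u| ≤ η := by
  set A := (∫ x, |id x| ∂ν) + 1 with hA
  have hA0 : 0 < A := by
    have : 0 ≤ ∫ x, |id x| ∂ν := integral_nonneg fun x => abs_nonneg _
    linarith
  -- The budget is `η / 2` for the tail of a ray, `η / 4` for the grid values and `η / 4` for the
  -- distance to the grid. `A` bounds the average of the absolute multipliers.
  obtain ⟨ε, hε⟩ : ∃ ε, ε = η / (4 * A) := ⟨_, rfl⟩
  obtain ⟨η', hη'⟩ : ∃ η', η' = η / (4 * (p + 1)) := ⟨_, rfl⟩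
  obtain ⟨δ, hδ⟩ : ∃ δ, δ = η / (4 * (p * (A * (2 * (C * C) * p)) + 1)) := ⟨_, rfl⟩
  have hε0 : 0 < ε := by rw [hε]; positivity
  have hη'0 : 0 < η' := by rw [hη']; positivity
  have hδ0 : 0 < δ := by rw [hδ]; positivity
  -- With this radius `exp (-(R n * ε)) = n⁻¹ * n⁻¹`, which beats the factor `n` from the number of
  -- individuals in the tail bound.
  set R : ℕ → ℝ := fun n => 2 * Real.log n / ε with hR
  set M : ℕ → ℕ := fun n => ⌈R n / δ⌉₊ with hM
  choose T hTc hTm using fun n => exists_grid β₀ hδ0 (M n)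
  have hTlim : Tendsto (fun n => ((T n).card : ℝ) / n) atTop (𝓝 0) := by
    refine squeeze_zero' (Eventually.of_forall fun n => by positivity) ?_
      (tendsto_pow_log_div p (4 / (ε * δ)) 3)
    filter_upwards [eventually_ge_atTop 1] with n hn
    refine div_le_div_of_nonneg_right ?_ (Nat.cast_nonneg n)
    have h1 : ((T n).card : ℝ) ≤ (2 * M n + 1) ^ p := by exact_mod_cast hTc n
    refine h1.trans (pow_le_pow_left₀ (by positivity) ?_ p)
    have hlog : 0 ≤ Real.log n := Real.log_nonneg (by exact_mod_cast hn)
    have h2 : (M n : ℝ) ≤ R n / δ + 1 := (Nat.ceil_lt_add_one (by positivity)).le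
    have h3 : 4 / (ε * δ) * Real.log n = 2 * (R n / δ) := by
      simp only [hR]
      field_simp
      ring
    linarith
  have hexp : ∀ᶠ n : ℕ in atTop, 2 * C * n * Real.exp (2 * C * ‖β₀‖) * Real.exp (-(R n * ε)) ≤ ε := by
    have h1 : Tendsto (fun n : ℕ => 2 * C * Real.exp (2 * C * ‖β₀‖) * (n : ℝ)⁻¹) atTop (𝓝 0) := by
      simpa using (tendsto_inv_atTop_nhds_zero_nat (𝕜 := ℝ)).const_mul
        (2 * C * Real.exp (2 * C * ‖β₀‖))
    filter_upwards [h1.eventually (gt_mem_nhds hε0), eventually_gt_atTop 0] with n hn hpos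
    refine le_trans (le_of_eq ?_) hn.le
    have hn0 : (0 : ℝ) < n := by exact_mod_cast hpos
    have h3 : Real.exp (-(R n * ε)) = (n : ℝ)⁻¹ * (n : ℝ)⁻¹ := by
      have : -(R n * ε) = -Real.log n + -Real.log n := by
        simp only [hR]
        field_simp
        ring
      rw [this, Real.exp_add, Real.exp_neg, Real.exp_log hn0]
    rw [h3]
    field_simp
  filter_upwards [eventually_abs_avgScore_lt hC hC0 hF hG h0 h2 hTlim hη'0,
    eventually_average_abs_le hC hG measurable_id (h2.integrable one_le_two),
    tendsto_fst_probFilter.eventually hexp,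
    tendsto_fst_probFilter.eventually (eventually_ge_atTop 1)] with q hgrid habs hq hn u hu
  obtain ⟨n, ω⟩ := q
  simp only [id] at hgrid habs hq hn ⊢
  have hlog : 0 ≤ Real.log n := Real.log_nonneg (by exact_mod_cast hn)
  have hR0 : 0 ≤ R n := by positivity
  have hS0 : 0 ≤ (n : ℝ)⁻¹ * ∑ i, |G n i ω| := by positivity
  have hin : ∀ s, 0 ≤ s → s ≤ R n →
      |inner ℝ ((D n).avgScore τ (fun i => G n i ω) (β₀ + s • u) ω) u| ≤ η / 2 := by
    intro s hs hsR
    obtain ⟨t, ht, htd⟩ := hTm n (β₀ + s • u) (by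
      rw [add_sub_cancel_left, norm_smul, hu, mul_one, Real.norm_of_nonneg hs]
      refine hsR.trans ?_
      rw [mul_comm, ← div_le_iff₀ hδ0]
      exact Nat.le_ceil _)
    refine (abs_real_inner_le_norm _ _).trans ?_
    rw [hu, mul_one]
    refine (norm_le_sum_abs _).trans ?_
    have hcoord : ∀ a, |(D n).avgScore τ (fun i => G n i ω) (β₀ + s • u) ω a| ≤
        η' + A * (2 * (C * C) * (p * δ)) := by
      intro a
      have h4 := (hC n).abs_avgScore_sub_le hC0 hF (fun i => G n i ω) t (β₀ + s • u) ω a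
      have h5 : ((n : ℝ)⁻¹ * ∑ i, |G n i ω|) * (2 * (C * C) * ‖β₀ + s • u - t‖) ≤
          A * (2 * (C * C) * (p * δ)) :=
        mul_le_mul habs (mul_le_mul_of_nonneg_left htd (by positivity)) (by positivity) hA0.le
      have h6 := (hgrid t ht a).le
      calc _ ≤ |(D n).avgScore τ (fun i => G n i ω) t ω a| +
            |(D n).avgScore τ (fun i => G n i ω) (β₀ + s • u) ω a -
              (D n).avgScore τ (fun i => G n i ω) t ω a| := by
            have := abs_add_le ((D n).avgScore τ (fun i => G n i ω) t ω a)
              ((D n).avgScore τ (fun i => G n i ω) (β₀ + s • u) ω a -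
              (D n).avgScore τ (fun i => G n i ω) t ω a)
            rwa [add_sub_cancel] at this
        _ ≤ _ := add_le_add h6 (h4.trans h5)
    refine (Finset.sum_le_sum fun a _ => hcoord a).trans ?_
    rw [Finset.sum_const, Finset.card_univ, Fintype.card_fin, nsmul_eq_mul, mul_add]
    have h7 : (p : ℝ) * η' ≤ η / 4 := by
      rw [hη', ← mul_div_assoc, div_le_div_iff₀ (by positivity) (by positivity)]
      nlinarith
    have h8 : (p : ℝ) * (A * (2 * (C * C) * (p * δ))) ≤ η / 4 := by
      have e : (p : ℝ) * (A * (2 * (C * C) * (p * δ))) = (p * (A * (2 * (C * C) * p))) * δ := by ring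
      have h9 : 0 ≤ (p : ℝ) * (A * (2 * (C * C) * p)) := by positivity
      rw [e, hδ, ← mul_div_assoc, div_le_div_iff₀ (by positivity) (by positivity)]
      nlinarith
    linarith
  intro s hs
  rcases le_total s (R n) with h | h
  · exact (hin s hs h).trans (by linarith)
  -- Beyond radius `R n` the value is compared with the one at `R n` on the same ray; the difference
  -- is at most `A * (ε + ε) = η / 2`.
  · have h4 := (hC n).abs_inner_avgScore_ray_le hC0 hF (fun i => G n i ω) hu ω hε0.le hR0 h
    have h5 := hin (R n) hR0 le_rfl
    have h6 : ((n : ℝ)⁻¹ * ∑ i, |G n i ω|) *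
        (ε + 2 * C * n * Real.exp (2 * C * ‖β₀‖) * Real.exp (-(R n * ε))) ≤ A * (ε + ε) :=
      mul_le_mul habs (by linarith) (by positivity) hA0.le
    have h7 : A * (ε + ε) = η / 2 := by
      rw [hε]
      field_simp
      ring
    have h8 := abs_add_le (inner ℝ ((D n).avgScore τ (fun i => G n i ω) (β₀ + R n • u) ω) u)
      (inner ℝ ((D n).avgScore τ (fun i => G n i ω) (β₀ + s • u) ω) u -
        inner ℝ ((D n).avgScore τ (fun i => G n i ω) (β₀ + R n • u) ω) u)
    rw [add_sub_cancel] at h8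
    linarith

end Multipliers

/-! ### Positive definiteness and location of zeros -/

section Zeros

variable {p : ℕ}

/-- The bound is the minimum of the quadratic form on the compact unit sphere. In dimension zero the
sphere is empty and any constant will do. -/
lemma exists_pos_le_quadratic {S : Matrix (Fin p) (Fin p) ℝ} (hS : S.PosDef) :
    ∃ lam : ℝ, 0 < lam ∧ ∀ u : Vec p, ‖u‖ = 1 → lam ≤ ∑ a, ∑ c, u a * u c * S a c := by
  by_cases hne : (Metric.sphere (0 : Vec p) 1).Nonempty
  · have hcont : Continuous fun u : Vec p => ∑ a, ∑ c, u a * u c * S a c := by fun_prop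
    obtain ⟨v, hv, hmin⟩ := (isCompact_sphere (0 : Vec p) 1).exists_isMinOn hne hcont.continuousOn
    refine ⟨_, ?_, fun u hu => hmin (mem_sphere_zero_iff_norm.2 hu)⟩
    have hv0 : WithLp.ofLp v ≠ 0 := by
      intro h
      have : v = 0 := by ext a; exact congrFun h a
      rw [mem_sphere_zero_iff_norm, this, norm_zero] at hv
      exact zero_ne_one hv
    have := hS.dotProduct_mulVec_pos hv0
    simp only [dotProduct, Matrix.mulVec, star_trivial, Finset.mul_sum] at this
    refine this.trans_eq (Finset.sum_congr rfl fun a _ => Finset.sum_congr rfl fun c _ => by ring)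
  · exact ⟨1, one_pos, fun u hu => absurd ⟨u, mem_sphere_zero_iff_norm.2 hu⟩ hne⟩

/-- A gradient field that points inwards outside a ball has a zero, and all zeros lie in the
ball. -/
lemma exists_zero_and_norm_lt {f : Vec p → ℝ} {S : Vec p → Vec p}
    (hf : ∀ β, HasFDerivAt f (innerSL ℝ (S β)) β) (β₀ : Vec p) {r : ℝ} (hr : 0 < r)
    (h : ∀ u : Vec p, ‖u‖ = 1 → ∀ s, r ≤ s → inner ℝ (S (β₀ + s • u)) u < 0) :
    (∃ β, S β = 0) ∧ ∀ β, S β = 0 → ‖β - β₀‖ < r := by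
  have key : ∀ β, r ≤ ‖β - β₀‖ → inner ℝ (S β) (β - β₀) < 0 := by
    intro β hβ
    have hpos : 0 < ‖β - β₀‖ := hr.trans_le hβ
    have h1 := h (‖β - β₀‖⁻¹ • (β - β₀)) (by rw [norm_smul, norm_inv, norm_norm, inv_mul_cancel₀ hpos.ne'])
      ‖β - β₀‖ hβ
    rw [smul_smul, mul_inv_cancel₀ hpos.ne', one_smul, add_sub_cancel, inner_smul_right] at h1
    exact (pos_iff_neg_of_mul_neg h1).1 (inv_pos.2 hpos)
  constructor
  · obtain ⟨β, -, hβ⟩ := exists_zero_of_inner_neg hf β₀ hr fun β hβ => key β hβ.ge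
    exact ⟨β, hβ⟩
  · intro β hβ
    by_contra hcon
    have := key β (not_lt.1 hcon)
    rw [hβ, inner_zero_left] at this
    exact lt_irrefl _ this

end Zeros

/-! ### Consistency of the solutions of the score equations -/

section Consistency

variable {Ω : Type*} [mΩ : MeasurableSpace Ω] {μ : Measure Ω} [IsProbabilityMeasure μ] {p : ℕ}
    {τ : ℝ≥0} {haz : ℝ≥0 → ℝ} {β₀ : Vec p} {F : Set (Vec p)} {C : ℝ}
    {D : (n : ℕ) → SurvivalData Ω n p} {ℱ : ℕ → Filtration ℝ≥0 mΩ}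
    {B : Set (Vec p)} {s0 : ℝ≥0 → Vec p → ℝ} {s1 : ℝ≥0 → Vec p → Vec p}
    {s2 : ℝ≥0 → Vec p → Matrix (Fin p) (Fin p) ℝ} {ν : Measure ℝ} [IsProbabilityMeasure ν]
    {G : (n : ℕ) → Fin n → Ω → ℝ}

lemma eventually_le_average_wcov (hC : ∀ n, IsCoxModel μ (D n) (ℱ n) τ haz β₀ F) (hC0 : 0 ≤ C)
    (hF : ∀ x ∈ F, ‖x‖ ≤ C) (hz : Measurable haz) (hz0 : ∀ t, 0 ≤ haz t)
    (hzi : IntervalIntegrable (fun s : ℝ => haz s.toNNReal) volume 0 τ)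
    (hReg : RegularityConditions μ D τ haz β₀ B s0 s1 s2) :
    ∃ lam : ℝ, 0 < lam ∧ ∀ᶠ q in probFilter μ, ∀ u : Vec p, ‖u‖ = 1 →
      lam ≤ ∑ i, ((q.1 : ℝ)⁻¹ * (1 * ((D q.1).N i τ q.2 : ℝ))) * wcov ((D q.1).riskAt τ q.2 i)
        ((D q.1).covAt τ q.2 i) (fun j => inner ℝ ((D q.1).covAt τ q.2 i j) u)
        (fun j => inner ℝ ((D q.1).covAt τ q.2 i j) u) β₀ := by
  obtain ⟨lam, hlam, hmin⟩ := exists_pos_le_quadratic hReg.posDef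
  set Sg := limitSigma τ haz β₀ s0 s1 s2 with hSg
  -- On unit vectors, errors of at most `δ` in each of the `p * p` entries change the quadratic form
  -- by at most `lam / 2`.
  set δ := lam / 2 / (p * p + 1) with hδ
  have hδ0 : 0 < δ := by positivity
  refine ⟨lam / 2, by positivity, ?_⟩
  have hev : ∀ᶠ q in probFilter μ, ∀ a c,
      dist ((D q.1).avgCov τ (fun _ => 1) β₀ q.2 a c) (Sg a c) < δ := by
    rw [eventually_all]
    intro a
    rw [eventually_all]
    intro c
    exact Metric.tendsto_nhds.1 (tendsto_avgCov_one hC hC0 hF hz hz0 hzi hReg a c) δ hδ0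
  filter_upwards [hev] with q hq u hu
  have e : ∑ i, ((q.1 : ℝ)⁻¹ * (1 * ((D q.1).N i τ q.2 : ℝ))) * wcov ((D q.1).riskAt τ q.2 i)
        ((D q.1).covAt τ q.2 i) (fun j => inner ℝ ((D q.1).covAt τ q.2 i j) u)
        (fun j => inner ℝ ((D q.1).covAt τ q.2 i j) u) β₀ =
      ∑ a, ∑ c, u a * u c * (D q.1).avgCov τ (fun _ => 1) β₀ q.2 a c := by
    simp only [wcov_inner, SurvivalData.avgCov, Finset.mul_sum]
    rw [Finset.sum_comm]
    refine Finset.sum_congr rfl fun a _ => ?_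
    rw [Finset.sum_comm]
    exact Finset.sum_congr rfl fun c _ => Finset.sum_congr rfl fun i _ => by ring
  rw [e]
  have h1 : ∑ a, ∑ c, (u a * u c * Sg a c - δ) ≤
      ∑ a, ∑ c, u a * u c * (D q.1).avgCov τ (fun _ => 1) β₀ q.2 a c := by
    refine Finset.sum_le_sum fun a _ => Finset.sum_le_sum fun c _ => ?_
    have h2 := hq a c
    rw [Real.dist_eq] at h2
    have h3 : |u a * u c * ((D q.1).avgCov τ (fun _ => 1) β₀ q.2 a c - Sg a c)| ≤ δ := by
      rw [abs_mul]
      refine (mul_le_of_le_one_left (abs_nonneg _) ?_).trans h2.le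
      rw [abs_mul]
      exact mul_le_one₀ ((abs_coord_le u a).trans hu.le) (abs_nonneg _)
        ((abs_coord_le u c).trans hu.le)
    have := (abs_le.1 h3).1
    rw [mul_sub] at this
    linarith
  have h4 : ∑ a, ∑ c, (u a * u c * Sg a c - δ) = (∑ a, ∑ c, u a * u c * Sg a c) - p * p * δ := by
    simp [Finset.sum_sub_distrib, mul_assoc]
  have h5 : (p : ℝ) * p * δ ≤ lam / 2 := by
    rw [hδ, ← mul_div_assoc, div_le_iff₀ (by positivity)]
    nlinarith
  have := hmin u hu
  linarith

/-- The averaged score points inwards, uniformly outside any ball around the true parameter. -/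
lemma eventually_inner_avgScore_le (hC : ∀ n, IsCoxModel μ (D n) (ℱ n) τ haz β₀ F) (hC0 : 0 ≤ C)
    (hF : ∀ x ∈ F, ‖x‖ ≤ C) (hz : Measurable haz) (hz0 : ∀ t, 0 ≤ haz t)
    (hzi : IntervalIntegrable (fun s : ℝ => haz s.toNNReal) volume 0 τ)
    (hReg : RegularityConditions μ D τ haz β₀ B s0 s1 s2) {r : ℝ} (hr : 0 < r) :
    ∃ η : ℝ, 0 < η ∧ ∀ᶠ q in probFilter μ, ∀ u : Vec p, ‖u‖ = 1 → ∀ s, r ≤ s →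
      inner ℝ ((D q.1).avgScore τ (fun _ => 1) (β₀ + s • u) q.2) u ≤ -η := by
  obtain ⟨lam, hlam, hev⟩ := eventually_le_average_wcov hC hC0 hF hz hz0 hzi hReg
  -- The radius is shrunk until the variances cannot lose more than `lam / 2` over it; being inward
  -- beyond `r'` implies the same beyond `r`.
  set r' := min r (lam / 2 / (6 * C ^ 3 + 1)) with hr'
  have hr'0 : 0 < r' := lt_min hr (by positivity)
  have hr'1 : 6 * C ^ 3 * r' ≤ lam / 2 := by
    calc 6 * C ^ 3 * r' ≤ 6 * C ^ 3 * (lam / 2 / (6 * C ^ 3 + 1)) :=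
          mul_le_mul_of_nonneg_left (min_le_right _ _) (by positivity)
      _ ≤ lam / 2 := by
        have h3 : 0 ≤ 6 * C ^ 3 := by positivity
        rw [← mul_div_assoc, div_le_iff₀ (by positivity)]
        nlinarith
  -- The inward drift gained up to `r'` is `r' * (lam / 2)`; half of it absorbs the score at the
  -- true parameter.
  refine ⟨r' * (lam / 4), by positivity, ?_⟩
  set δ := r' * (lam / 4) / (p + 1) with hδ
  have hδ0 : 0 < δ := by positivity
  have hsc : ∀ᶠ q in probFilter μ, ∀ a, dist ((D q.1).avgScore τ (fun _ => 1) β₀ q.2 a) 0 < δ := by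
    rw [eventually_all]
    exact fun a => Metric.tendsto_nhds.1 (tendsto_avgScore_one hC hC0 hF hz hz0 hzi a) δ hδ0
  filter_upwards [hev, hsc] with q hq hs u hu s hrs
  have hδ' : inner ℝ ((D q.1).avgScore τ (fun _ => 1) β₀ q.2) u ≤ r' * (lam / 4) := by
    refine (real_inner_le_norm _ _).trans ?_
    rw [hu, mul_one]
    refine (norm_le_sum_abs _).trans ((Finset.sum_le_sum (g := fun _ => δ) fun a _ => ?_).trans ?_)
    · simpa [Real.dist_eq] using (hs a).le
    · rw [Finset.sum_const, Finset.card_univ, Fintype.card_fin, nsmul_eq_mul, hδ, ← mul_div_assoc,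
        div_le_iff₀ (by positivity)]
      have : 0 < r' * (lam / 4) := by positivity
      nlinarith
  have ha1 : ∑ i, (q.1 : ℝ)⁻¹ * (1 * ((D q.1).N i τ q.2 : ℝ)) ≤ 1 := by
    rw [← Finset.mul_sum]
    have h1 : ∑ i, 1 * ((D q.1).N i τ q.2 : ℝ) ≤ q.1 := by
      refine (Finset.sum_le_sum (g := fun _ => (1 : ℝ)) fun i _ => ?_).trans (by simp)
      rw [one_mul]
      exact (le_abs_self _).trans ((hC q.1).N_abs_le i q.2)
    rcases Nat.eq_zero_or_pos q.1 with h0 | hpos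
    · rw [h0]; simp
    · rw [inv_mul_le_iff₀ (by positivity), mul_one]
      exact h1
  have := inner_linScore_le (w := (D q.1).riskAt τ q.2) (x := (D q.1).covAt τ q.2)
    (z := fun i => (D q.1).covAt τ q.2 i i) (a := fun i => (q.1 : ℝ)⁻¹ * (1 * (D q.1).N i τ q.2))
    ((hC q.1).riskAt_nonneg q.2) hC0 ((hC q.1).covAt_norm_le hF q.2) (fun i => by positivity) ha1
    hu (hq u hu) hδ' hr'0.le hr'1 ((min_le_left _ _).trans hrs)
  refine this.trans (le_of_eq ?_)
  ring

lemma IsCoxModel.avgScore_zeros {n : ℕ} {D : SurvivalData Ω n p} {ℱ : Filtration ℝ≥0 mΩ}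
    (hC : IsCoxModel μ D ℱ τ haz β₀ F) (c : Fin n → ℝ) (ω : Ω) {r : ℝ} (hr : 0 < r)
    (h : ∀ u : Vec p, ‖u‖ = 1 → ∀ s, r ≤ s → inner ℝ (D.avgScore τ c (β₀ + s • u) ω) u < 0) :
    (∃ β, D.avgScore τ c β ω = 0) ∧ ∀ β, D.avgScore τ c β ω = 0 → ‖β - β₀‖ < r := by
  obtain ⟨f, hf⟩ := exists_potential (w := D.riskAt τ ω) (x := D.covAt τ ω) (hC.riskAt_nonneg ω)
    (fun i => D.covAt τ ω i i) (fun i => (n : ℝ)⁻¹ * (c i * D.N i τ ω))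
  exact exists_zero_and_norm_lt hf β₀ hr h

lemma eventually_score_zeros (hC : ∀ n, IsCoxModel μ (D n) (ℱ n) τ haz β₀ F) (hC0 : 0 ≤ C)
    (hF : ∀ x ∈ F, ‖x‖ ≤ C) (hz : Measurable haz) (hz0 : ∀ t, 0 ≤ haz t)
    (hzi : IntervalIntegrable (fun s : ℝ => haz s.toNNReal) volume 0 τ)
    (hReg : RegularityConditions μ D τ haz β₀ B s0 s1 s2) {r : ℝ} (hr : 0 < r) :
    ∀ᶠ q in probFilter μ, (∃ β, (D q.1).score τ β q.2 = 0) ∧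
      ∀ β, (D q.1).score τ β q.2 = 0 → ‖β - β₀‖ < r := by
  obtain ⟨η, hη, hev⟩ := eventually_inner_avgScore_le hC hC0 hF hz hz0 hzi hReg hr
  filter_upwards [hev, tendsto_fst_probFilter.eventually (eventually_gt_atTop 0)] with q hq hn
  obtain ⟨⟨β, hβ⟩, hz⟩ := (hC q.1).avgScore_zeros _ q.2 hr fun u hu s hs =>
    (hq u hu s hs).trans_lt (neg_lt_zero.2 hη)
  have hn' : (q.1 : ℝ) ≠ 0 := by positivity
  simp only [(hC q.1).score_eq, smul_eq_zero, hn', false_or]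
  exact ⟨⟨β, hβ⟩, hz⟩

/-- The inward component of the score is at least `η`, and the perturbation takes away at most `η /
2` at any distance. The potential exists for weights of any sign, so no concavity of the resampled
problem is used. -/
lemma eventually_bootScore_zeros (hC : ∀ n, IsCoxModel μ (D n) (ℱ n) τ haz β₀ F) (hC0 : 0 ≤ C)
    (hF : ∀ x ∈ F, ‖x‖ ≤ C) (hz : Measurable haz) (hz0 : ∀ t, 0 ≤ haz t)
    (hzi : IntervalIntegrable (fun s : ℝ => haz s.toNNReal) volume 0 τ)
    (hReg : RegularityConditions μ D τ haz β₀ B s0 s1 s2)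
    (hG : ∀ n, IsMultiplier ((D n).obs τ) μ ν (G n))
    (h0 : ∫ x, x ∂ν = 0) (h2 : MemLp id 2 ν) {r : ℝ} (hr : 0 < r) :
    ∀ᶠ q in probFilter μ, (∃ β, (D q.1).bootScore τ (G q.1) β q.2 = 0) ∧
      ∀ β, (D q.1).bootScore τ (G q.1) β q.2 = 0 → ‖β - β₀‖ < r := by
  obtain ⟨η, hη, hev⟩ := eventually_inner_avgScore_le hC hC0 hF hz hz0 hzi hReg hr
  filter_upwards [hev, eventually_abs_inner_avgScore_le hC hC0 hF hG h0 h2 (half_pos hη),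
    tendsto_fst_probFilter.eventually (eventually_gt_atTop 0)] with q hq hq' hn
  obtain ⟨⟨β, hβ⟩, hz⟩ := (hC q.1).avgScore_zeros (fun i => G q.1 i q.2 + 1) q.2 hr fun u hu s hs => by
    rw [SurvivalData.avgScore_add, inner_add_left]
    have h1 := hq u hu s hs
    have h2 := (abs_le.1 (hq' u hu s (hr.le.trans hs))).2
    linarith
  have hn' : (q.1 : ℝ) ≠ 0 := by positivity
  simp only [(hC q.1).bootScore_eq, smul_eq_zero, hn', false_or]
  exact ⟨⟨β, hβ⟩, hz⟩

/-- The maximum partial likelihood estimator is consistent, and solves the score equation. -/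
lemma estimator_consistent (hC : ∀ n, IsCoxModel μ (D n) (ℱ n) τ haz β₀ F) (hC0 : 0 ≤ C)
    (hF : ∀ x ∈ F, ‖x‖ ≤ C) (hz : Measurable haz) (hz0 : ∀ t, 0 ≤ haz t)
    (hzi : IntervalIntegrable (fun s : ℝ => haz s.toNNReal) volume 0 τ)
    (hReg : RegularityConditions μ D τ haz β₀ B s0 s1 s2) {βhat : ℕ → Ω → Vec p}
    (hβ : ∀ n, ∀ᵐ ω ∂μ, (∃ β, (D n).score τ β ω = 0) → (D n).score τ (βhat n ω) ω = 0) :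
    Tendsto (fun q : ℕ × Ω => βhat q.1 q.2) (probFilter μ) (𝓝 β₀) ∧
      ∀ᶠ q in probFilter μ, (D q.1).score τ (βhat q.1 q.2) q.2 = 0 := by
  have hβ' := eventually_probFilter_of_ae hβ
  constructor
  · rw [Metric.tendsto_nhds]
    intro ε hε
    filter_upwards [hβ', eventually_score_zeros hC hC0 hF hz hz0 hzi hReg hε] with q h1 h2
    rw [dist_eq_norm]
    exact h2.2 _ (h1 h2.1)
  · filter_upwards [hβ', eventually_score_zeros hC hC0 hF hz hz0 hzi hReg one_pos] with q h1 h2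
    exact h1 h2.1

/-- Solutions of the resampled score equation are consistent. -/
lemma boot_consistent (hC : ∀ n, IsCoxModel μ (D n) (ℱ n) τ haz β₀ F) (hC0 : 0 ≤ C)
    (hF : ∀ x ∈ F, ‖x‖ ≤ C) (hz : Measurable haz) (hz0 : ∀ t, 0 ≤ haz t)
    (hzi : IntervalIntegrable (fun s : ℝ => haz s.toNNReal) volume 0 τ)
    (hReg : RegularityConditions μ D τ haz β₀ B s0 s1 s2)
    (hG : ∀ n, IsMultiplier ((D n).obs τ) μ ν (G n))
    (h0 : ∫ x, x ∂ν = 0) (h2 : MemLp id 2 ν) {βstar : ℕ → Ω → Vec p}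
    (hβ : ∀ n, ∀ᵐ ω ∂μ, (∃ β, (D n).bootScore τ (G n) β ω = 0) →
      (D n).bootScore τ (G n) (βstar n ω) ω = 0) :
    Tendsto (fun q : ℕ × Ω => βstar q.1 q.2) (probFilter μ) (𝓝 β₀) := by
  rw [Metric.tendsto_nhds]
  intro ε hε
  filter_upwards [eventually_probFilter_of_ae hβ,
    eventually_bootScore_zeros hC hC0 hF hz hz0 hzi hReg hG h0 h2 hε] with q h1 h2
  rw [dist_eq_norm]
  exact h2.2 _ (h1 h2.1)

end Consistency

/-! ### Limits of the resampled score, information and estimator -/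

section ResampledLimits

variable {Ω : Type*} [mΩ : MeasurableSpace Ω] {μ : Measure Ω} [IsProbabilityMeasure μ] {p : ℕ}
    {τ : ℝ≥0} {haz : ℝ≥0 → ℝ} {β₀ : Vec p} {F : Set (Vec p)} {C : ℝ}
    {D : (n : ℕ) → SurvivalData Ω n p} {ℱ : ℕ → Filtration ℝ≥0 mΩ}
    {B : Set (Vec p)} {s0 : ℝ≥0 → Vec p → ℝ} {s1 : ℝ≥0 → Vec p → Vec p}
    {s2 : ℝ≥0 → Vec p → Matrix (Fin p) (Fin p) ℝ} {ν : Measure ℝ} [IsProbabilityMeasure ν]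
    {G : (n : ℕ) → Fin n → Ω → ℝ}

lemma IsCoxModel.abs_avgCov_sub_le {n : ℕ} {D : SurvivalData Ω n p} {ℱ : Filtration ℝ≥0 mΩ}
    (hC : IsCoxModel μ D ℱ τ haz β₀ F) (hC0 : 0 ≤ C) (hF : ∀ x ∈ F, ‖x‖ ≤ C) (c : Fin n → ℝ)
    (β β' : Vec p) (ω : Ω) (a d : Fin p) :
    |D.avgCov τ c β' ω a d - D.avgCov τ c β ω a d| ≤
      ((n : ℝ)⁻¹ * ∑ i, |c i|) * (6 * (C ^ 2 * C) * ‖β' - β‖) := by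
  unfold SurvivalData.avgCov
  rw [← mul_sub, ← Finset.sum_sub_distrib, abs_mul,
    abs_of_nonneg (by positivity : (0 : ℝ) ≤ (n : ℝ)⁻¹), mul_assoc, Finset.sum_mul]
  refine mul_le_mul_of_nonneg_left ((Finset.abs_sum_le_sum_abs _ _).trans
    (Finset.sum_le_sum fun i _ => ?_)) (by positivity)
  rw [← mul_sub, ← mul_sub, abs_mul]
  exact mul_le_mul_of_nonneg_left ((hC.N_mul_abs_le i ω _).trans (abs_wcov_sub_le
    (hC.riskAt_nonneg ω i) hC0 hC0 (fun j => hC.covAt_abs_le hF ω i j a)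
    (fun j => hC.covAt_abs_le hF ω i j d) (hC.covAt_norm_le hF ω i) β β')) (abs_nonneg _)

lemma tendsto_norm_sub_zero {β : ℕ → Ω → Vec p}
    (hβ : Tendsto (fun q : ℕ × Ω => β q.1 q.2) (probFilter μ) (𝓝 β₀)) (c : ℝ) :
    Tendsto (fun q : ℕ × Ω => c * ‖β q.1 q.2 - β₀‖) (probFilter μ) (𝓝 0) := by
  have h := (tendsto_iff_norm_sub_tendsto_zero.1 hβ).const_mul c
  rwa [mul_zero] at h

/-- The averaged derivative of the resampled score tends to the information matrix. -/
lemma tendsto_avgCov_boot (hC : ∀ n, IsCoxModel μ (D n) (ℱ n) τ haz β₀ F) (hC0 : 0 ≤ C)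
    (hF : ∀ x ∈ F, ‖x‖ ≤ C) (hz : Measurable haz) (hz0 : ∀ t, 0 ≤ haz t)
    (hzi : IntervalIntegrable (fun s : ℝ => haz s.toNNReal) volume 0 τ)
    (hReg : RegularityConditions μ D τ haz β₀ B s0 s1 s2)
    (hG : ∀ n, IsMultiplier ((D n).obs τ) μ ν (G n))
    (h0 : ∫ x, x ∂ν = 0) (h2 : MemLp id 2 ν) {β : ℕ → Ω → Vec p}
    (hβ : Tendsto (fun q : ℕ × Ω => β q.1 q.2) (probFilter μ) (𝓝 β₀)) (a c : Fin p) :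
    Tendsto (fun q : ℕ × Ω => (D q.1).avgCov τ (fun i => G q.1 i q.2 + 1) (β q.1 q.2) q.2 a c)
      (probFilter μ) (𝓝 (limitSigma τ haz β₀ s0 s1 s2 a c)) := by
  have hid : Integrable (fun x : ℝ => x) ν := h2.integrable one_le_two
  have h1 : Tendsto (fun q : ℕ × Ω => (D q.1).avgCov τ (fun i => G q.1 i q.2) β₀ q.2 a c)
      (probFilter μ) (𝓝 0) :=
    tendsto_multiplier_average (m := fun n => (D n).obs τ) (fun n => (hC n).obs_le) hG
      (φ := fun x => x) measurable_id hid h0 (w := fun n i ω => ((D n).N i τ ω : ℝ) *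
        wcov ((D n).riskAt τ ω i) ((D n).covAt τ ω i) (fun j => (D n).covAt τ ω i j a)
          (fun j => (D n).covAt τ ω i j c) β₀)
      (fun n i => (hC n).measurable_N_mul_wcov i β₀ a c) (C := 2 * (C * C)) (by positivity)
      fun n i ω => ((hC n).N_mul_abs_le i ω _).trans (abs_wcov_le ((hC n).riskAt_nonneg ω i) hC0 hC0
        (fun j => (hC n).covAt_abs_le hF ω i j a) (fun j => (hC n).covAt_abs_le hF ω i j c))
  have h3 : Tendsto (fun q : ℕ × Ω =>
      (D q.1).avgCov τ (fun i => G q.1 i q.2 + 1) (β q.1 q.2) q.2 a c -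
      (D q.1).avgCov τ (fun i => G q.1 i q.2 + 1) β₀ q.2 a c) (probFilter μ) (𝓝 0) := by
    refine squeeze_zero_norm' ?_ (tendsto_norm_sub_zero hβ
      (((∫ x, |x + 1| ∂ν) + 1) * (6 * (C ^ 2 * C))))
    filter_upwards [eventually_average_abs_le hC hG (φ := fun x => x + 1)
      (measurable_id.add_const 1) (hid.add (integrable_const 1))] with q hq
    refine ((hC q.1).abs_avgCov_sub_le hC0 hF _ β₀ (β q.1 q.2) q.2 a c).trans ?_
    rw [mul_assoc (_ + _)]
    exact mul_le_mul_of_nonneg_right hq (by positivity)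
  have h4 := h3.add (h1.add (tendsto_avgCov_one hC hC0 hF hz hz0 hzi hReg a c))
  rw [zero_add, zero_add] at h4
  refine h4.congr fun q => ?_
  rw [← SurvivalData.avgCov_add, sub_add_cancel]

/-- Residuals are bounded and Lipschitz in the parameter, uniformly in the sample, so the true
parameter may be replaced by a consistent estimator. -/
lemma tendsto_average_residual_mul_estimator
    (hC : ∀ n, IsCoxModel μ (D n) (ℱ n) τ haz β₀ F) (hC0 : 0 ≤ C)
    (hF : ∀ x ∈ F, ‖x‖ ≤ C) (hz : Measurable haz) (hz0 : ∀ t, 0 ≤ haz t)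
    (hzi : IntervalIntegrable (fun s : ℝ => haz s.toNNReal) volume 0 τ)
    (hReg : RegularityConditions μ D τ haz β₀ B s0 s1 s2) {β : ℕ → Ω → Vec p}
    (hβ : Tendsto (fun q : ℕ × Ω => β q.1 q.2) (probFilter μ) (𝓝 β₀)) (a c : Fin p) :
    Tendsto (fun q : ℕ × Ω => (q.1 : ℝ)⁻¹ * ∑ i, (D q.1).residual τ i (β q.1 q.2) q.2 a *
      (D q.1).residual τ i (β q.1 q.2) q.2 c) (probFilter μ)
      (𝓝 (limitSigma τ haz β₀ s0 s1 s2 a c)) := by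
  have h3 : Tendsto (fun q : ℕ × Ω =>
      (q.1 : ℝ)⁻¹ * ∑ i, (D q.1).residual τ i (β q.1 q.2) q.2 a *
        (D q.1).residual τ i (β q.1 q.2) q.2 c -
      (q.1 : ℝ)⁻¹ * ∑ i, (D q.1).residual τ i β₀ q.2 a * (D q.1).residual τ i β₀ q.2 c)
      (probFilter μ) (𝓝 0) := by
    refine squeeze_zero_norm' ?_ (tendsto_norm_sub_zero hβ (2 * (2 * C * (2 * (C * C)))))
    filter_upwards [tendsto_fst_probFilter.eventually (eventually_gt_atTop 0)] with q hn
    rw [← mul_sub, ← Finset.sum_sub_distrib, Real.norm_eq_abs, abs_mul,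
      abs_of_nonneg (by positivity : (0 : ℝ) ≤ (q.1 : ℝ)⁻¹), inv_mul_le_iff₀ (by positivity)]
    refine (Finset.abs_sum_le_sum_abs _ _).trans ((Finset.sum_le_sum (g := fun _ =>
      2 * (2 * C * (2 * (C * C))) * ‖β q.1 q.2 - β₀‖) fun i _ => ?_).trans (by simp))
    have e : ∀ x y x' y' : ℝ, x * y - x' * y' = x * (y - y') + (x - x') * y' := by
      intros; ring
    rw [e]
    refine (abs_add_le _ _).trans ?_
    rw [abs_mul, abs_mul]
    have h5 := mul_le_mul ((hC q.1).residual_abs_le hC0 hF i (β q.1 q.2) q.2 a)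
      ((hC q.1).residual_sub_abs_le hC0 hF i β₀ (β q.1 q.2) q.2 c) (abs_nonneg _) (by positivity)
    have h6 := mul_le_mul ((hC q.1).residual_sub_abs_le hC0 hF i β₀ (β q.1 q.2) q.2 a)
      ((hC q.1).residual_abs_le hC0 hF i β₀ q.2 c) (abs_nonneg _) (by positivity)
    linarith
  have h4 := h3.add (tendsto_average_residual_mul hC hC0 hF hz hz0 hzi hReg a c)
  rw [zero_add] at h4
  refine h4.congr fun q => ?_
  rw [sub_add_cancel]

/-- The averaged matrix `I*` tends to the information matrix. -/
lemma tendsto_average_classicalInfo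
    (hC : ∀ n, IsCoxModel μ (D n) (ℱ n) τ haz β₀ F) (hC0 : 0 ≤ C)
    (hF : ∀ x ∈ F, ‖x‖ ≤ C) (hz : Measurable haz) (hz0 : ∀ t, 0 ≤ haz t)
    (hzi : IntervalIntegrable (fun s : ℝ => haz s.toNNReal) volume 0 τ)
    (hReg : RegularityConditions μ D τ haz β₀ B s0 s1 s2)
    (hG : ∀ n, IsMultiplier ((D n).obs τ) μ ν (G n)) (h1 : ∫ x, x ^ 2 ∂ν = 1)
    (h2 : MemLp id 2 ν) {β : ℕ → Ω → Vec p} (hβm : ∀ n, Measurable[(D n).obs τ] (β n))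
    (hβ : Tendsto (fun q : ℕ × Ω => β q.1 q.2) (probFilter μ) (𝓝 β₀)) (a c : Fin p) :
    Tendsto (fun q : ℕ × Ω => (q.1 : ℝ)⁻¹ * (D q.1).classicalInfo τ (G q.1) (β q.1 q.2) q.2 a c)
      (probFilter μ) (𝓝 (limitSigma τ haz β₀ s0 s1 s2 a c)) := by
  have hsq : Integrable (fun x : ℝ => x ^ 2) ν := h2.integrable_sq
  have h3 := tendsto_multiplier_average (m := fun n => (D n).obs τ) (fun n => (hC n).obs_le) hG
    (φ := fun x => x ^ 2 - 1) ((measurable_id.pow_const 2).sub_const 1)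
    (hsq.sub (integrable_const 1)) (by rw [integral_sub hsq (integrable_const 1), h1]; simp)
    (w := fun n i ω => (D n).residual τ i (β n ω) ω a * (D n).residual τ i (β n ω) ω c)
    (fun n i => by
      have h := ((hC n).measurable_residual_apply i (hβm n) a).mul
        ((hC n).measurable_residual_apply i (hβm n) c)
      exact h) (C := 2 * C * (2 * C)) (by positivity) (fun n i ω => by
      rw [abs_mul]
      exact mul_le_mul ((hC n).residual_abs_le hC0 hF i _ ω a)
        ((hC n).residual_abs_le hC0 hF i _ ω c) (abs_nonneg _) (by positivity))
  have h4 := h3.add (tendsto_average_residual_mul_estimator hC hC0 hF hz hz0 hzi hReg hβ a c)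
  rw [zero_add] at h4
  refine h4.congr fun q => ?_
  rw [(hC q.1).classicalInfo_apply, ← mul_add, ← Finset.sum_add_distrib]
  congr 1
  exact Finset.sum_congr rfl fun i _ => by ring

lemma condTendstoInLaw_classicalScore
    (hC : ∀ n, IsCoxModel μ (D n) (ℱ n) τ haz β₀ F) (hC0 : 0 ≤ C)
    (hF : ∀ x ∈ F, ‖x‖ ≤ C) (hz : Measurable haz) (hz0 : ∀ t, 0 ≤ haz t)
    (hzi : IntervalIntegrable (fun s : ℝ => haz s.toNNReal) volume 0 τ)
    (hReg : RegularityConditions μ D τ haz β₀ B s0 s1 s2)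
    (hG : ∀ n, IsMultiplier ((D n).obs τ) μ ν (G n)) (h0 : ∫ x, x ∂ν = 0) (h1 : ∫ x, x ^ 2 ∂ν = 1)
    {β : ℕ → Ω → Vec p} (hβm : ∀ n, Measurable[(D n).obs τ] (β n))
    (hβ : Tendsto (fun q : ℕ × Ω => β q.1 q.2) (probFilter μ) (𝓝 β₀)) :
    CondTendstoInLaw μ (fun n => (D n).obs τ)
      (fun n ω => (Real.sqrt n)⁻¹ • (D n).classicalScore τ (G n) (β n ω) ω)
      (multivariateGaussian 0 (limitSigma τ haz β₀ s0 s1 s2)) := by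
  simp only [(hC _).classicalScore_eq]
  exact condTendstoInLaw_multiplier (fun n => (hC n).obs_le) hG h0 h1 hReg.posDef.posSemidef
    (fun n i => (hC n).measurable_residual i (hβm n))
    (fun n i ω => (hC n).residual_norm_le hC0 hF i _ ω)
    (tendsto_average_residual_mul_estimator hC hC0 hF hz hz0 hzi hReg hβ)

/-- Conditional convergence in law is not affected by changes on events of vanishing
probability. -/
lemma CondTendstoInLaw.congr {E : Type*} [TopologicalSpace E] [MeasurableSpace E]
    [OpensMeasurableSpace E] {m : ℕ → MeasurableSpace Ω}
    {Z Z' : ℕ → Ω → E} {ρ : Measure E} (hZ : ∀ n, Measurable (Z n)) (hZ' : ∀ n, Measurable (Z' n))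
    (h : CondTendstoInLaw μ m Z ρ) (he : ∀ᶠ q in probFilter μ, Z' q.1 q.2 = Z q.1 q.2) :
    CondTendstoInLaw μ m Z' ρ := by
  intro f
  have h1 := h f
  rw [tendstoInMeasure_iff_probFilter] at h1 ⊢
  have hi : ∀ {Y : ℕ → Ω → E}, (∀ n, Measurable (Y n)) → ∀ n, Integrable (fun ω => f (Y n ω)) μ :=
    fun hY n => Integrable.of_bound (f.continuous.measurable.comp (hY n)).aestronglyMeasurable ‖f‖
      (Eventually.of_forall fun ω => f.norm_coe_le_norm _)
  have hd : ∀ n, Integrable (fun ω => f (Z' n ω) - f (Z n ω)) μ := fun n =>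
    (hi hZ' n).sub (hi hZ n)
  -- Conditional expectation contracts the mean, and the two integrands differ by at most `2 * ‖f‖`,
  -- only where `Z'` and `Z` differ. That event need not be measurable in this generality, hence its
  -- measurable hull.
  have hbound : ∀ n, ∫ ω, |(μ[fun ω => f (Z' n ω) - f (Z n ω) | m n]) ω| ∂μ ≤
      2 * ‖f‖ * (μ (toMeasurable μ {ω | ¬ Z' n ω = Z n ω})).toReal := by
    intro n
    refine (integral_abs_condExp_le _).trans ?_
    set S := toMeasurable μ {ω | ¬ Z' n ω = Z n ω} with hS
    have hSm : MeasurableSet S := measurableSet_toMeasurable _ _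
    refine (integral_mono (hd n).abs ((integrable_const (2 * ‖f‖)).indicator hSm)
      fun ω => ?_).trans (le_of_eq ?_)
    · by_cases hω : ω ∈ S
      · rw [Set.indicator_of_mem hω]
        refine (abs_sub _ _).trans ?_
        have := f.norm_coe_le_norm (Z' n ω)
        have := f.norm_coe_le_norm (Z n ω)
        rw [Real.norm_eq_abs] at *
        linarith
      · have : Z' n ω = Z n ω := by
          by_contra hne
          exact hω (subset_toMeasurable _ _ hne)
        simp [hω, this]
    · rw [integral_indicator_const _ hSm, smul_eq_mul, mul_comm]
      rfl
  have hlim : Tendsto (fun n => 2 * ‖f‖ *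
      (μ (toMeasurable μ {ω | ¬ Z' n ω = Z n ω})).toReal) atTop (𝓝 0) := by
    rw [eventually_probFilter] at he
    simp only [measure_toMeasurable]
    have := ((ENNReal.tendsto_toReal ENNReal.zero_ne_top).comp he).const_mul (2 * ‖f‖)
    simpa using this
  have h2 := tendsto_probFilter_of_integral_le (fun n => integrable_condExp) hbound hlim
  have h3 := h2.add h1
  rw [zero_add] at h3
  refine h3.congr' ?_
  refine eventually_probFilter_of_ae (μ := μ) (P := fun n ω =>
    (μ[fun ω => f (Z' n ω) - f (Z n ω) | m n]) ω + (μ[fun ω => f (Z n ω) | m n]) ω =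
      (μ[fun ω => f (Z' n ω) | m n]) ω) fun n => ?_
  filter_upwards [condExp_sub (hi hZ' n) (hi hZ n) (m n)] with ω hω
  have e : (μ[fun ω => f (Z' n ω) - f (Z n ω) | m n]) ω =
      (μ[fun ω => f (Z' n ω) | m n]) ω - (μ[fun ω => f (Z n ω) | m n]) ω := hω
  rw [e, sub_add_cancel]

lemma matAct_apply (A : Matrix (Fin p) (Fin p) ℝ) (v : Vec p) (a : Fin p) :
    matAct A v a = ∑ c, A a c * v c := by
  simp [matAct, Matrix.mulVec, dotProduct]

/-- The classical resampled estimator is consistent. -/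
lemma tendsto_classicalEstimator_sub
    (hC : ∀ n, IsCoxModel μ (D n) (ℱ n) τ haz β₀ F) (hC0 : 0 ≤ C)
    (hF : ∀ x ∈ F, ‖x‖ ≤ C) (hz : Measurable haz) (hz0 : ∀ t, 0 ≤ haz t)
    (hzi : IntervalIntegrable (fun s : ℝ => haz s.toNNReal) volume 0 τ)
    (hReg : RegularityConditions μ D τ haz β₀ B s0 s1 s2)
    (hG : ∀ n, IsMultiplier ((D n).obs τ) μ ν (G n)) (h0 : ∫ x, x ∂ν = 0) (h1 : ∫ x, x ^ 2 ∂ν = 1)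
    (h2 : MemLp id 2 ν) {β : ℕ → Ω → Vec p} (hβm : ∀ n, Measurable[(D n).obs τ] (β n))
    (hβ : Tendsto (fun q : ℕ × Ω => β q.1 q.2) (probFilter μ) (𝓝 β₀)) :
    Tendsto (fun q : ℕ × Ω =>
      ‖(D q.1).classicalEstimator τ (G q.1) (β q.1) q.2 - β q.1 q.2‖) (probFilter μ) (𝓝 0) := by
  set Sg := limitSigma τ haz β₀ s0 s1 s2 with hSg
  have hI : Tendsto (fun q : ℕ × Ω => (q.1 : ℝ)⁻¹ • (D q.1).classicalInfo τ (G q.1) (β q.1 q.2) q.2)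
      (probFilter μ) (𝓝 Sg) := by
    refine tendsto_pi_nhds.2 fun a => tendsto_pi_nhds.2 fun c => ?_
    exact tendsto_average_classicalInfo hC hC0 hF hz hz0 hzi hReg hG h1 h2 hβm hβ a c
  have hdet : Sg.det ≠ 0 := hReg.posDef.det_pos.ne'
  -- Inversion is continuous at `Σ`, as seen from the adjugate and the determinant. Singular
  -- samples, whose inverse is zero by convention, need no separate treatment.
  have hinv : Tendsto (fun q : ℕ × Ω =>
      ((q.1 : ℝ)⁻¹ • (D q.1).classicalInfo τ (G q.1) (β q.1 q.2) q.2)⁻¹) (probFilter μ) (𝓝 Sg⁻¹) := by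
    simp only [Matrix.inv_def, Ring.inverse_eq_inv']
    have hc1 : Continuous fun A : Matrix (Fin p) (Fin p) ℝ => A.det := continuous_id.matrix_det
    have hc2 : Continuous fun A : Matrix (Fin p) (Fin p) ℝ => A.adjugate :=
      continuous_id.matrix_adjugate
    exact (((hc1.tendsto Sg).comp hI).inv₀ hdet).smul ((hc2.tendsto Sg).comp hI)
  have hv : ∀ c, Tendsto (fun q : ℕ × Ω =>
      (D q.1).avgScore τ (fun i => G q.1 i q.2) (β q.1 q.2) q.2 c) (probFilter μ) (𝓝 0) := by
    intro c
    simp only [SurvivalData.avgScore_apply]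
    exact tendsto_multiplier_average (m := fun n => (D n).obs τ) (fun n => (hC n).obs_le) hG
      (φ := fun x => x) measurable_id (h2.integrable one_le_two) h0
      (w := fun n i ω => (D n).residual τ i (β n ω) ω c) (fun n i => (hC n).measurable_residual_apply i (hβm n) c)
      (C := 2 * C) (by positivity) fun n i ω => (hC n).residual_abs_le hC0 hF i _ ω c
  have hcoord : ∀ a, Tendsto (fun q : ℕ × Ω =>
      |((D q.1).classicalEstimator τ (G q.1) (β q.1) q.2 - β q.1 q.2) a|) (probFilter μ) (𝓝 0) := by
    intro a
    have h3 : Tendsto (fun q : ℕ × Ω => ∑ c,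
        ((q.1 : ℝ)⁻¹ • (D q.1).classicalInfo τ (G q.1) (β q.1 q.2) q.2)⁻¹ a c *
        (D q.1).avgScore τ (fun i => G q.1 i q.2) (β q.1 q.2) q.2 c) (probFilter μ)
        (𝓝 (∑ c, Sg⁻¹ a c * 0)) :=
      tendsto_finsetSum _ fun c _ =>
        (((continuous_id.matrix_elem a c).tendsto Sg⁻¹).comp hinv).mul (hv c)
    simp only [mul_zero, Finset.sum_const_zero] at h3
    have h4 := h3.abs
    rw [abs_zero] at h4
    refine h4.congr fun q => ?_
    congr 1
    -- The two factors `n ^ (-1/2)` combine to `n⁻¹`, so the law of large numbers for the resampled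
    -- score suffices and no rate is needed.
    rw [← matAct_apply, SurvivalData.classicalEstimator, add_sub_cancel_left, map_smul, smul_smul,
      ← mul_inv, Real.mul_self_sqrt (Nat.cast_nonneg _), ← map_smul, (hC q.1).classicalScore_eq,
      SurvivalData.avgScore_eq]
  have hsum := tendsto_finsetSum Finset.univ fun a (_ : a ∈ Finset.univ) => hcoord a
  rw [Finset.sum_const_zero] at hsum
  exact squeeze_zero (fun _ => norm_nonneg _) (fun q => norm_le_sum_abs _) hsum

lemma measurable_classicalScore (hC : ∀ n, IsCoxModel μ (D n) (ℱ n) τ haz β₀ F)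
    (hG : ∀ n, IsMultiplier ((D n).obs τ) μ ν (G n)) {β : ℕ → Ω → Vec p}
    (hβm : ∀ n, Measurable[(D n).obs τ] (β n)) (n : ℕ) :
    Measurable fun ω => (D n).classicalScore τ (G n) (β n ω) ω := by
  simp only [(hC n).classicalScore_eq]
  exact Finset.measurable_sum _ fun i _ => ((hG n).measurable i).smul
    (((hC n).measurable_residual i (hβm n)).mono (hC n).obs_le le_rfl)

lemma measurable_bootScore (hC : ∀ n, IsCoxModel μ (D n) (ℱ n) τ haz β₀ F)
    (hG : ∀ n, IsMultiplier ((D n).obs τ) μ ν (G n)) {β : ℕ → Ω → Vec p}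
    (hβm : ∀ n, Measurable[(D n).obs τ] (β n)) (n : ℕ) :
    Measurable fun ω => (D n).bootScore τ (G n) (β n ω) ω := by
  simp only [(hC n).bootScore_eq, SurvivalData.smul_avgScore]
  exact Finset.measurable_sum _ fun i _ => (((hG n).measurable i).add_const 1).smul
    (((hC n).measurable_residual i (hβm n)).mono (hC n).obs_le le_rfl)

end ResampledLimits

/-! ### Replacing the baseline hazard by a Borel version -/

section HazardModification

lemma timeIntegral_congr {τ t : ℝ≥0} (ht : t ≤ τ) {f g : ℝ≥0 → ℝ}
    (h : ∀ᵐ s ∂(volume.restrict (Set.Ioc (0 : ℝ) τ)), f s.toNNReal = g s.toNNReal) :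
    timeIntegral t f = timeIntegral t g := by
  rw [timeIntegral_eq, timeIntegral_eq]
  exact integral_congr_ae (ae_restrict_of_ae_restrict_of_subset
    (Set.Ioc_subset_Ioc_right (by exact_mod_cast ht)) h)

/-- Integrability only provides almost everywhere measurability on `(0, τ]`, and signs are known
only up to `τ`. The absolute value of a measurable representative repairs both. -/
lemma exists_measurable_hazard {τ : ℝ≥0} {haz : ℝ≥0 → ℝ} (hz0 : ∀ t ≤ τ, 0 ≤ haz t)
    (hzi : IntervalIntegrable (fun s : ℝ => haz s.toNNReal) volume 0 τ) :
    ∃ haz' : ℝ≥0 → ℝ, Measurable haz' ∧ (∀ t, 0 ≤ haz' t) ∧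
      ∀ᵐ s ∂(volume.restrict (Set.Ioc (0 : ℝ) τ)), haz s.toNNReal = haz' s.toNNReal := by
  have hm : AEStronglyMeasurable (fun s : ℝ => haz s.toNNReal)
      (volume.restrict (Set.Ioc (0 : ℝ) τ)) :=
    ((intervalIntegrable_iff_integrableOn_Ioc_of_le τ.2).1 hzi).aestronglyMeasurable
  refine ⟨fun t => |hm.mk _ t|, (hm.stronglyMeasurable_mk.measurable.comp
    measurable_coe_nnreal_real).abs, fun t => abs_nonneg _, ?_⟩
  filter_upwards [hm.ae_eq_mk, ae_restrict_mem measurableSet_Ioc] with s hs hmem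
  rw [Real.coe_toNNReal s hmem.1.le, ← hs, abs_of_nonneg (hz0 _ (toNNReal_le_of_mem_Ioc hmem))]

/-- The hazard enters the model only through time integrals up to `τ`. -/
lemma IsCoxModel.congr_hazard {Ω : Type*} [mΩ : MeasurableSpace Ω] {μ : Measure Ω} {n p : ℕ}
    {D : SurvivalData Ω n p} {ℱ : Filtration ℝ≥0 mΩ} {τ : ℝ≥0} {haz haz' : ℝ≥0 → ℝ} {β₀ : Vec p}
    {F : Set (Vec p)} (hC : IsCoxModel μ D ℱ τ haz β₀ F)
    (h : ∀ᵐ s ∂(volume.restrict (Set.Ioc (0 : ℝ) τ)), haz s.toNNReal = haz' s.toNNReal) :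
    IsCoxModel μ D ℱ τ haz' β₀ F := by
  refine { hC with martingale := fun i => ?_ }
  have hM := hC.martingale i
  have e : ∀ t ω, timeIntegral (min t τ)
      (fun s => D.Y i s ω * haz s * Real.exp (inner ℝ (D.X i s ω) β₀)) = timeIntegral (min t τ)
      (fun s => D.Y i s ω * haz' s * Real.exp (inner ℝ (D.X i s ω) β₀)) := fun t ω => by
    refine timeIntegral_congr (min_le_right t τ) ?_
    filter_upwards [h] with s hs
    rw [hs]
  simpa only [e] using hM

lemma limitSigma_congr_hazard {p : ℕ} {τ : ℝ≥0} {haz haz' : ℝ≥0 → ℝ} {β₀ : Vec p}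
    (h : ∀ᵐ s ∂(volume.restrict (Set.Ioc (0 : ℝ) τ)), haz s.toNNReal = haz' s.toNNReal)
    (s0 : ℝ≥0 → Vec p → ℝ) (s1 : ℝ≥0 → Vec p → Vec p)
    (s2 : ℝ≥0 → Vec p → Matrix (Fin p) (Fin p) ℝ) :
    limitSigma τ haz β₀ s0 s1 s2 = limitSigma τ haz' β₀ s0 s1 s2 := by
  ext a c
  simp only [limitSigma, Matrix.of_apply]
  refine timeIntegral_congr le_rfl ?_
  filter_upwards [h] with s hs
  rw [hs]

end HazardModification

end WildBootstrap

end

/-! ### The main theorem -/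

theorem lemma1 {Ω : Type*} [mΩ : MeasurableSpace Ω] (μ : Measure Ω) [IsProbabilityMeasure μ]
    (p : ℕ) (τ : ℝ≥0) (hτ : 0 < τ)
    -- baseline hazard, with finite cumulative hazard on `[0, τ]`, and true parameter
    (haz : ℝ≥0 → ℝ) (haz_nonneg : ∀ t ≤ τ, 0 ≤ haz t)
    (haz_int : IntervalIntegrable (fun s : ℝ => haz s.toNNReal) volume 0 τ)
    (β₀ : WildBootstrap.Vec p)
    -- for each sample size `n`, data from the Cox model with covariates in a common bounded set
    (F : Set (WildBootstrap.Vec p)) (hF : Bornology.IsBounded F)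
    (D : (n : ℕ) → WildBootstrap.SurvivalData Ω n p) (ℱ : ℕ → Filtration ℝ≥0 mΩ)
    (hCox : ∀ n, WildBootstrap.IsCoxModel μ (D n) (ℱ n) τ haz β₀ F)
    -- regularity conditions
    (B : Set (WildBootstrap.Vec p)) (s0 : ℝ≥0 → WildBootstrap.Vec p → ℝ)
    (s1 : ℝ≥0 → WildBootstrap.Vec p → WildBootstrap.Vec p)
    (s2 : ℝ≥0 → WildBootstrap.Vec p → Matrix (Fin p) (Fin p) ℝ)
    (hReg : WildBootstrap.RegularityConditions μ D τ haz β₀ B s0 s1 s2)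
    -- i.i.d. multipliers with mean zero and unit variance, independent of the data
    (ν : Measure ℝ) [IsProbabilityMeasure ν] (hν_mean : ∫ x, x ∂ν = 0)
    (hν_var : ∫ x, x ^ 2 ∂ν = 1)
    (G : (n : ℕ) → Fin n → Ω → ℝ)
    (hG : ∀ n, WildBootstrap.IsMultiplier ((D n).obs τ) μ ν (G n))
    -- the estimator `β̂`: a function of the data solving the score equation if it has a solution
    (βhat : ℕ → Ω → WildBootstrap.Vec p) (hβhat_meas : ∀ n, Measurable[(D n).obs τ] (βhat n))
    (hβhat : ∀ n, ∀ᵐ ω ∂μ,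
      (∃ β, (D n).score τ β ω = 0) → (D n).score τ (βhat n ω) ω = 0) :
    -- asymptotic normality of the resampled score, in the form used by either scheme
    WildBootstrap.CondTendstoInLaw μ (fun n => (D n).obs τ)
      (fun n ω => (Real.sqrt n)⁻¹ • (D n).classicalScore τ (G n) (βhat n ω) ω)
      (multivariateGaussian 0 (WildBootstrap.limitSigma τ haz β₀ s0 s1 s2)) ∧
    WildBootstrap.CondTendstoInLaw μ (fun n => (D n).obs τ)
      (fun n ω => (Real.sqrt n)⁻¹ • (D n).bootScore τ (G n) (βhat n ω) ω)
      (multivariateGaussian 0 (WildBootstrap.limitSigma τ haz β₀ s0 s1 s2)) ∧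
    -- convergence of the mean-value Jacobian at arbitrary random points tending to `β₀`, and of
    -- the matrix that takes its place in the classical scheme
    (∀ b : (n : ℕ) → Fin p → Ω → WildBootstrap.Vec p, (∀ n a, Measurable (b n a)) →
      (∀ a, TendstoInMeasure μ (fun n => b n a) atTop (fun _ => β₀)) →
      ∀ a c, WildBootstrap.CondTendstoZero μ (fun n => (D n).obs τ) (fun n ω =>
        -((n : ℝ)⁻¹ * (D n).bootJacobian τ (G n) (fun j => b n j ω) ω a c) -
          WildBootstrap.limitSigma τ haz β₀ s0 s1 s2 a c)) ∧
    (∀ a c, WildBootstrap.CondTendstoZero μ (fun n => (D n).obs τ) (fun n ω =>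
      (n : ℝ)⁻¹ * (D n).classicalInfo τ (G n) (βhat n ω) ω a c -
        WildBootstrap.limitSigma τ haz β₀ s0 s1 s2 a c)) ∧
    -- consistency: the classical estimator, and every solution of the resampled score equation
    WildBootstrap.CondTendstoZero μ (fun n => (D n).obs τ)
      (fun n ω => ‖(D n).classicalEstimator τ (G n) (βhat n) ω - βhat n ω‖) ∧
    (∀ βstar : ℕ → Ω → WildBootstrap.Vec p, (∀ n, Measurable (βstar n)) →
      (∀ n, ∀ᵐ ω ∂μ, (∃ β, (D n).bootScore τ (G n) β ω = 0) →
        (D n).bootScore τ (G n) (βstar n ω) ω = 0) →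
      WildBootstrap.CondTendstoZero μ (fun n => (D n).obs τ)
        (fun n ω => ‖βstar n ω - βhat n ω‖)) := by
  obtain ⟨haz', hz, hz0, heq⟩ := WildBootstrap.exists_measurable_hazard haz_nonneg haz_int
  have hC := fun n => (hCox n).congr_hazard heq
  have hSg := WildBootstrap.limitSigma_congr_hazard heq s0 s1 s2 (β₀ := β₀)
  have hzi : IntervalIntegrable (fun s : ℝ => haz' s.toNNReal) volume 0 τ :=
    (intervalIntegrable_iff_integrableOn_Ioc_of_le τ.2).2
      (((intervalIntegrable_iff_integrableOn_Ioc_of_le τ.2).1 haz_int).congr heq)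
  have hR : WildBootstrap.RegularityConditions μ D τ haz' β₀ B s0 s1 s2 :=
    { hReg with posDef := hSg ▸ hReg.posDef }
  rw [hSg]
  obtain ⟨C, hC0, hFC⟩ := hF.exists_pos_norm_le
  -- The second moment is finite, since otherwise its integral would be zero by convention, not one.
  have h2 : MemLp id 2 ν := by
    refine (memLp_two_iff_integrable_sq measurable_id.aestronglyMeasurable).2 ?_
    by_contra hcon
    have := integral_undef hcon
    simp only [id] at this
    rw [hν_var] at this
    exact one_ne_zero this
  obtain ⟨hcons, hzero⟩ := WildBootstrap.estimator_consistent hC hC0.le hFC hz hz0 hzi hR hβhat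
  have hobs : ∀ n, (D n).obs τ ≤ mΩ := fun n => (hC n).obs_le
  have hCLT := WildBootstrap.condTendstoInLaw_classicalScore hC hC0.le hFC hz hz0 hzi hR hG hν_mean
    hν_var hβhat_meas hcons
  refine ⟨hCLT, ?_, ?_, ?_, ?_, ?_⟩
  -- The score vanishes at the estimator with probability tending to one, and there both resampled
  -- scores are equal.
  · refine hCLT.congr (fun n => ?_) (fun n => ?_) ?_
    · have h := (WildBootstrap.measurable_classicalScore hC hG hβhat_meas n).const_smul (Real.sqrt n)⁻¹
      exact h
    · have h := (WildBootstrap.measurable_bootScore hC hG hβhat_meas n).const_smul (Real.sqrt n)⁻¹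
      exact h
    · filter_upwards [hzero] with q hq
      rw [(hC q.1).bootScore_eq_add, hq, add_zero]
  · intro b _ hb a c
    refine WildBootstrap.condTendstoZero_of_tendsto hobs ?_
    simp only [(hC _).bootJacobian_eq]
    have := (WildBootstrap.tendsto_avgCov_boot hC hC0.le hFC hz hz0 hzi hR hG hν_mean h2
      (WildBootstrap.tendstoInMeasure_iff_probFilter.1 (hb a)) a c).sub_const
        (WildBootstrap.limitSigma τ haz' β₀ s0 s1 s2 a c)
    rwa [sub_self] at this
  · intro a c
    refine WildBootstrap.condTendstoZero_of_tendsto hobs ?_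
    have := (WildBootstrap.tendsto_average_classicalInfo hC hC0.le hFC hz hz0 hzi hR hG hν_var h2
      hβhat_meas hcons a c).sub_const (WildBootstrap.limitSigma τ haz' β₀ s0 s1 s2 a c)
    rwa [sub_self] at this
  · exact WildBootstrap.condTendstoZero_of_tendsto hobs
      (WildBootstrap.tendsto_classicalEstimator_sub hC hC0.le hFC hz hz0 hzi hR hG hν_mean hν_var h2
        hβhat_meas hcons)
  -- Both estimators tend to the true parameter in probability, hence so does their difference to
  -- zero.
  · intro βstar _ hβstar
    refine WildBootstrap.condTendstoZero_of_tendsto hobs ?_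
    have := ((WildBootstrap.boot_consistent hC hC0.le hFC hz hz0 hzi hR hG hν_mean h2 hβstar).sub
      hcons).norm
    rwa [sub_self, norm_zero] at this
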